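/- **Setting.** Let $L>0$ and $\mathbb T^3=\mathbb R^3/(L\mathbb Z)^3$; $\langle\cdot,\cdot\rangle$ is the $L^2(\mathbb T^3)$ pairing of vector fields. Let $\chi\in C_c^\infty(\mathbb R^3)$ be nonnegative and radial with $\chi(\xi)=1$ for $|\xi|\le 3/4$ and $\chi(\xi)=0$ for $|\xi|\ge1$; put $\varphi_{-1}=\chi$ and $\varphi_q(\xi)=\chi(2^{-q-1}\xi)-\chi(2^{-q}\xi)$ for $q\ge0$, $$\Delta_q v(x)=\sum_{k\in\mathbb Z^3}\hat v(k)\,\varphi_q(k)\,e^{i\frac{2\pi}{L}k\cdot x},\qquad S_q v=\sum_{p=-1}^q\Delta_p v .$$ For a non-negative sequence $c=(c_n)_{n\ge1}\in\ell^1$ let $\|v\|_{B^{1/3,c_n}_{3,\infty}}=\sum_{q\ge-1}c_{q+2}\,2^{q/3}\|\Delta_q v\|_{L^3(\mathbb T^3)}$. *Weak Euler solutions.* $u\in C_w([0,T];L^2(\mathbb T^3))$ is a weak solution of the Euler equations $\partial_t u+u\cdot\nabla u+\nabla p=f$, $\nabla\cdot u=0$, $u(0)=u_{\rm in}$, with $f\in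 L^1([0,T];L^1(\mathbb T^3))$, if $u(t)$ is weakly divergence free for every $t\in[0,T]$, $u(0)=u_{\rm in}$, and for all smooth divergence-free periodic $\phi(x,t)$ $$\int_0^T\!\!\int_{\mathbb T^3}\big(u\cdot\partial_t\phi+(u\otimes u):\nabla\phi+f\cdot\phi\big)\,dx\,dt=\int_{\mathbb T^3}u(T)\cdot\phi(T)\,dx-\int_{\mathbb T^3}u_{\rm in}\cdot\phi(0)\,dx .$$ *Finite energy input.* $(u,f)$ is a smooth Euler solution with finite energy input if $u,f\in C^\infty(\mathbb T^3\times[0,T))$ satisfy the Euler equations there with a smooth pressure, $u\in L^\infty([0,T];L^2)$, $\langle f,u\rangle\in L^1_{\rm loc}([0,T))$, $\lim_{t\to T^-}\int_0^t\langle f,u\rangle\,d\tau$ exists, and $\lim_{t\to T^-}f(t)$ exists in $\mathcal D'(\mathbb T^3)$. *Anomalous work.* For such a pair and $h>0$, put $$\Phi_q(t,h)=\int_{[t-h,t+h]\cap[0,T]}\big(\langle S_qf,S_qu\rangle-\langle f,u\rangle\big)\,d\tau\quad(t<T),$$ $$\Phi_q(T,h)=\int_{\max(T-h,0)}^T\langle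 S_qf,S_qu\rangle\,d\tau-\lim_{t_1\to T^-}\int_{\max(T-h,0)}^{t_1}\langle f,u\rangle\,d\tau .$$ The amount of anomalous work of $f$ is zero if $\limsup_{q\to\infty}|\Phi_q(t,h)|=0$ for every $t\in[0,T]$ and every $h>0$ (with $t+h<T$ when $t<T$). **Theorem.** There are $T>0$, viscosities $\nu_n>0$ with $\nu_n\to0$, a divergence-free field $u_{\rm in}\in L^2(\mathbb T^3)$ with $u_{\rm in}\ne0$, and smooth $u^n,f^{\nu_n}$ on $\mathbb T^3\times[0,T]$ solving, with smooth pressures $p^n$, $$\partial_tu^n+u^n\cdot\nabla u^n+\nabla p^n=f^{\nu_n}+\nu_n\Delta u^n,\qquad \nabla\cdot u^n=0,\qquad u^n(0)=u_{\rm in},$$ and there is a pair $(u,f)$, which is a smooth Euler solution on $\mathbb T^3\times[0,T)$ with finite energy input, such that: 1. $u^n\to u$ in $L^\infty([0,T];L^2(\mathbb T^3))$, and $f^{\nu_n}\to f$ in $L^1([0,T];L^r(\mathbb T^3))$ for every $0<r<2$. 2. $(u,f)$ is a weak solution of the Euler equations on $[0,T]$ with $u(0)=u_{\rm in}$, and $u\in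 L^3([0,T];B^{1/3,c_n}_{3,\infty}(\mathbb T^3))$ for every non-negative $(c_n)\in\ell^1$. 3. $\displaystyle\limsup_{q\to\infty}\int_0^T2^q\,\|\Delta_qu(t)\|_{L^3(\mathbb T^3)}^3\,dt<\infty$, and the amount of anomalous work of $f$ is zero. 4. The family has total viscous anomalous dissipation and does zero work: $$\lim_{n\to\infty}2\nu_n\int_0^T\|\nabla u^n(t)\|_{L^2}^2\,dt=\|u_{\rm in}\|_{L^2}^2,\qquad \int_0^T\langle f^{\nu_n},u^n\rangle\,dt=0\quad\text{for all }n .$$ -/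

import Mathlib

open MeasureTheory Set Filter Topology
open scoped ENNReal ContDiff RealInnerProductSpace

noncomputable section

/-- Three-dimensional Euclidean space. Functions on the torus `𝕋³ = ℝ³ / (L ℤ)³` are represented
by functions on `ℝ³` that are `L`-periodic in each coordinate. -/
abbrev E3 := EuclideanSpace ℝ (Fin 3)

/-- The `i`-th standard unit vector. -/
def unitVec (i : Fin 3) : E3 := EuclideanSpace.single i 1

/-- `L`-periodicity in each of the three coordinates. -/
def IsPeriodic {F : Type} (L : ℝ) (v : E3 → F) : Prop :=
  ∀ (i : Fin 3) (x : E3), v (x + L • unitVec i) = v x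

/-- Lebesgue measure on the fundamental cube `[0,L)³`; integration over `𝕋³`. -/
def torusMeasure (L : ℝ) : Measure E3 :=
  volume.restrict {x : E3 | ∀ i, x i ∈ Ico 0 L}

/-- The divergence `∑ᵢ ∂ᵢ vᵢ`. -/
def divergence (v : E3 → E3) (x : E3) : ℝ := ∑ i, (fderiv ℝ v x (unitVec i)) i

/-- `|∇v(x)|² = ∑ⱼ |∂ⱼ v(x)|² = ∑ᵢⱼ |∂ⱼ vᵢ(x)|²` (Frobenius norm of the gradient). -/
def gradSq (v : E3 → E3) (x : E3) : ℝ := ∑ j, ‖fderiv ℝ v x (unitVec j)‖ ^ 2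

/-- The `L²(𝕋³)` pairing of two vector fields. -/
def pairing (L : ℝ) (v w : E3 → E3) : ℝ := ∫ x, ⟪v x, w x⟫ ∂torusMeasure L

/-- The norm of `v` in `L^p([0,T]; L^r(𝕋³))`, with values in `[0,∞]`. -/
def mixedNorm (L T : ℝ) (p r : ℝ≥0∞) (v : ℝ → E3 → E3) : ℝ≥0∞ :=
  eLpNorm (fun t => eLpNorm (v t) r (torusMeasure L)) p (volume.restrict (Icc 0 T))

/-- `(u, f)` is a smooth solution on `𝕋³ × I` of
`∂ₜu + u·∇u + ∇p = f + ν Δu`, `div u = 0`, for some smooth pressure `p`; with `ν > 0` these are the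
Navier–Stokes equations and with `ν = 0` the Euler equations. `I` is a time interval, and all
functions are smooth up to the endpoints that belong to `I`. -/
structure IsSmoothSolution (L ν : ℝ) (I : Set ℝ) (u f : ℝ → E3 → E3) : Prop where
  periodic_u : ∀ t ∈ I, IsPeriodic L (u t)
  periodic_f : ∀ t ∈ I, IsPeriodic L (f t)
  smooth_u : ContDiffOn ℝ ∞ (fun z : ℝ × E3 => u z.1 z.2) (I ×ˢ univ)
  smooth_f : ContDiffOn ℝ ∞ (fun z : ℝ × E3 => f z.1 z.2) (I ×ˢ univ)
  div_free : ∀ t ∈ I, ∀ x, divergence (u t) x = 0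
  momentum : ∃ p : ℝ → E3 → ℝ, (∀ t ∈ I, IsPeriodic L (p t)) ∧
    ContDiffOn ℝ ∞ (fun z : ℝ × E3 => p z.1 z.2) (I ×ˢ univ) ∧
    ∀ t ∈ I, ∀ x,
      derivWithin (fun s => u s x) I t + fderiv ℝ (u t) x (u t x) + gradient (p t) x
        = f t x + ν • Laplacian.laplacian (u t) x

/-- `u ∈ C_w([0,T]; L²(𝕋³))` is a weak solution of the Euler equations with force `f` and initial
datum `uin`. The test fields are smooth, periodic and divergence free and need not vanish at the
endpoints of `[0,T]`; `⟪u, (u·∇)φ⟫ = (u ⊗ u) : ∇φ`. -/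
structure IsWeakEulerSolution (L T : ℝ) (u f : ℝ → E3 → E3) (uin : E3 → E3) : Prop where
  periodic_u : ∀ t ∈ Icc 0 T, IsPeriodic L (u t)
  memLp : ∀ t ∈ Icc 0 T, MemLp (u t) 2 (torusMeasure L)
  weakly_continuous : ∀ ψ : E3 → E3, MemLp ψ 2 (torusMeasure L) →
    ContinuousOn (fun t => pairing L (u t) ψ) (Icc 0 T)
  force_integrable : mixedNorm L T 1 1 f < ⊤
  weakly_div_free : ∀ t ∈ Icc 0 T, ∀ ψ : E3 → ℝ, ContDiff ℝ ∞ ψ → IsPeriodic L ψ →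
    pairing L (u t) (gradient ψ) = 0
  initial : u 0 =ᵐ[torusMeasure L] uin
  weak_form : ∀ φ : ℝ → E3 → E3, ContDiff ℝ ∞ (fun z : ℝ × E3 => φ z.1 z.2) →
    (∀ t, IsPeriodic L (φ t)) → (∀ t x, divergence (φ t) x = 0) →
    ∫ t in 0..T, ∫ x, (⟪u t x, deriv (fun s => φ s x) t⟫
          + ⟪u t x, fderiv ℝ (φ t) x (u t x)⟫ + ⟪f t x, φ t x⟫) ∂torusMeasure L
      = pairing L (u T) (φ T) - pairing L uin (φ 0)

/-- `(u, f)` is a smooth solution of the Euler equations on `𝕋³ × [0,T)` with finite energy input.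
In the last field, convergence in `𝓓'(𝕋³)` is convergence against each test field (the limit
functional is then automatically a distribution, by the uniform boundedness principle). -/
structure HasFiniteEnergyInput (L T : ℝ) (u f : ℝ → E3 → E3) : Prop where
  solution : IsSmoothSolution L 0 (Ico 0 T) u f
  bounded : mixedNorm L T ⊤ 2 u < ⊤
  work_locallyIntegrable : LocallyIntegrableOn (fun t => pairing L (f t) (u t)) (Ico 0 T)
  work_limit : ∃ w : ℝ, Tendsto (fun t => ∫ s in 0..t, pairing L (f s) (u s)) (𝓝[<] T) (𝓝 w)
  force_limit : ∀ ψ : E3 → E3, ContDiff ℝ ∞ ψ → IsPeriodic L ψ →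
    ∃ ℓ : ℝ, Tendsto (fun t => pairing L (f t) ψ) (𝓝[<] T) (𝓝 ℓ)

/-- The low-frequency cut-off from which the Littlewood–Paley decomposition is built. -/
structure IsCutoff (χ : E3 → ℝ) : Prop where
  smooth : ContDiff ℝ ∞ χ
  nonneg : ∀ ξ, 0 ≤ χ ξ
  radial : ∀ ξ η, ‖ξ‖ = ‖η‖ → χ ξ = χ η
  eq_one : ∀ ξ, ‖ξ‖ ≤ 3 / 4 → χ ξ = 1
  eq_zero : ∀ ξ, 1 ≤ ‖ξ‖ → χ ξ = 0

/-- The multiplier `φ_q`, with index `j = q + 1 ≥ 0`: `φ₋₁ = χ` and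
`φ_q(ξ) = χ(2⁻ᵠ⁻¹ ξ) - χ(2⁻ᵠ ξ)` for `q ≥ 0`. -/
def lpSymbol (χ : E3 → ℝ) : ℕ → E3 → ℝ
  | 0, ξ => χ ξ
  | q + 1, ξ => χ (((2 : ℝ) ^ (q + 1))⁻¹ • ξ) - χ (((2 : ℝ) ^ q)⁻¹ • ξ)

/-- An integer frequency as a vector of `ℝ³`. -/
def freq (k : Fin 3 → ℤ) : E3 := WithLp.toLp 2 (fun i => (k i : ℝ))

/-- The character `e^{i (2π/L) k·x}`. -/
def character (L : ℝ) (k : Fin 3 → ℤ) (x : E3) : ℂ :=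
  Complex.exp (Complex.I * ((2 * Real.pi / L * ⟪freq k, x⟫ : ℝ) : ℂ))

/-- The `k`-th Fourier coefficient of the `i`-th component of `v`. -/
def fourierCoefficient (L : ℝ) (v : E3 → E3) (k : Fin 3 → ℤ) (i : Fin 3) : ℂ :=
  ((L ^ 3 : ℝ) : ℂ)⁻¹ * ∫ x, ((v x i : ℝ) : ℂ) * character L (-k) x ∂torusMeasure L

/-- The Littlewood–Paley block `Δ_q v = ∑ₖ v̂(k) φ_q(k) e^{i (2π/L) k·x}`, with index
`j = q + 1 ≥ 0`. The sum is finite, and it is real because `v` is real and `φ_q` is even, so that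
taking the real part only changes the type. -/
def lpBlock (χ : E3 → ℝ) (L : ℝ) (j : ℕ) (v : E3 → E3) (x : E3) : E3 :=
  WithLp.toLp 2 (fun i =>
    (∑' k : Fin 3 → ℤ,
      fourierCoefficient L v k i * (lpSymbol χ j (freq k) : ℂ) * character L k x).re)

/-- The low-frequency cut-off operator `S_q v = ∑_{p=-1}^{q} Δ_p v`, for `q ≥ 0`. -/
def lowPass (χ : E3 → ℝ) (L : ℝ) (q : ℕ) (v : E3 → E3) (x : E3) : E3 :=
  ∑ j ∈ Finset.range (q + 2), lpBlock χ L j v x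

/-- The weighted Besov norm
`∑_{q ≥ -1} a_{q+2} 2^{q s} ‖Δ_q v‖_{L^p}`, in `[0,∞]`, written with `j = q + 1`. -/
def weightedBesovNorm (χ : E3 → ℝ) (L s : ℝ) (p : ℝ≥0∞) (a : ℕ → ℝ) (v : E3 → E3) : ℝ≥0∞ :=
  ∑' j : ℕ, ENNReal.ofReal (a (j + 1)) * ENNReal.ofReal ((2 : ℝ) ^ (s * ((j : ℝ) - 1)))
    * eLpNorm (lpBlock χ L j v) p (torusMeasure L)

/-- The anomalous work `Φ_q(t,h)` at the `q`-th dyadic shell. -/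
def shellAnomalousWork (χ : E3 → ℝ) (L T : ℝ) (u f : ℝ → E3 → E3) (q : ℕ) (t h : ℝ) : ℝ :=
  if t < T then
    ∫ τ in Icc (t - h) (t + h) ∩ Icc 0 T,
      (pairing L (lowPass χ L q (f τ)) (lowPass χ L q (u τ)) - pairing L (f τ) (u τ))
  else
    (∫ τ in (max (T - h) 0)..T, pairing L (lowPass χ L q (f τ)) (lowPass χ L q (u τ)))
      - limUnder (𝓝[<] T) (fun t₁ => ∫ τ in (max (T - h) 0)..t₁, pairing L (f τ) (u τ))

/-- The amount of anomalous work `Φ(t) = limsup_q |Φ_q(t,h)|`, in `[0,∞]`. -/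
def anomalousWork (χ : E3 → ℝ) (L T : ℝ) (u f : ℝ → E3 → E3) (t h : ℝ) : ℝ≥0∞ :=
  limsup (fun q => ENNReal.ofReal |shellAnomalousWork χ L T u f q t h|) atTop

end

/-! All fields are shears $g(t,x_0)e_1$. For these the divergence and the convective term vanish
identically, so any smooth $u$ of this kind solves the equations with zero pressure once the force
is declared to be $\partial_tu-\nu\Delta u$. What remains is to choose $u$ so that the viscous part
of the force is negligible although its dissipation is not.

Take $T=1$ and $u=\sum_m a_m(t)\,b_m$, where the bumps $a_m$ have disjoint supports of duration
$\tau_m\sim2^{-16m}$ accumulating at $t=1$, and $b_m$ is a cosine of frequency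
$\lambda_m\sim2^{10m}$ times a Fejér kernel of width $N_m\sim2^{2m}$, with amplitude
$A_m=(m+1)^{-2}2^{-3m}$. The field $u^n$ keeps the stages $m\le n$. At most one stage is active at a
time, so energies, enstrophies and cubed Besov norms split over the stages without cross terms. The
exponents are tuned to the following estimates.

- $\|b_m\|_{L^2}\lesssim(m+1)^{-2}$ is summable and $\int|a_m'|$ is bounded: $u^n\to u$ uniformly in
time, and $f=\sum a_m'b_m$ is integrable in time. -
$\tau_m\lambda_m\|b_m\|_\infty^3\lesssim2^{-3m}$: the critical Besov bounds (`exists_besov_bound`).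
- $\tau_m\|\nabla b_m\|_{L^2}^2\gtrsim2^{4m}(m+1)^{-4}$: the total enstrophy diverges
(`exists_le_enstrophy_rate`), so the viscosity $\nu_n$ making the dissipation of $u^n$ equal to
$\|u_{\rm in}\|_{L^2}^2$ tends to zero. - $\|\Delta
b_m\|_{L^r}\lesssim(m+1)^2\,2^{(1-2/r)m}\,\|\nabla b_m\|_{L^2}^2$ for $1\le r<2$
(`exists_laplacian_rate`): the viscous force is bounded by a weighted average of a null sequence
whose weights have divergent sum, and vanishes in $L^1L^r$. - $\tau_m^{-1}\lambda_m^{-2}\sim2^{-4m}$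
beats $A_mN_m^2\lesssim2^m$: the force tends to $0$ in distributions as $t\to1^-$
(`tendsto_stageRate_mul_pairing`).

The velocity starts at $b_0$ and ends at $0$. The work of the force on $u^n$ is therefore
$-\frac12\|b_0\|^2$ plus $\nu_n$ times the integrated enstrophy, that is zero. For the limit, the
work over $[c,d]$ is $\sum_m\frac12(a_m(d)^2-a_m(c)^2)\|b_m\|^2$, in which only the stages active at
$c$ or $d$ survive. Low-pass filters of high order leave those profiles unchanged, so the anomalous
work is exactly zero for large $q$ (`eventually_energyJump_eq`). -/

/-! ### Integration over the torus -/

/-- The closed fundamental cube `[0,L]³`. -/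
def closedCube (L : ℝ) : Set E3 := {x | ∀ i, x i ∈ Icc 0 L}

/-- Fubini for products of one-variable functions and the divergence theorem on boxes live on the
plain product space; torus integrals reach them through this map. -/
theorem torusMeasure_map_ofLp (L : ℝ) :
    MeasurePreserving (WithLp.ofLp : E3 → Fin 3 → ℝ) (torusMeasure L)
      (Measure.pi fun _ => (volume : Measure ℝ).restrict (Ico 0 L)) := by
  rw [← Measure.restrict_pi_pi]
  have h := (PiLp.volume_preserving_ofLp (Fin 3)).restrict_preimage
    (s := univ.pi fun _ : Fin 3 => Ico 0 L) (MeasurableSet.univ_pi fun _ => measurableSet_Ico)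
  have e : (WithLp.ofLp : E3 → Fin 3 → ℝ) ⁻¹' (univ.pi fun _ : Fin 3 => Ico 0 L)
      = {x : E3 | ∀ i, x i ∈ Ico 0 L} := by
    ext x; simp
  rw [e] at h
  exact h

theorem integral_torus_prod {L : ℝ} (f : Fin 3 → ℝ → ℂ) :
    ∫ x, ∏ i, f i (x i) ∂torusMeasure L = ∏ i, ∫ s in Ico 0 L, f i s := by
  rw [← integral_fintype_prod_eq_prod (𝕜 := ℂ) f]
  exact (torusMeasure_map_ofLp L).integral_comp
    (MeasurableEquiv.toLp 2 (Fin 3 → ℝ)).symm.measurableEmbedding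
    (fun y : Fin 3 → ℝ => ∏ i, f i (y i))

theorem integral_torus_coord {L : ℝ} (hL : 0 ≤ L) (F : ℝ → ℝ) :
    ∫ x, F (x 0) ∂torusMeasure L = L ^ 2 * ∫ s in 0..L, F s := by
  have h := (torusMeasure_map_ofLp L).integral_comp
    (MeasurableEquiv.toLp 2 (Fin 3 → ℝ)).symm.measurableEmbedding
    (fun y : Fin 3 → ℝ => ∏ i, (![F, fun _ => 1, fun _ => 1] : Fin 3 → ℝ → ℝ) i (y i))
  rw [integral_fintype_prod_eq_prod (𝕜 := ℝ)] at h
  simp only [Fin.prod_univ_three, Matrix.cons_val_zero, Matrix.cons_val_one, Matrix.cons_val,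
    mul_one, integral_const, smul_eq_mul] at h
  refine h.trans ?_
  rw [intervalIntegral.integral_of_le hL, integral_Ico_eq_integral_Ioo, integral_Ioc_eq_integral_Ioo]
  simp [Measure.real, hL]
  ring

theorem isCompact_closedCube (L : ℝ) : IsCompact (closedCube L) := by
  have h : IsCompact (univ.pi fun _ : Fin 3 => Icc (0 : ℝ) L) :=
    isCompact_univ_pi fun _ => isCompact_Icc
  have := h.image (PiLp.continuous_toLp 2 (fun _ : Fin 3 => ℝ))
  convert this using 1
  ext x
  constructor
  · intro hx
    exact ⟨WithLp.ofLp x, fun i _ => hx i, rfl⟩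
  · rintro ⟨y, hy, rfl⟩ i
    exact hy i (mem_univ i)

theorem ae_mem_closedCube (L : ℝ) : ∀ᵐ x ∂torusMeasure L, x ∈ closedCube L := by
  have hm : MeasurableSet {x : E3 | ∀ i, x i ∈ Ico 0 L} := by
    have : {x : E3 | ∀ i, x i ∈ Ico 0 L}
      = (WithLp.ofLp : E3 → Fin 3 → ℝ) ⁻¹' (univ.pi fun _ : Fin 3 => Ico 0 L) := by
        ext x; simp
    rw [this]
    exact (PiLp.continuous_ofLp 2 _).measurable (MeasurableSet.univ_pi fun _ => measurableSet_Ico)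
  filter_upwards [ae_restrict_mem hm] with x hx i
  exact ⟨(hx i).1, (hx i).2.le⟩

theorem torusMeasure_univ (L : ℝ) :
    torusMeasure L univ = ENNReal.ofReal L ^ 3 := by
  have h := (torusMeasure_map_ofLp L).measure_preimage (s := univ) MeasurableSet.univ.nullMeasurableSet
  rw [preimage_univ] at h
  rw [h, Measure.pi_univ]
  simp

instance (L : ℝ) : IsFiniteMeasure (torusMeasure L) :=
  ⟨by rw [torusMeasure_univ]; exact ENNReal.pow_lt_top ENNReal.ofReal_lt_top⟩

theorem exists_bound_on_cube {F : Type*} [NormedAddCommGroup F] (L : ℝ) {h : E3 → F}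
    (hh : Continuous h) : ∃ C : ℝ, 0 ≤ C ∧ ∀ x ∈ closedCube L, ‖h x‖ ≤ C := by
  obtain ⟨C, hC⟩ := (isCompact_closedCube L).exists_bound_of_continuousOn hh.continuousOn
  exact ⟨max C 0, le_max_right _ _, fun x hx => (hC x hx).trans (le_max_left _ _)⟩

theorem memLp_torus {F : Type*} [NormedAddCommGroup F] [SecondCountableTopologyEither E3 F]
    (L : ℝ) {h : E3 → F} (hh : Continuous h) (p : ℝ≥0∞) : MemLp h p (torusMeasure L) := by
  obtain ⟨C, -, hC⟩ := exists_bound_on_cube L hh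
  exact MemLp.of_bound hh.aestronglyMeasurable C ((ae_mem_closedCube L).mono hC)

theorem integrable_torus {F : Type*} [NormedAddCommGroup F] [SecondCountableTopologyEither E3 F]
    (L : ℝ) {h : E3 → F} (hh : Continuous h) : Integrable h (torusMeasure L) :=
  memLp_one_iff_integrable.1 (memLp_torus L hh 1)

/-- The integral of a derivative of a periodic function over the torus vanishes. -/
theorem integral_torus_fderiv_eq_zero {L : ℝ} (hL : 0 ≤ L) {h : E3 → ℝ} (hh : ContDiff ℝ 1 h)
    (hp : IsPeriodic L h) (i : Fin 3) :
    ∫ x, fderiv ℝ h x (unitVec i) ∂torusMeasure L = 0 := by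
  set e : (Fin 3 → ℝ) →L[ℝ] E3 :=
    (PiLp.continuousLinearEquiv 2 ℝ (fun _ : Fin 3 => ℝ)).symm.toContinuousLinearMap with he
  have he' : ∀ y, e y = WithLp.toLp 2 y := fun y => rfl
  have hd : ∀ y, HasFDerivAt (fun y => h (e y)) ((fderiv ℝ h (e y)).comp e) y := fun y =>
    ((hh.differentiable one_ne_zero) (e y)).hasFDerivAt.comp y e.hasFDerivAt
  have hcont : Continuous fun y => fderiv ℝ h (e y) (unitVec i) :=
    ((hh.continuous_fderiv one_ne_zero).comp e.continuous).clm_apply continuous_const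
  -- The divergence theorem is applied to the field whose only nonzero component is the $i$-th one,
  -- equal to $h$.
  have key := integral_divergence_of_hasFDerivAt_off_countable' (n := 2) (E := ℝ)
    (a := fun _ => (0 : ℝ)) (b := fun _ => L) (fun _ => hL)
    (fun j y => if j = i then h (e y) else 0)
    (fun j y => if j = i then (fderiv ℝ h (e y)).comp e else 0) ∅ countable_empty
    (fun j => by
      by_cases hj : j = i
      · simp only [hj, if_true]; exact (hh.continuous.comp e.continuous).continuousOn
      · simp only [hj, if_false]; exact continuousOn_const)
    (fun y _ j => by
      by_cases hj : j = i
      · simp only [hj, if_true]; exact hd y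
      · simp only [hj, if_false]; exact hasFDerivAt_const _ _)
    (by
      refine ContinuousOn.integrableOn_compact isCompact_Icc (Continuous.continuousOn ?_)
      refine continuous_finsetSum _ fun j _ => ?_
      by_cases hj : j = i
      · simp only [hj, if_true]
        exact ((hh.continuous_fderiv one_ne_zero).comp e.continuous).clm_apply continuous_const
      · simp only [hj, if_false]; exact continuous_const)
  have hs : ∀ y, (∑ j, (if j = i then (fderiv ℝ h (e y)).comp e else 0) (Pi.single j (1 : ℝ)))
      = fderiv ℝ h (e y) (unitVec i) := by
    intro y
    rw [Finset.sum_eq_single i]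
    · simp only [if_true]; rfl
    · intro j _ hj; simp [hj]
    · simp
  simp only [hs] at key
  -- Periodicity identifies the values on the two faces orthogonal to the $i$-th axis, so the
  -- boundary terms cancel.
  have hface : ∀ y : Fin 2 → ℝ, h (e (i.insertNth L y)) = h (e (i.insertNth 0 y)) := by
    intro y
    rw [← hp i (e (i.insertNth 0 y))]
    congr 1
    ext j
    rcases eq_or_ne j i with rfl | hj
    · simp [he', unitVec]
    · obtain ⟨k, rfl⟩ := Fin.exists_succAbove_eq hj
      simp [he', unitVec]
  have hr : (∑ j : Fin 3, ((∫ y in Icc ((fun _ => (0:ℝ)) ∘ j.succAbove) ((fun _ => L) ∘ j.succAbove),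
      (if j = i then h (e (j.insertNth L y)) else 0))
      - ∫ y in Icc ((fun _ => (0:ℝ)) ∘ j.succAbove) ((fun _ => L) ∘ j.succAbove),
      (if j = i then h (e (j.insertNth 0 y)) else 0))) = 0 := by
    refine Finset.sum_eq_zero fun j _ => ?_
    by_cases hj : j = i
    · subst hj; simp [hface]
    · simp [hj]
  have h3 := key.trans hr
  have h2 := (torusMeasure_map_ofLp L).integral_comp
    (MeasurableEquiv.toLp 2 (Fin 3 → ℝ)).symm.measurableEmbedding
    (fun y : Fin 3 → ℝ => fderiv ℝ h (e y) (unitVec i))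
  refine h2.trans ?_
  rw [← Measure.restrict_pi_pi, Measure.restrict_congr_set Measure.univ_pi_Ico_ae_eq_Icc]
  exact h3

theorem continuous_integral_torus {X : Type*} [TopologicalSpace X] [FirstCountableTopology X]
    [LocallyCompactSpace X] (L : ℝ) {k : X → E3 → ℝ}
    (hk : Continuous fun z : X × E3 => k z.1 z.2) :
    Continuous fun t => ∫ x, k t x ∂torusMeasure L := by
  have hc := continuous_parametric_integral_of_continuous (μ := torusMeasure L) (f := k) hk
    (isCompact_closedCube L)
  have e : (torusMeasure L).restrict (closedCube L) = torusMeasure L :=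
    Measure.restrict_eq_self_of_ae_mem (ae_mem_closedCube L)
  simpa only [e] using hc

/-- The derivative is bounded on the compact set $[t-1,t+1]\times[0,L]^3$, so a constant serves as
dominating function. -/
theorem hasDerivAt_integral_torus (L : ℝ) {k k' : ℝ → E3 → ℝ}
    (hk : Continuous fun z : ℝ × E3 => k z.1 z.2) (hk' : Continuous fun z : ℝ × E3 => k' z.1 z.2)
    (hd : ∀ t x, HasDerivAt (fun s => k s x) (k' t x) t) (t : ℝ) :
    HasDerivAt (fun s => ∫ x, k s x ∂torusMeasure L) (∫ x, k' t x ∂torusMeasure L) t := by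
  obtain ⟨C, hC⟩ := ((isCompact_Icc (a := t - 1) (b := t + 1)).prod
    (isCompact_closedCube L)).exists_bound_of_continuousOn hk'.continuousOn
  have hslice : ∀ s, Continuous (k s) := fun s => hk.comp (Continuous.prodMk_right s)
  have hslice' : ∀ s, Continuous (k' s) := fun s => hk'.comp (Continuous.prodMk_right s)
  refine (hasDerivAt_integral_of_dominated_loc_of_deriv_le (s := Icc (t - 1) (t + 1))
    (bound := fun _ => C) (Icc_mem_nhds (by linarith) (by linarith))
    (.of_forall fun s => (hslice s).aestronglyMeasurable) (integrable_torus L (hslice t))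
    (hslice' t).aestronglyMeasurable ?_ (integrable_const C) ?_).2
  · filter_upwards [ae_mem_closedCube L] with x hx s hs using hC (s, x) ⟨hs, hx⟩
  · exact .of_forall fun x s _ => hd s x

/-! ### Shear fields -/

/-- The shear field `x ↦ g(x₀) e₁`. -/
noncomputable def shear (g : ℝ → ℝ) (x : E3) : E3 := g (x 0) • unitVec 1

theorem shear_apply (g : ℝ → ℝ) (x : E3) (i : Fin 3) :
    shear g x i = if i = 1 then g (x 0) else 0 := by
  simp [shear, unitVec, PiLp.single_apply]

theorem norm_shear (g : ℝ → ℝ) (x : E3) : ‖shear g x‖ = |g (x 0)| := by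
  simp [shear, unitVec, norm_smul]

theorem inner_shear_left (g : ℝ → ℝ) (x v : E3) : ⟪shear g x, v⟫ = g (x 0) * v 1 := by
  simp [shear, unitVec, real_inner_smul_left, EuclideanSpace.inner_single_left]

theorem inner_shear_shear (g h : ℝ → ℝ) (x : E3) :
    ⟪shear g x, shear h x⟫ = g (x 0) * h (x 0) := by
  rw [inner_shear_left, shear_apply, if_pos rfl]

theorem smul_shear (a : ℝ) (g : ℝ → ℝ) : a • shear g = shear (a • g) := by
  ext1 x; simp [shear, smul_smul]

theorem isPeriodic_shear {L : ℝ} {g : ℝ → ℝ} (hg : Function.Periodic g L) :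
    IsPeriodic L (shear g) := by
  intro i x
  have : g ((x + L • unitVec i) 0) = g (x 0) := by
    fin_cases i
    · simpa [unitVec] using hg (x 0)
    · simp [unitVec]
    · simp [unitVec]
  simp only [shear, this]

theorem contDiff_coord (i : Fin 3) {n : WithTop ℕ∞} : ContDiff ℝ n (fun x : E3 => x i) :=
  (EuclideanSpace.proj (𝕜 := ℝ) i : E3 →L[ℝ] ℝ).contDiff

theorem continuous_coord (i : Fin 3) : Continuous (fun x : E3 => x i) :=
  (contDiff_coord i (n := 0)).continuous

theorem continuous_shear {g : ℝ → ℝ} (hg : Continuous g) : Continuous (shear g) :=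
  (hg.comp (continuous_coord 0)).smul continuous_const

theorem contDiff_shear {n : WithTop ℕ∞} {g : ℝ → ℝ} (hg : ContDiff ℝ n g) :
    ContDiff ℝ n (shear g) :=
  (hg.comp (contDiff_coord 0)).smul contDiff_const

theorem hasFDerivAt_coord (i : Fin 3) (x : E3) :
    HasFDerivAt (fun x : E3 => x i)
      (EuclideanSpace.proj (𝕜 := ℝ) i : E3 →L[ℝ] ℝ) x :=
  (EuclideanSpace.proj (𝕜 := ℝ) i : E3 →L[ℝ] ℝ).hasFDerivAt

theorem fderiv_comp_coord {g : ℝ → ℝ} (hg : Differentiable ℝ g) (x v : E3) :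
    fderiv ℝ (fun x : E3 => g (x 0)) x v = deriv g (x 0) * v 0 := by
  have h := (hg (x 0)).hasDerivAt.comp_hasFDerivAt x (hasFDerivAt_coord 0 x)
  change HasFDerivAt (fun x : E3 => g (x 0)) _ x at h
  rw [h.fderiv]
  simp

theorem fderiv_shear {g : ℝ → ℝ} (hg : Differentiable ℝ g) (x v : E3) :
    fderiv ℝ (shear g) x v = (deriv g (x 0) * v 0) • unitVec 1 := by
  have h := (hg (x 0)).hasDerivAt.comp_hasFDerivAt x (hasFDerivAt_coord 0 x)
  change HasFDerivAt (fun x : E3 => g (x 0)) _ x at h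
  have h2 := h.smul_const (unitVec 1)
  rw [show shear g = fun x => g (x 0) • unitVec 1 from rfl, h2.fderiv]
  simp

theorem divergence_shear {g : ℝ → ℝ} (hg : Differentiable ℝ g) (x : E3) :
    divergence (shear g) x = 0 := by
  simp [divergence, fderiv_shear hg, unitVec, Fin.sum_univ_three]

/-- A shear varies along $e_0$ and points along $e_1$. This orthogonality removes the nonlinearity
from every equation of the construction. -/
theorem fderiv_shear_shear {g : ℝ → ℝ} (hg : Differentiable ℝ g) (h : ℝ → ℝ) (x : E3) :
    fderiv ℝ (shear g) x (shear h x) = 0 := by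
  rw [fderiv_shear hg, shear_apply]; simp

theorem gradSq_shear {g : ℝ → ℝ} (hg : Differentiable ℝ g) (x : E3) :
    gradSq (shear g) x = deriv g (x 0) ^ 2 := by
  simp [gradSq, fderiv_shear hg, unitVec, Fin.sum_univ_three, norm_smul]

theorem laplacian_shear {g : ℝ → ℝ} (hg : ContDiff ℝ 2 g) (x : E3) :
    Laplacian.laplacian (shear g) x = shear (deriv (deriv g)) x := by
  rw [InnerProductSpace.laplacian_eq_iteratedFDeriv_orthonormalBasis (shear g)
    (EuclideanSpace.basisFun (Fin 3) ℝ)]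
  have hd : Differentiable ℝ g := hg.differentiable two_ne_zero
  have hg1 : ContDiff ℝ 1 (deriv g) := (contDiff_succ_iff_deriv (n := 1).1 hg).2.2
  have hd' : Differentiable ℝ (deriv g) := hg1.differentiable one_ne_zero
  have hf : ∀ v : E3, (fun y => fderiv ℝ (shear g) y v) = v 0 • shear (deriv g) := by
    intro v; ext1 y; rw [fderiv_shear hd, Pi.smul_apply, shear, smul_smul, mul_comm]
  have key : ∀ v : E3, iteratedFDeriv ℝ 2 (shear g) x ![v, v]
      = (v 0 * v 0) • shear (deriv (deriv g)) x := by
    intro v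
    rw [iteratedFDeriv_two_apply]
    simp only [Matrix.cons_val_zero, Matrix.cons_val_one]
    have hdd : DifferentiableAt ℝ (fderiv ℝ (shear g)) x :=
      ((contDiff_shear hg).fderiv_right (m := 1) le_rfl).differentiable one_ne_zero x
    have : fderiv ℝ (fderiv ℝ (shear g)) x v v = fderiv ℝ (fun y => fderiv ℝ (shear g) y v) x v := by
      rw [fderiv_clm_apply hdd (differentiableAt_const _)]; simp
    rw [this, hf v, fderiv_const_smul
      ((contDiff_shear hg1).differentiable one_ne_zero x)]
    rw [_root_.smul_apply, fderiv_shear hd', shear, smul_smul, smul_smul]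
    congr 1; ring
  simp only [key, Fin.sum_univ_three]
  simp

theorem pairing_shear {L : ℝ} (hL : 0 ≤ L) (g h : ℝ → ℝ) :
    pairing L (shear g) (shear h) = L ^ 2 * ∫ s in 0..L, g s * h s := by
  rw [← integral_torus_coord hL]
  simp only [pairing, inner_shear_shear]

theorem periodic_deriv {L : ℝ} {g : ℝ → ℝ} (hg : Function.Periodic g L) :
    Function.Periodic (deriv g) L := by
  intro s
  rw [← deriv_comp_add_const]
  congr 1
  funext y; exact hg y

/-- Integration by parts over one period. It identifies the work of the viscous part of the force
with the enstrophy. -/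
theorem pairing_shear_deriv_deriv {L : ℝ} (hL : 0 ≤ L) {g : ℝ → ℝ} (hg : ContDiff ℝ 2 g)
    (hp : Function.Periodic g L) :
    pairing L (shear (deriv (deriv g))) (shear g)
      = - ∫ x, gradSq (shear g) x ∂torusMeasure L := by
  have hd : Differentiable ℝ g := hg.differentiable two_ne_zero
  have hg1 : ContDiff ℝ 1 (deriv g) := (contDiff_succ_iff_deriv (n := 1).1 hg).2.2
  have hd' : Differentiable ℝ (deriv g) := hg1.differentiable one_ne_zero
  have hc : Continuous (deriv (deriv g)) := hg1.continuous_deriv_one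
  rw [pairing_shear hL]
  simp only [gradSq_shear hd]
  rw [integral_torus_coord hL (fun s => deriv g s ^ 2), ← mul_neg]
  congr 1
  have := intervalIntegral.integral_mul_deriv_eq_deriv_mul (a := 0) (b := L)
    (u := g) (v := deriv g) (u' := deriv g) (v' := deriv (deriv g))
    (fun x _ => (hd x).hasDerivAt) (fun x _ => (hd' x).hasDerivAt)
    (hg1.continuous.intervalIntegrable _ _) (hc.intervalIntegrable _ _)
  have e1 : g L = g 0 := by simpa using hp 0
  have e2 : deriv g L = deriv g 0 := by simpa using periodic_deriv hp 0
  rw [e1, e2, sub_self, zero_sub] at this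
  simp only [mul_comm (deriv (deriv g) _), this, sq]

/-! ### Integration by parts of shears against periodic test fields -/

theorem contDiff_component {n : WithTop ℕ∞} {ψ : E3 → E3} (hψ : ContDiff ℝ n ψ) (i : Fin 3) :
    ContDiff ℝ n (fun x => ψ x i) := (contDiff_coord i).comp hψ

theorem fderiv_component {ψ : E3 → E3} {x : E3} (hψ : DifferentiableAt ℝ ψ x) (i : Fin 3)
    (v : E3) : fderiv ℝ (fun x => ψ x i) x v = fderiv ℝ ψ x v i := by
  have := (hasFDerivAt_coord i (ψ x)).comp x hψ.hasFDerivAt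
  change HasFDerivAt (fun x => ψ x i) _ x at this
  rw [this.fderiv]; simp

theorem isPeriodic_fderiv {F : Type} [NormedAddCommGroup F] [NormedSpace ℝ F] {L : ℝ} {ψ : E3 → F}
    (hψ : IsPeriodic L ψ) (v : E3) : IsPeriodic L (fun x => fderiv ℝ ψ x v) := by
  intro i x
  have : fderiv ℝ ψ (x + L • unitVec i) = fderiv ℝ ψ x := by
    rw [← fderiv_comp_add_right]
    congr 1
    funext y; exact hψ i y
  simp only [this]

theorem IsPeriodic.comp {F G : Type} {L : ℝ} {ψ : E3 → F} (hψ : IsPeriodic L ψ) (f : F → G) :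
    IsPeriodic L (fun x => f (ψ x)) := fun i x => by simp only [hψ i x]

theorem isPeriodic_comp_coord {L : ℝ} {g : ℝ → ℝ} (hg : Function.Periodic g L) :
    IsPeriodic L (fun x => g (x 0)) := by
  intro i x
  fin_cases i
  · simpa [unitVec] using hg (x 0)
  · simp [unitVec]
  · simp [unitVec]

/-- Integration by parts against a function of the first coordinate. -/
theorem integral_coord_mul_fderiv {L : ℝ} (hL : 0 ≤ L) {g : ℝ → ℝ} (hg : ContDiff ℝ 1 g)
    (hp : Function.Periodic g L) {h : E3 → ℝ} (hh : ContDiff ℝ 1 h) (hhp : IsPeriodic L h)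
    (i : Fin 3) :
    ∫ x, g (x 0) * fderiv ℝ h x (unitVec i) ∂torusMeasure L
      = - ∫ x, deriv g (x 0) * unitVec i 0 * h x ∂torusMeasure L := by
  have hG : ContDiff ℝ 1 (fun x : E3 => g (x 0)) := hg.comp (contDiff_coord 0)
  have h0 := integral_torus_fderiv_eq_zero hL (hG.mul hh)
    (fun j x => by
      change g _ * h _ = g _ * h _
      rw [hhp j x]
      congr 1
      exact isPeriodic_comp_coord hp j x) i
  have hd : ∀ x, fderiv ℝ (fun x : E3 => g (x 0) * h x) x (unitVec i)
      = g (x 0) * fderiv ℝ h x (unitVec i) + deriv g (x 0) * unitVec i 0 * h x := by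
    intro x
    rw [fderiv_fun_mul (hG.differentiable one_ne_zero x) (hh.differentiable one_ne_zero x)]
    simp only [_root_.add_apply, _root_.smul_apply, smul_eq_mul]
    rw [fderiv_comp_coord (hg.differentiable one_ne_zero)]
    ring
  simp only [hd] at h0
  rw [integral_add] at h0
  · linarith
  · exact integrable_torus L ((hG.continuous).mul
      ((hh.continuous_fderiv one_ne_zero).clm_apply continuous_const))
  · exact integrable_torus L ((((hg.continuous_deriv_one).comp
      (continuous_coord 0)).mul continuous_const).mul hh.continuous)

theorem pairing_shear_deriv {L : ℝ} (hL : 0 ≤ L) {g : ℝ → ℝ} (hg : ContDiff ℝ 1 g)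
    (hp : Function.Periodic g L) {ψ : E3 → E3} (hψ : ContDiff ℝ 1 ψ) (hψp : IsPeriodic L ψ) :
    pairing L (shear (deriv g)) ψ
      = - pairing L (shear g) (fun x => fderiv ℝ ψ x (unitVec 0)) := by
  have := integral_coord_mul_fderiv hL hg hp (contDiff_component hψ 1) (hψp.comp (fun v => v 1)) 0
  simp only [pairing, inner_shear_left]
  simp only [fderiv_component (hψ.differentiable one_ne_zero _)] at this
  rw [this, neg_neg]
  simp [unitVec]

/-- The pairing only sees $\partial_1\psi$, while the weight depends on $x_0$ alone; the integral
over a period in $x_1$ vanishes. -/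
theorem pairing_shear_gradient {L : ℝ} (hL : 0 ≤ L) {g : ℝ → ℝ} (hg : ContDiff ℝ 1 g)
    (hp : Function.Periodic g L) {ψ : E3 → ℝ} (hψ : ContDiff ℝ 1 ψ) (hψp : IsPeriodic L ψ) :
    pairing L (shear g) (gradient ψ) = 0 := by
  have := integral_coord_mul_fderiv hL hg hp hψ hψp 1
  have e : ∀ x, ⟪shear g x, gradient ψ x⟫ = g (x 0) * fderiv ℝ ψ x (unitVec 1) := by
    intro x
    rw [real_inner_comm, inner_gradient_left, shear, map_smul, smul_eq_mul]
  simp only [pairing, e, this]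
  simp [unitVec]

/-- The integrand is $g(x_0)^2\,\partial_1\varphi_1$, again a weight in $x_0$ times a derivative
along $e_1$. -/
theorem integral_convection_shear {L : ℝ} (hL : 0 ≤ L) {g : ℝ → ℝ} (hg : ContDiff ℝ 1 g)
    (hp : Function.Periodic g L) {φ : E3 → E3} (hφ : ContDiff ℝ 1 φ) (hφp : IsPeriodic L φ) :
    ∫ x, ⟪shear g x, fderiv ℝ φ x (shear g x)⟫ ∂torusMeasure L = 0 := by
  have := integral_coord_mul_fderiv hL (hg.mul hg) (fun s => by simp [hp s])
    (contDiff_component hφ 1) (hφp.comp (fun v => v 1)) 1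
  have e : ∀ x, ⟪shear g x, fderiv ℝ φ x (shear g x)⟫
      = g (x 0) * g (x 0) * fderiv ℝ (fun x => φ x 1) x (unitVec 1) := by
    intro x
    rw [inner_shear_left, fderiv_component (hφ.differentiable one_ne_zero x), shear, map_smul]
    simp; ring
  simp only [e, this]
  simp [unitVec]

/-! ### Littlewood–Paley blocks of shear fields given by cosine sums -/

/-- The cosine sum `s ↦ ∑ₚ cₚ cos ((2π/L) kₚ s)`. -/
noncomputable def cosSum {ι : Type*} (L : ℝ) (P : Finset ι) (c : ι → ℝ) (k : ι → ℤ) (s : ℝ) : ℝ :=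
  ∑ p ∈ P, c p * Real.cos (2 * Real.pi / L * k p * s)

/-- The frequency `n e₀`. -/
def axisFreq (n : ℤ) : Fin 3 → ℤ := Pi.single 0 n

theorem contDiff_cosSum {ι : Type*} (L : ℝ) (P : Finset ι) (c : ι → ℝ) (k : ι → ℤ)
    {n : WithTop ℕ∞} : ContDiff ℝ n (cosSum L P c k) := by
  unfold cosSum; fun_prop

theorem periodic_cosSum {ι : Type*} {L : ℝ} (hL : L ≠ 0) (P : Finset ι) (c : ι → ℝ) (k : ι → ℤ) :
    Function.Periodic (cosSum L P c k) L := by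
  intro s
  refine Finset.sum_congr rfl fun p _ => ?_
  have : 2 * Real.pi / L * k p * (s + L) = 2 * Real.pi / L * k p * s + k p * (2 * Real.pi) := by
    field_simp
  rw [this, Real.cos_add_int_mul_two_pi]

theorem abs_cosSum_le {ι : Type*} (L : ℝ) (P : Finset ι) (c : ι → ℝ) (k : ι → ℤ) (s : ℝ) :
    |cosSum L P c k s| ≤ ∑ p ∈ P, |c p| := by
  refine (Finset.abs_sum_le_sum_abs _ _).trans (Finset.sum_le_sum fun p _ => ?_)
  rw [abs_mul]
  exact mul_le_of_le_one_right (abs_nonneg _) (Real.abs_cos_le_one _)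

theorem integral_exp_int_mul {L : ℝ} (hL : 0 < L) (n : ℤ) :
    ∫ s in 0..L, Complex.exp (Complex.I * ((2 * Real.pi / L * n * s : ℝ) : ℂ))
      = if n = 0 then (L : ℂ) else 0 := by
  by_cases hn : n = 0
  · simp [hn]
  rw [if_neg hn]
  have hc : (Complex.I * (2 * Real.pi / L * n : ℝ) : ℂ) ≠ 0 := by
    refine mul_ne_zero Complex.I_ne_zero (Complex.ofReal_ne_zero.2 ?_)
    have : (n : ℝ) ≠ 0 := by exact_mod_cast hn
    positivity
  have e : ∀ s : ℝ, Complex.exp (Complex.I * ((2 * Real.pi / L * n * s : ℝ) : ℂ))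
      = Complex.exp (Complex.I * (2 * Real.pi / L * n : ℝ) * s) := by
    intro s; push_cast; ring_nf
  simp only [e]
  rw [integral_exp_mul_complex hc]
  have h1 : (Complex.I * (2 * Real.pi / L * n : ℝ) * L : ℂ) = n * (2 * Real.pi * Complex.I) := by
    have : (L : ℂ) ≠ 0 := Complex.ofReal_ne_zero.2 hL.ne'
    push_cast; field_simp
  rw [h1, Complex.exp_int_mul_two_pi_mul_I]
  simp

theorem ofReal_cos_eq_exp (y : ℝ) : ((Real.cos y : ℝ) : ℂ)
    = (Complex.exp (Complex.I * (y : ℂ)) + Complex.exp (Complex.I * ((-y : ℝ) : ℂ))) / 2 := by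
  rw [Complex.ofReal_cos, Complex.cos]
  push_cast
  ring_nf

theorem integral_cosSum_mul_exp {ι : Type*} {L : ℝ} (hL : 0 < L) (P : Finset ι) (c : ι → ℝ)
    (k : ι → ℤ) (n : ℤ) :
    ∫ s in 0..L, (cosSum L P c k s : ℂ) * Complex.exp (Complex.I * ((2 * Real.pi / L * (-n : ℤ) * s : ℝ) : ℂ))
      = ∑ p ∈ P, (c p : ℂ) / 2 * ((if n = k p then (L : ℂ) else 0) + if n = -k p then (L : ℂ) else 0) := by
  have e : ∀ s : ℝ, (cosSum L P c k s : ℂ)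
      * Complex.exp (Complex.I * ((2 * Real.pi / L * (-n : ℤ) * s : ℝ) : ℂ))
      = ∑ p ∈ P, (c p : ℂ) / 2 * (Complex.exp (Complex.I * ((2 * Real.pi / L * (k p - n : ℤ) * s : ℝ) : ℂ))
        + Complex.exp (Complex.I * ((2 * Real.pi / L * (-k p - n : ℤ) * s : ℝ) : ℂ))) := by
    intro s
    rw [cosSum, Complex.ofReal_sum, Finset.sum_mul]
    refine Finset.sum_congr rfl fun p _ => ?_
    rw [Complex.ofReal_mul, ofReal_cos_eq_exp, mul_assoc, div_mul_eq_mul_div, add_mul,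
      ← Complex.exp_add, ← Complex.exp_add]
    push_cast
    ring_nf
  simp only [e]
  rw [intervalIntegral.integral_finsetSum
    (fun p _ => Continuous.intervalIntegrable (by fun_prop) _ _)]
  refine Finset.sum_congr rfl fun p _ => ?_
  rw [intervalIntegral.integral_const_mul, intervalIntegral.integral_add
    (Continuous.intervalIntegrable (by fun_prop) _ _)
    (Continuous.intervalIntegrable (by fun_prop) _ _), integral_exp_int_mul hL,
    integral_exp_int_mul hL]
  congr 3
  · simp only [sub_eq_zero, eq_comm]
  · simp only [sub_eq_zero, eq_comm]

theorem character_eq_prod (L : ℝ) (n : Fin 3 → ℤ) (x : E3) :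
    character L n x = ∏ i, Complex.exp (Complex.I * ((2 * Real.pi / L * n i * x i : ℝ) : ℂ)) := by
  rw [character, ← Complex.exp_sum, ← Finset.mul_sum, ← Complex.ofReal_sum]
  congr 3
  rw [PiLp.inner_apply, Finset.mul_sum]
  refine Finset.sum_congr rfl fun i _ => ?_
  simp [freq]; ring

/-- The integrand factors over the coordinates, and the factors in $x_1,x_2$ are pure exponentials,
which integrate to zero unless the corresponding frequency vanishes. Shears have spectrum on the
$e_0$ axis. -/
theorem fourierCoefficient_shear {L : ℝ} (hL : 0 < L) (g : ℝ → ℝ) (n : Fin 3 → ℤ) (i : Fin 3) :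
    fourierCoefficient L (shear g) n i
      = if i = 1 ∧ n 1 = 0 ∧ n 2 = 0 then (L : ℂ)⁻¹ * ∫ s in 0..L,
          (g s : ℂ) * Complex.exp (Complex.I * ((2 * Real.pi / L * (-n 0 : ℤ) * s : ℝ) : ℂ))
        else 0 := by
  rw [fourierCoefficient]
  by_cases hi : i = 1
  swap
  · simp [shear_apply, hi]
  simp only [hi, shear_apply, if_true, true_and]
  set F : Fin 3 → ℝ → ℂ := fun i s => (if i = 0 then (g s : ℂ) else 1)
    * Complex.exp (Complex.I * ((2 * Real.pi / L * (-n i : ℤ) * s : ℝ) : ℂ)) with hF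
  have e : ∀ x : E3, ((g (x 0) : ℝ) : ℂ) * character L (-n) x = ∏ i, F i (x i) := by
    intro x
    rw [character_eq_prod, Fin.prod_univ_three, Fin.prod_univ_three]
    simp [hF]; ring
  simp only [e]
  rw [integral_torus_prod, Fin.prod_univ_three]
  have conv : ∀ f : ℝ → ℂ, ∫ s in Ico 0 L, f s = ∫ s in 0..L, f s := fun f => by
    rw [intervalIntegral.integral_of_le hL.le, integral_Ico_eq_integral_Ioo,
      integral_Ioc_eq_integral_Ioo]
  simp only [conv, hF]
  simp only [if_true, Fin.isValue, one_ne_zero, if_false, one_mul, Fin.reduceEq]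
  rw [integral_exp_int_mul hL, integral_exp_int_mul hL]
  have hL' : (L : ℂ) ≠ 0 := Complex.ofReal_ne_zero.2 hL.ne'
  by_cases h1 : n 1 = 0 <;> by_cases h2 : n 2 = 0 <;> simp [h1, h2]
  field_simp

theorem eq_axisFreq_iff (n : Fin 3 → ℤ) (k : ℤ) :
    n = axisFreq k ↔ n 0 = k ∧ n 1 = 0 ∧ n 2 = 0 := by
  constructor
  · rintro rfl; simp [axisFreq]
  · rintro ⟨h0, h1, h2⟩
    ext i; fin_cases i <;> simp [axisFreq, h0, h1, h2]

/-- The frequencies $\pm k_p$ may repeat for different $p$ or coincide with one another. Recording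
the coefficient as a sum of indicators makes multiplicities add up without case distinctions. -/
theorem fourierCoefficient_shear_cosSum {ι : Type*} {L : ℝ} (hL : 0 < L) (P : Finset ι) (c : ι → ℝ)
    (k : ι → ℤ) (n : Fin 3 → ℤ) :
    fourierCoefficient L (shear (cosSum L P c k)) n 1
      = ∑ p ∈ P, ((if n = axisFreq (k p) then (c p : ℂ) / 2 else 0)
          + if n = axisFreq (-k p) then (c p : ℂ) / 2 else 0) := by
  have hL' : (L : ℂ) ≠ 0 := Complex.ofReal_ne_zero.2 hL.ne'
  rw [fourierCoefficient_shear hL, integral_cosSum_mul_exp hL]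
  simp only [true_and, eq_axisFreq_iff]
  by_cases h : n 1 = 0 ∧ n 2 = 0
  · simp only [h, and_true, if_true, and_self]
    rw [Finset.mul_sum]
    refine Finset.sum_congr rfl fun p _ => ?_
    split_ifs <;> field_simp <;> simp [mul_comm]
  · simp only [h, and_false, if_false]; simp

theorem freq_axisFreq_neg (k : ℤ) : freq (axisFreq (-k)) = - freq (axisFreq k) := by
  ext i; fin_cases i <;> simp [freq, axisFreq]

theorem norm_freq_axisFreq (k : ℤ) : ‖freq (axisFreq k)‖ = |(k : ℝ)| := by
  rw [EuclideanSpace.norm_eq, Fin.sum_univ_three]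
  simp [freq, axisFreq, Real.sqrt_sq_eq_abs]

theorem lpSymbol_neg {χ : E3 → ℝ} (hχ : IsCutoff χ) (j : ℕ) (ξ : E3) :
    lpSymbol χ j (-ξ) = lpSymbol χ j ξ := by
  have h : ∀ η : E3, χ (-η) = χ η := fun η => hχ.radial _ _ (norm_neg η)
  cases j with
  | zero => exact h ξ
  | succ q => simp only [lpSymbol, smul_neg, h]

theorem character_axisFreq (L : ℝ) (k : ℤ) (x : E3) :
    character L (axisFreq k) x = Complex.exp (Complex.I * ((2 * Real.pi / L * k * x 0 : ℝ) : ℂ)) := by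
  rw [character_eq_prod, Fin.prod_univ_three]
  simp [axisFreq]

/-- A Littlewood–Paley block acts on a cosine sum by multiplication of the coefficients. -/
theorem lpBlock_shear_cosSum {ι : Type*} {L : ℝ} (hL : 0 < L) {χ : E3 → ℝ} (hχ : IsCutoff χ) (j : ℕ)
    (P : Finset ι) (c : ι → ℝ) (k : ι → ℤ) :
    lpBlock χ L j (shear (cosSum L P c k))
      = shear (cosSum L P (fun p => c p * lpSymbol χ j (freq (axisFreq (k p)))) k) := by
  ext x i
  simp only [lpBlock, shear_apply]
  by_cases hi : i = 1
  swap
  · simp [hi, fourierCoefficient_shear hL]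
  subst hi
  simp only [if_true]
  set m : (Fin 3 → ℤ) → ℂ := fun n => (lpSymbol χ j (freq n) : ℂ) * character L n x with hm
  have hsum : HasSum (fun n => fourierCoefficient L (shear (cosSum L P c k)) n 1
      * (lpSymbol χ j (freq n) : ℂ) * character L n x)
      (∑ p ∈ P, ((c p : ℂ) / 2 * m (axisFreq (k p)) + (c p : ℂ) / 2 * m (axisFreq (-k p)))) := by
    have e : (fun n => fourierCoefficient L (shear (cosSum L P c k)) n 1
        * (lpSymbol χ j (freq n) : ℂ) * character L n x)
        = fun n => ∑ p ∈ P, ((if n = axisFreq (k p) then (c p : ℂ) / 2 * m (axisFreq (k p)) else 0)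
          + if n = axisFreq (-k p) then (c p : ℂ) / 2 * m (axisFreq (-k p)) else 0) := by
      funext n
      rw [fourierCoefficient_shear_cosSum hL, mul_assoc, Finset.sum_mul]
      refine Finset.sum_congr rfl fun p _ => ?_
      rw [add_mul, ite_mul, ite_mul, zero_mul]
      congr 1
      · split_ifs with h
        · rw [h]
        · rfl
      · split_ifs with h
        · rw [h]
        · rfl
    rw [e]
    exact hasSum_sum fun p _ => (hasSum_ite_eq _ _).add (hasSum_ite_eq _ _)
  rw [hsum.tsum_eq, cosSum, Complex.re_sum]
  refine Finset.sum_congr rfl fun p _ => ?_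
  have : (c p : ℂ) / 2 * m (axisFreq (k p)) + (c p : ℂ) / 2 * m (axisFreq (-k p))
      = ((c p * lpSymbol χ j (freq (axisFreq (k p)))
          * Real.cos (2 * Real.pi / L * k p * x 0) : ℝ) : ℂ) := by
    -- The symbol is even, because the cutoff is radial, so the contributions of $k_p$ and $-k_p$
    -- recombine into one real cosine.
    simp only [hm, freq_axisFreq_neg, lpSymbol_neg hχ, character_axisFreq]
    rw [Complex.ofReal_mul (c p * _), ofReal_cos_eq_exp]
    push_cast
    ring_nf
  rw [this, Complex.ofReal_re]

theorem fourierCoefficient_smul (L a : ℝ) (v : E3 → E3) (n : Fin 3 → ℤ) (i : Fin 3) :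
    fourierCoefficient L (a • v) n i = a * fourierCoefficient L v n i := by
  simp only [fourierCoefficient, Pi.smul_apply, PiLp.smul_apply, smul_eq_mul, Complex.ofReal_mul,
    mul_assoc, integral_const_mul]
  ring

theorem lpBlock_smul (χ : E3 → ℝ) (L : ℝ) (j : ℕ) (a : ℝ) (v : E3 → E3) :
    lpBlock χ L j (a • v) = a • lpBlock χ L j v := by
  ext x i
  simp only [lpBlock, fourierCoefficient_smul, mul_assoc, tsum_mul_left, Pi.smul_apply,
    PiLp.smul_apply, smul_eq_mul, Complex.re_ofReal_mul]

theorem lowPass_smul (χ : E3 → ℝ) (L : ℝ) (q : ℕ) (a : ℝ) (v : E3 → E3) :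
    lowPass χ L q (a • v) = a • lowPass χ L q v := by
  ext1 x
  simp only [lowPass, lpBlock_smul, Pi.smul_apply, Finset.smul_sum]

theorem sum_lpSymbol (χ : E3 → ℝ) (q : ℕ) (ξ : E3) :
    ∑ j ∈ Finset.range (q + 1), lpSymbol χ j ξ = χ (((2 : ℝ) ^ q)⁻¹ • ξ) := by
  induction q with
  | zero => simp [lpSymbol]
  | succ q ih => rw [Finset.sum_range_succ, ih, lpSymbol]; ring

/-- The symbols telescope. Since $S_q$ includes the blocks $-1,\dots,q$, that is $q+2$ of them, the
surviving multiplier is $\chi$ dilated by $2^{q+1}$. -/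
theorem lowPass_shear_cosSum {ι : Type*} {L : ℝ} (hL : 0 < L) {χ : E3 → ℝ} (hχ : IsCutoff χ) (q : ℕ)
    (P : Finset ι) (c : ι → ℝ) (k : ι → ℤ) :
    lowPass χ L q (shear (cosSum L P c k))
      = shear (cosSum L P (fun p => c p * χ (((2 : ℝ) ^ (q + 1))⁻¹ • freq (axisFreq (k p)))) k) := by
  ext1 x
  simp only [lowPass, lpBlock_shear_cosSum hL hχ, shear, cosSum, ← Finset.sum_smul]
  rw [Finset.sum_comm]
  congr 1
  refine Finset.sum_congr rfl fun p _ => ?_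
  beta_reduce
  rw [← sum_lpSymbol χ (q + 1), ← Finset.sum_mul, Finset.mul_sum]

theorem norm_scaled_freq (q : ℕ) (k : ℤ) :
    ‖((2 : ℝ) ^ q)⁻¹ • freq (axisFreq k)‖ = |(k : ℝ)| / 2 ^ q := by
  rw [norm_smul, norm_freq_axisFreq, norm_inv, norm_pow, Real.norm_ofNat]
  field_simp

/-- The cutoff is $1$ on the ball of radius $3/4$, so after dilation it is $1$ up to $\frac32\,2^q$,
which exceeds $2^q$. -/
theorem lowPass_shear_cosSum_eq_self {ι : Type*} {L : ℝ} (hL : 0 < L) {χ : E3 → ℝ}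
    (hχ : IsCutoff χ) {q : ℕ} {P : Finset ι} {c : ι → ℝ} {k : ι → ℤ}
    (hq : ∀ p ∈ P, |(k p : ℝ)| ≤ 2 ^ q) :
    lowPass χ L q (shear (cosSum L P c k)) = shear (cosSum L P c k) := by
  rw [lowPass_shear_cosSum hL hχ]
  congr 1
  funext s
  refine Finset.sum_congr rfl fun p hp => ?_
  beta_reduce
  rw [hχ.eq_one, mul_one]
  rw [norm_scaled_freq, div_le_iff₀ (by positivity), pow_succ]
  have := hq p hp
  have h2 : (0 : ℝ) < 2 ^ q := by positivity
  linarith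

theorem lowPass_shear_cosSum_eq_zero {ι : Type*} {L : ℝ} (hL : 0 < L) {χ : E3 → ℝ}
    (hχ : IsCutoff χ) {q : ℕ} {P : Finset ι} {c : ι → ℝ} {k : ι → ℤ}
    (hq : ∀ p ∈ P, (2 : ℝ) ^ (q + 1) ≤ |(k p : ℝ)|) :
    lowPass χ L q (shear (cosSum L P c k)) = 0 := by
  rw [lowPass_shear_cosSum hL hχ]
  ext1 x
  have : cosSum L P (fun p => c p * χ (((2 : ℝ) ^ (q + 1))⁻¹ • freq (axisFreq (k p)))) k (x 0)
      = 0 := by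
    refine Finset.sum_eq_zero fun p hp => ?_
    beta_reduce
    rw [hχ.eq_zero, mul_zero, zero_mul]
    rw [norm_scaled_freq, one_le_div (by positivity)]
    exact hq p hp
  simp [shear, this]

/-! ### Size of the Littlewood–Paley symbols -/

theorem IsCutoff.exists_le {χ : E3 → ℝ} (hχ : IsCutoff χ) : ∃ K : ℝ, 1 ≤ K ∧ ∀ ξ, χ ξ ≤ K := by
  obtain ⟨C, hC⟩ := (isCompact_closedBall (0 : E3) 1).exists_bound_of_continuousOn
    hχ.smooth.continuous.continuousOn
  refine ⟨max C 1, le_max_right _ _, fun ξ => ?_⟩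
  rcases le_total ‖ξ‖ 1 with h | h
  · exact ((le_abs_self _).trans (hC ξ (by simpa using h))).trans (le_max_left _ _)
  · rw [hχ.eq_zero ξ h]; exact zero_le_one.trans (le_max_right _ _)

/-- Both terms of the symbol lie in $[0,K]$, hence so does the modulus of their difference. The
definition of a cutoff does not impose $\chi\le1$, which is why a general $K$ is carried. -/
theorem abs_lpSymbol_le {χ : E3 → ℝ} (hχ : IsCutoff χ) {K : ℝ} (hK : ∀ ξ, χ ξ ≤ K) (j : ℕ)
    (ξ : E3) : |lpSymbol χ j ξ| ≤ K := by
  cases j with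
  | zero => rw [lpSymbol, abs_of_nonneg (hχ.nonneg ξ)]; exact hK ξ
  | succ q =>
    rw [lpSymbol, abs_sub_le_iff]
    constructor
    · linarith [hK (((2 : ℝ) ^ (q + 1))⁻¹ • ξ), hχ.nonneg (((2 : ℝ) ^ q)⁻¹ • ξ)]
    · linarith [hK (((2 : ℝ) ^ q)⁻¹ • ξ), hχ.nonneg (((2 : ℝ) ^ (q + 1))⁻¹ • ξ)]

/-- The symbol of a block vanishes on frequencies well below the corresponding dyadic shell. -/
theorem lpSymbol_axisFreq_eq_zero {χ : E3 → ℝ} (hχ : IsCutoff χ) {j : ℕ} {k : ℤ}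
    (h : 4 / 3 * |(k : ℝ)| ≤ 2 ^ j) : lpSymbol χ (j + 1) (freq (axisFreq k)) = 0 := by
  have h2 : (0 : ℝ) < 2 ^ j := by positivity
  have ha := abs_nonneg (k : ℝ)
  rw [lpSymbol, hχ.eq_one, hχ.eq_one, sub_self]
  · rw [norm_scaled_freq, div_le_iff₀ h2]; linarith
  · rw [norm_scaled_freq, div_le_iff₀ (by positivity), pow_succ]; linarith

/-! ### Wave packets: an oscillation modulated by a Fejér kernel -/

theorem integral_cos_int_mul {L : ℝ} (hL : 0 < L) (n : ℤ) :
    ∫ s in 0..L, Real.cos (2 * Real.pi / L * n * s) = if n = 0 then L else 0 := by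
  by_cases hn : n = 0
  · simp [hn]
  rw [if_neg hn]
  have hn' : (n : ℝ) ≠ 0 := by exact_mod_cast hn
  have hc : 2 * Real.pi / L * n ≠ 0 := by positivity
  rw [intervalIntegral.integral_comp_mul_left (fun y => Real.cos y) hc, integral_cos]
  have : 2 * Real.pi / L * n * L = n * (2 * Real.pi) := by field_simp
  rw [this, mul_zero, Real.sin_zero, sub_zero, ← sub_zero (n * (2 * Real.pi)),
    Real.sin_int_mul_two_pi_sub]
  simp

theorem integral_sin_mul_sin {L : ℝ} (hL : 0 < L) {k l : ℤ} (hk : 0 < k) (hl : 0 < l) :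
    ∫ s in 0..L, Real.sin (2 * Real.pi / L * k * s) * Real.sin (2 * Real.pi / L * l * s)
      = if k = l then L / 2 else 0 := by
  have e : ∀ s : ℝ, Real.sin (2 * Real.pi / L * k * s) * Real.sin (2 * Real.pi / L * l * s)
      = (Real.cos (2 * Real.pi / L * (k - l : ℤ) * s)
        - Real.cos (2 * Real.pi / L * (k + l : ℤ) * s)) / 2 := by
    intro s
    have h1 : 2 * Real.pi / L * (k - l : ℤ) * s = 2 * Real.pi / L * k * s - 2 * Real.pi / L * l * s := by
      push_cast; ring
    have h2 : 2 * Real.pi / L * (k + l : ℤ) * s = 2 * Real.pi / L * k * s + 2 * Real.pi / L * l * s := by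
      push_cast; ring
    rw [h1, h2, Real.cos_sub, Real.cos_add]; ring
  simp only [e]
  rw [intervalIntegral.integral_div, intervalIntegral.integral_sub
    (Continuous.intervalIntegrable (by fun_prop) _ _)
    (Continuous.intervalIntegrable (by fun_prop) _ _),
    -- Positivity of both frequencies excludes the resonance $k+l=0$.
    integral_cos_int_mul hL, integral_cos_int_mul hL, if_neg (by omega : k + l ≠ 0)]
  simp only [sub_eq_zero, sub_zero]
  split_ifs <;> simp

theorem deriv_cosSum {ι : Type*} (L : ℝ) (P : Finset ι) (c : ι → ℝ) (k : ι → ℤ) :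
    deriv (cosSum L P c k) = fun s => ∑ p ∈ P,
      -(c p * (2 * Real.pi / L * k p)) * Real.sin (2 * Real.pi / L * k p * s) := by
  funext s
  have h : HasDerivAt (cosSum L P c k) (∑ p ∈ P,
      -(c p * (2 * Real.pi / L * k p)) * Real.sin (2 * Real.pi / L * k p * s)) s := by
    refine HasDerivAt.fun_sum fun p _ => ?_
    have h1 : HasDerivAt (fun s : ℝ => 2 * Real.pi / L * k p * s) (2 * Real.pi / L * k p) s := by
      simpa using (hasDerivAt_id s).const_mul (2 * Real.pi / L * k p)
    exact (h1.cos.const_mul (c p)).congr_deriv (by ring)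
  exact h.deriv

theorem deriv_deriv_cosSum {ι : Type*} (L : ℝ) (P : Finset ι) (c : ι → ℝ) (k : ι → ℤ) :
    deriv (deriv (cosSum L P c k)) = cosSum L P (fun p => -(c p * (2 * Real.pi / L * k p) ^ 2)) k := by
  rw [deriv_cosSum]
  funext s
  have h : HasDerivAt (fun s => ∑ p ∈ P,
      -(c p * (2 * Real.pi / L * k p)) * Real.sin (2 * Real.pi / L * k p * s))
      (cosSum L P (fun p => -(c p * (2 * Real.pi / L * k p) ^ 2)) k s) s := by
    refine HasDerivAt.fun_sum fun p _ => ?_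
    have h1 : HasDerivAt (fun s : ℝ => 2 * Real.pi / L * k p * s) (2 * Real.pi / L * k p) s := by
      simpa using (hasDerivAt_id s).const_mul (2 * Real.pi / L * k p)
    exact (h1.sin.const_mul (-(c p * (2 * Real.pi / L * k p)))).congr_deriv (by ring)
  exact h.deriv

/-- The index set of the double sum defining the Fejér kernel. -/
def packetIndex (N : ℕ) : Finset (ℕ × ℕ) := Finset.range N ×ˢ Finset.range N

/-- The frequencies of a wave packet of width `N` around the frequency `lam`. -/
def packetFreq (lam : ℕ) (p : ℕ × ℕ) : ℤ := lam + p.1 - p.2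

/-- The wave packet `A cos ((2π/L) lam s) F_N(s)`, with `F_N` the Fejér kernel. -/
noncomputable def packet (L A : ℝ) (lam N : ℕ) : ℝ → ℝ :=
  cosSum L (packetIndex N) (fun _ => A) (packetFreq lam)

theorem card_packetIndex (N : ℕ) : (packetIndex N).card = N ^ 2 := by
  simp [packetIndex, sq]

theorem packetFreq_sub_abs_le {lam N : ℕ} {p : ℕ × ℕ} (hp : p ∈ packetIndex N) :
    |(packetFreq lam p : ℝ) - lam| ≤ N := by
  simp only [packetIndex, Finset.mem_product, Finset.mem_range] at hp
  have h1 : (p.1 : ℝ) ≤ N := by exact_mod_cast hp.1.le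
  have h2 : (p.2 : ℝ) ≤ N := by exact_mod_cast hp.2.le
  have h3 : (0 : ℝ) ≤ p.1 := by positivity
  have h4 : (0 : ℝ) ≤ p.2 := by positivity
  simp only [packetFreq]
  push_cast
  rw [abs_le]; constructor <;> linarith

theorem packetFreq_bounds {lam N : ℕ} (h : 2 * N ≤ lam) {p : ℕ × ℕ} (hp : p ∈ packetIndex N) :
    (lam : ℝ) / 2 ≤ packetFreq lam p ∧ (packetFreq lam p : ℝ) ≤ 3 / 2 * lam := by
  have h0 : (2 : ℝ) * N ≤ lam := by exact_mod_cast h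
  have := abs_le.1 (packetFreq_sub_abs_le (lam := lam) hp)
  constructor <;> linarith

/-- Real form of $\operatorname{Re}\bigl(e^{ia}\,|\sum_j e^{iy_j}|^2\bigr)$. The modulus squared
makes the Fejér kernel nonnegative, and the phase $a$ factors out as the carrier wave. -/
theorem sum_cos_packet (y : ℕ → ℝ) (a : ℝ) (N : ℕ) :
    ∑ p ∈ packetIndex N, Real.cos (a + y p.1 - y p.2)
      = Real.cos a * ((∑ i ∈ Finset.range N, Real.cos (y i)) ^ 2
        + (∑ i ∈ Finset.range N, Real.sin (y i)) ^ 2) := by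
  have e : ∀ p : ℕ × ℕ, Real.cos (a + y p.1 - y p.2)
      = Real.cos a * (Real.cos (y p.1) * Real.cos (y p.2) + Real.sin (y p.1) * Real.sin (y p.2))
        - Real.sin a * (Real.sin (y p.1) * Real.cos (y p.2))
        + Real.sin a * (Real.cos (y p.1) * Real.sin (y p.2)) := by
    intro p
    rw [Real.cos_sub, Real.cos_add, Real.sin_add]; ring
  have S : ∀ f g : ℕ → ℝ, ∑ p ∈ packetIndex N, f p.1 * g p.2
      = (∑ i ∈ Finset.range N, f i) * ∑ i ∈ Finset.range N, g i := fun f g => by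
    rw [packetIndex, Finset.sum_product, Finset.sum_mul_sum]
  simp only [e, Finset.sum_add_distrib, Finset.sum_sub_distrib, ← Finset.mul_sum]
  rw [S (fun i => Real.cos (y i)) (fun i => Real.cos (y i)),
    S (fun i => Real.sin (y i)) (fun i => Real.sin (y i)),
    S (fun i => Real.sin (y i)) (fun i => Real.cos (y i)),
    S (fun i => Real.cos (y i)) (fun i => Real.sin (y i))]
  ring

/-- The Fejér kernel `∑_{i,j<N} cos ((2π/L)(i-j)s)`. -/
noncomputable def fejer (L : ℝ) (N : ℕ) : ℝ → ℝ :=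
  cosSum L (packetIndex N) (fun _ => 1) (packetFreq 0)

theorem packet_eq (L A : ℝ) (lam N : ℕ) (s : ℝ) :
    packet L A lam N s = A * (Real.cos (2 * Real.pi / L * lam * s) * fejer L N s) := by
  have h := sum_cos_packet (fun i => 2 * Real.pi / L * i * s)
  have e1 : ∀ p, 2 * Real.pi / L * packetFreq lam p * s = 2 * Real.pi / L * lam * s
      + 2 * Real.pi / L * (p.1 : ℕ) * s - 2 * Real.pi / L * (p.2 : ℕ) * s := by
    intro p; simp only [packetFreq]; push_cast; ring
  have e2 : ∀ p, 2 * Real.pi / L * packetFreq 0 p * s = 0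
      + 2 * Real.pi / L * (p.1 : ℕ) * s - 2 * Real.pi / L * (p.2 : ℕ) * s := by
    intro p; simp only [packetFreq]; push_cast; ring
  simp only [packet, fejer, cosSum, one_mul, ← Finset.mul_sum, e1, e2, h, Real.cos_zero]

theorem fejer_nonneg (L : ℝ) (N : ℕ) (s : ℝ) : 0 ≤ fejer L N s := by
  have h := sum_cos_packet (fun i => 2 * Real.pi / L * i * s) 0 N
  have e2 : ∀ p, 2 * Real.pi / L * packetFreq 0 p * s = 0
      + 2 * Real.pi / L * (p.1 : ℕ) * s - 2 * Real.pi / L * (p.2 : ℕ) * s := by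
    intro p; simp only [packetFreq]; push_cast; ring
  simp only [fejer, cosSum, one_mul, e2, h, Real.cos_zero]
  positivity

theorem abs_packet_le_fejer (L : ℝ) {A : ℝ} (hA : 0 ≤ A) (lam N : ℕ) (s : ℝ) :
    |packet L A lam N s| ≤ A * fejer L N s := by
  rw [packet_eq, abs_mul, abs_mul, abs_of_nonneg hA, abs_of_nonneg (fejer_nonneg L N s)]
  gcongr
  exact mul_le_of_le_one_left (fejer_nonneg L N s) (Real.abs_cos_le_one _)

theorem continuous_fejer (L : ℝ) (N : ℕ) : Continuous (fejer L N) :=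
  (contDiff_cosSum L _ _ _ (n := 0)).continuous

theorem contDiff_packet (L A : ℝ) (lam N : ℕ) {n : WithTop ℕ∞} : ContDiff ℝ n (packet L A lam N) :=
  contDiff_cosSum L _ _ _

/-- Only the $N$ diagonal pairs have zero frequency. The mean is thus of order $N$ while the maximum
is $N^2$: the kernel concentrates on a set of relative size $1/N$. -/
theorem integral_fejer {L : ℝ} (hL : 0 < L) (N : ℕ) : ∫ s in 0..L, fejer L N s = N * L := by
  simp only [fejer, cosSum, one_mul]
  rw [intervalIntegral.integral_finsetSum
    (fun p _ => Continuous.intervalIntegrable (by fun_prop) _ _)]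
  simp only [integral_cos_int_mul hL, packetFreq, packetIndex, Finset.sum_product]
  have : ∀ i ∈ Finset.range N, ∑ j ∈ Finset.range N,
      (if ((0 : ℕ) : ℤ) + (i : ℤ) - (j : ℤ) = 0 then L else 0) = L := by
    intro i hi
    rw [Finset.sum_eq_single i]
    · simp
    · intro j _ hj
      rw [if_neg]; omega
    · intro h; exact absurd hi h
  rw [Finset.sum_congr rfl this]
  simp

theorem abs_packet_le (L : ℝ) {A : ℝ} (hA : 0 ≤ A) (lam N : ℕ) (s : ℝ) :
    |packet L A lam N s| ≤ A * N ^ 2 := by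
  refine (abs_cosSum_le _ _ _ _ _).trans (le_of_eq ?_)
  rw [Finset.sum_const, card_packetIndex, abs_of_nonneg hA, nsmul_eq_mul]
  push_cast; ring

/-- Nonnegativity of the Fejér kernel is what gives a factor $N$; the triangle inequality over the
modes would only give $N^2$. -/
theorem integral_abs_packet_le {L : ℝ} (hL : 0 < L) {A : ℝ} (hA : 0 ≤ A) (lam N : ℕ) :
    ∫ s in 0..L, |packet L A lam N s| ≤ A * N * L := by
  have hc : Continuous (packet L A lam N) := (contDiff_packet L A lam N (n := 0)).continuous
  have hf := continuous_fejer L N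
  refine (intervalIntegral.integral_mono_on hL.le (hc.abs.intervalIntegrable _ _)
    (Continuous.intervalIntegrable (by fun_prop) _ _)
    (fun s _ => abs_packet_le_fejer L hA lam N s)).trans (le_of_eq ?_)
  rw [intervalIntegral.integral_const_mul, integral_fejer hL]; ring

theorem abs_deriv_deriv_packet_le {L : ℝ} (hL : 0 < L) {A : ℝ} (hA : 0 ≤ A) {lam N : ℕ}
    (h : 2 * N ≤ lam) (s : ℝ) :
    |deriv (deriv (packet L A lam N)) s| ≤ 4 * A * (2 * Real.pi / L) ^ 2 * lam ^ 2 * N ^ 2 := by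
  rw [packet, deriv_deriv_cosSum]
  refine (abs_cosSum_le _ _ _ _ _).trans ?_
  have : ∀ p ∈ packetIndex N, |-(A * (2 * Real.pi / L * packetFreq lam p) ^ 2)|
      ≤ 4 * A * (2 * Real.pi / L) ^ 2 * lam ^ 2 := by
    intro p hp
    obtain ⟨h1, h2⟩ := packetFreq_bounds h hp
    have h0 : (0 : ℝ) ≤ lam := by positivity
    rw [abs_neg, abs_of_nonneg (by positivity), mul_pow]
    -- The frequencies are at most $\frac32\lambda$; $(3/2)^2$ is rounded up to $4$.
    have : (packetFreq lam p : ℝ) ^ 2 ≤ 4 * lam ^ 2 := by nlinarith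
    calc A * ((2 * Real.pi / L) ^ 2 * (packetFreq lam p : ℝ) ^ 2)
        ≤ A * ((2 * Real.pi / L) ^ 2 * (4 * lam ^ 2)) := by gcongr
      _ = _ := by ring
  refine (Finset.sum_le_sum this).trans (le_of_eq ?_)
  rw [Finset.sum_const, card_packetIndex, nsmul_eq_mul]
  push_cast; ring

/-- Freezing every frequency $k$ at $\lambda$ turns the second derivative into a multiple of the
packet, to which the Fejér bound applies. The error $k^2-\lambda^2=(k-\lambda)(k+\lambda)$ is at
most $3\lambda N$ for each of the $N^2$ modes. -/
theorem abs_deriv_deriv_packet_le_fejer {L : ℝ} {A : ℝ} (hA : 0 ≤ A) {lam N : ℕ}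
    (h : N ≤ lam) (s : ℝ) :
    |deriv (deriv (packet L A lam N)) s|
      ≤ A * (2 * Real.pi / L) ^ 2 * (lam ^ 2 * fejer L N s + 3 * lam * N ^ 3) := by
  have e : deriv (deriv (packet L A lam N)) s = -((2 * Real.pi / L) ^ 2 * (lam ^ 2 * packet L A lam N s
      + cosSum L (packetIndex N) (fun p => A * ((packetFreq lam p : ℝ) ^ 2 - lam ^ 2)) (packetFreq lam) s)) := by
    rw [packet, deriv_deriv_cosSum, cosSum, cosSum, cosSum, Finset.mul_sum, ← Finset.sum_add_distrib,
      Finset.mul_sum, ← Finset.sum_neg_distrib]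
    refine Finset.sum_congr rfl fun p _ => ?_
    ring
  have hN : (N : ℝ) ≤ lam := by exact_mod_cast h
  have hN0 : (0 : ℝ) ≤ N := by positivity
  have hr : |cosSum L (packetIndex N) (fun p => A * ((packetFreq lam p : ℝ) ^ 2 - lam ^ 2))
      (packetFreq lam) s| ≤ A * (3 * lam * N ^ 3) := by
    refine (abs_cosSum_le _ _ _ _ _).trans ?_
    have : ∀ p ∈ packetIndex N, |A * ((packetFreq lam p : ℝ) ^ 2 - lam ^ 2)| ≤ A * (3 * lam * N) := by
      intro p hp
      rw [abs_mul, abs_of_nonneg hA]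
      have h1 := packetFreq_sub_abs_le (lam := lam) hp
      have h2 : |(packetFreq lam p : ℝ) + lam| ≤ 3 * lam := by
        have := abs_le.1 h1
        rw [abs_le]; constructor <;> linarith
      have : (packetFreq lam p : ℝ) ^ 2 - lam ^ 2
        = (packetFreq lam p + lam) * (packetFreq lam p - lam) := by ring
      rw [this, abs_mul]
      gcongr
    refine (Finset.sum_le_sum this).trans (le_of_eq ?_)
    rw [Finset.sum_const, card_packetIndex, nsmul_eq_mul]
    push_cast; ring
  rw [e, abs_neg, abs_mul, abs_of_nonneg (by positivity : (0:ℝ) ≤ (2 * Real.pi / L) ^ 2)]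
  calc (2 * Real.pi / L) ^ 2 * |_ + _|
      ≤ (2 * Real.pi / L) ^ 2 * (lam ^ 2 * (A * fejer L N s) + A * (3 * lam * N ^ 3)) := by
        gcongr
        refine (abs_add_le _ _).trans (add_le_add ?_ hr)
        rw [abs_mul, abs_of_nonneg (by positivity : (0:ℝ) ≤ (lam : ℝ) ^ 2)]
        gcongr
        exact abs_packet_le_fejer L hA lam N s
    _ = _ := by ring

/-- The hypothesis $N^2\le\lambda$ absorbs the error $3\lambda N^3$ of frequency freezing into
$3\lambda^2N$, so that the total constant is $1+3=4$. -/
theorem integral_abs_deriv_deriv_packet_le {L : ℝ} (hL : 0 < L) {A : ℝ} (hA : 0 ≤ A) {lam N : ℕ}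
    (h : N ≤ lam) (h' : N ^ 2 ≤ lam) :
    ∫ s in 0..L, |deriv (deriv (packet L A lam N)) s|
      ≤ 4 * A * (2 * Real.pi / L) ^ 2 * lam ^ 2 * N * L := by
  have hc : Continuous (deriv (deriv (packet L A lam N))) := by
    rw [packet, deriv_deriv_cosSum]; exact (contDiff_cosSum L _ _ _ (n := 0)).continuous
  have hf := continuous_fejer L N
  refine (intervalIntegral.integral_mono_on hL.le (hc.abs.intervalIntegrable _ _)
    (Continuous.intervalIntegrable (by fun_prop) _ _)
    (fun s _ => abs_deriv_deriv_packet_le_fejer hA h s)).trans ?_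
  rw [intervalIntegral.integral_const_mul, intervalIntegral.integral_add
    (Continuous.intervalIntegrable (by fun_prop) _ _)
    (Continuous.intervalIntegrable (by fun_prop) _ _), intervalIntegral.integral_const_mul,
    integral_fejer hL, intervalIntegral.integral_const, smul_eq_mul, sub_zero]
  have h2 : (N : ℝ) ^ 2 ≤ lam := by exact_mod_cast h'
  calc A * (2 * Real.pi / L) ^ 2 * (lam ^ 2 * (N * L) + L * (3 * lam * N ^ 3))
      = A * (2 * Real.pi / L) ^ 2 * (lam ^ 2 * (N * L) + L * (3 * lam * N * N ^ 2)) := by ring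
    _ ≤ A * (2 * Real.pi / L) ^ 2 * (lam ^ 2 * (N * L) + L * (3 * lam * N * lam)) := by gcongr
    _ = _ := by ring

/-- This bounds from below the additive energy of an interval: the pairs $(a+d,a)$ and $(b+d,b)$
with $a,b,d<M$ have the same difference $d$. The factor $2$ in the width leaves room for $a+d$. -/
theorem card_packet_coincidences (lam M : ℕ) :
    M ^ 3 ≤ ((packetIndex (2 * M) ×ˢ packetIndex (2 * M)).filter
      fun z => packetFreq lam z.1 = packetFreq lam z.2).card := by
  have : M ^ 3 = (Finset.range M ×ˢ Finset.range M ×ˢ Finset.range M).card := by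
    simp [pow_succ, mul_assoc]
  rw [this]
  refine Finset.card_le_card_of_injOn
    (fun w => ((w.1 + w.2.2, w.1), (w.2.1 + w.2.2, w.2.1))) ?_ ?_
  · rintro ⟨a, b, d⟩ hw
    rw [Finset.mem_coe] at hw
    simp only [Finset.mem_product, Finset.mem_range] at hw
    refine Finset.mem_coe.2 (Finset.mem_filter.2 ⟨?_, ?_⟩)
    · simp only [Finset.mem_product, packetIndex, Finset.mem_range]
      omega
    · simp only [packetFreq]
      push_cast
      ring
  · rintro ⟨a, b, d⟩ _ ⟨a', b', d'⟩ _ h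
    simp only [Prod.mk.injEq] at h ⊢
    omega

/-- Orthogonality of the sines leaves only coincident frequencies in the expanded square. There are
at least $M^3$ of them, and each contributes at least $A^2\kappa^2(\lambda/2)^2L/2$ with
$\kappa=2\pi/L$, which accounts for the $8$. -/
theorem integral_deriv_packet_sq_ge {L : ℝ} (hL : 0 < L) (A : ℝ) {lam M : ℕ}
    (h : 4 * M ≤ lam) (hlam : 0 < lam) :
    A ^ 2 * (2 * Real.pi / L) ^ 2 * lam ^ 2 * M ^ 3 * L / 8
      ≤ ∫ s in 0..L, deriv (packet L A lam (2 * M)) s ^ 2 := by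
  set κ := 2 * Real.pi / L with hκ
  set P := packetIndex (2 * M) with hP
  have hb : ∀ p ∈ P, (lam : ℝ) / 2 ≤ packetFreq lam p := fun p hp =>
    (packetFreq_bounds (by omega) hp).1
  have hpos : ∀ p ∈ P, 0 < packetFreq lam p := by
    intro p hp
    have := hb p hp
    have h0 : (0 : ℝ) < lam := by exact_mod_cast hlam
    have : (0 : ℝ) < packetFreq lam p := by linarith
    exact_mod_cast this
  have e : ∀ s, deriv (packet L A lam (2 * M)) s ^ 2 = ∑ z ∈ P ×ˢ P,
      A ^ 2 * κ ^ 2 * (packetFreq lam z.1 * packetFreq lam z.2)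
        * (Real.sin (κ * packetFreq lam z.1 * s) * Real.sin (κ * packetFreq lam z.2 * s)) := by
    intro s
    rw [packet, deriv_cosSum, sq, Finset.sum_mul_sum, ← Finset.sum_product']
    refine Finset.sum_congr rfl fun z _ => ?_
    ring
  simp only [e]
  rw [intervalIntegral.integral_finsetSum
    (fun p _ => Continuous.intervalIntegrable (by fun_prop) _ _)]
  have e2 : ∀ z ∈ P ×ˢ P, (∫ s in 0..L, A ^ 2 * κ ^ 2 * (packetFreq lam z.1 * packetFreq lam z.2)
        * (Real.sin (κ * packetFreq lam z.1 * s) * Real.sin (κ * packetFreq lam z.2 * s)))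
      = if packetFreq lam z.1 = packetFreq lam z.2 then
          A ^ 2 * κ ^ 2 * (packetFreq lam z.1 * packetFreq lam z.2) * (L / 2) else 0 := by
    intro z hz
    rw [Finset.mem_product] at hz
    rw [intervalIntegral.integral_const_mul, hκ,
      integral_sin_mul_sin hL (hpos _ hz.1) (hpos _ hz.2)]
    split_ifs <;> simp
  rw [Finset.sum_congr rfl e2, ← Finset.sum_filter]
  have hc : (M : ℝ) ^ 3 ≤ (((P ×ˢ P).filter
      fun z => packetFreq lam z.1 = packetFreq lam z.2).card : ℝ) := by
    exact_mod_cast card_packet_coincidences lam M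
  calc A ^ 2 * κ ^ 2 * lam ^ 2 * M ^ 3 * L / 8
      = (M : ℝ) ^ 3 * (A ^ 2 * κ ^ 2 * (lam / 2 * (lam / 2)) * (L / 2)) := by ring
    _ ≤ (((P ×ˢ P).filter fun z => packetFreq lam z.1 = packetFreq lam z.2).card : ℝ)
        * (A ^ 2 * κ ^ 2 * (lam / 2 * (lam / 2)) * (L / 2)) := by gcongr
    _ = ((P ×ˢ P).filter fun z => packetFreq lam z.1 = packetFreq lam z.2).card
        • (A ^ 2 * κ ^ 2 * (lam / 2 * (lam / 2)) * (L / 2)) := by rw [nsmul_eq_mul]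
    _ ≤ _ := by
        refine Finset.card_nsmul_le_sum _ _ _ fun z hz => ?_
        rw [Finset.mem_filter, Finset.mem_product] at hz
        have h1 := hb _ hz.1.1
        have h2 := hb _ hz.1.2
        have h0 : (0 : ℝ) ≤ lam := by positivity
        gcongr
        linarith

/-- The second antiderivative of a wave packet. -/
noncomputable def packetPrimitive (L A : ℝ) (lam N : ℕ) : ℝ → ℝ :=
  cosSum L (packetIndex N) (fun p => -(A / (2 * Real.pi / L * packetFreq lam p) ^ 2))
    (packetFreq lam)

theorem deriv_deriv_packetPrimitive {L : ℝ} (hL : 0 < L) (A : ℝ) {lam N : ℕ} (h : 2 * N ≤ lam)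
    (hlam : 0 < lam) : deriv (deriv (packetPrimitive L A lam N)) = packet L A lam N := by
  rw [packetPrimitive, deriv_deriv_cosSum, packet]
  funext s
  refine Finset.sum_congr rfl fun p hp => ?_
  have h0 : (0 : ℝ) < lam := by exact_mod_cast hlam
  have : (packetFreq lam p : ℝ) ≠ 0 := by
    have := (packetFreq_bounds h hp).1
    intro h; linarith
  have hk : 2 * Real.pi / L * packetFreq lam p ≠ 0 := by positivity
  beta_reduce
  rw [neg_mul (A / _), neg_neg, div_mul_cancel₀ _ (pow_ne_zero 2 hk)]

theorem abs_packetPrimitive_le {L : ℝ} (hL : 0 < L) {A : ℝ} (hA : 0 ≤ A) {lam N : ℕ}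
    (h : 2 * N ≤ lam) (hlam : 0 < lam) (s : ℝ) :
    |packetPrimitive L A lam N s| ≤ 4 * A * N ^ 2 / ((2 * Real.pi / L) ^ 2 * lam ^ 2) := by
  have h0 : (0 : ℝ) < lam := by exact_mod_cast hlam
  refine (abs_cosSum_le _ _ _ _ _).trans ?_
  have : ∀ p ∈ packetIndex N, |-(A / (2 * Real.pi / L * packetFreq lam p) ^ 2)|
      ≤ A / ((2 * Real.pi / L) ^ 2 * (lam / 2) ^ 2) := by
    intro p hp
    have h1 := (packetFreq_bounds h hp).1
    rw [abs_neg, abs_of_nonneg (by positivity), mul_pow]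
    gcongr
  refine (Finset.sum_le_sum this).trans (le_of_eq ?_)
  rw [Finset.sum_const, card_packetIndex, nsmul_eq_mul]
  push_cast; field_simp; norm_num

/-! ### Temporal bumps accumulating at time one -/

/-- A smooth bump on the line, equal to `1` near the origin. -/
noncomputable def timeProfile : ContDiffBump (0 : ℝ) where
  rIn := 1 / 10
  rOut := 1 / 5
  rIn_pos := by norm_num
  rIn_lt_rOut := by norm_num

/-- The inverse `65536 ^ m` of the duration of the `m`-th stage. -/
noncomputable def stageRate (m : ℕ) : ℝ := 65536 ^ m

/-- The temporal bump of the `m`-th stage, centred at `1 - 65536 ^ (-m)`. -/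
noncomputable def timeBump (m : ℕ) (t : ℝ) : ℝ := timeProfile (1 - stageRate m * (1 - t))

/-- The time interval of the `m`-th stage. -/
def stage (m : ℕ) : Set ℝ := Icc (1 - 6 / 5 / stageRate m) (1 - 4 / 5 / stageRate m)

theorem stageRate_pos (m : ℕ) : 0 < stageRate m := by unfold stageRate; positivity

theorem one_le_stageRate (m : ℕ) : 1 ≤ stageRate m := one_le_pow₀ (by norm_num)

theorem mem_stage_iff {m : ℕ} {t : ℝ} :
    t ∈ stage m ↔ 4 / 5 ≤ stageRate m * (1 - t) ∧ stageRate m * (1 - t) ≤ 6 / 5 := by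
  have h := stageRate_pos m
  rw [stage, mem_Icc, sub_le_comm, le_sub_comm, le_div_iff₀ h, div_le_iff₀ h, mul_comm]
  tauto

theorem contDiff_timeBump (m : ℕ) {n : ℕ∞} : ContDiff ℝ n (timeBump m) := by
  unfold timeBump
  exact timeProfile.contDiff.comp (by fun_prop)

theorem continuous_timeBump (m : ℕ) : Continuous (timeBump m) :=
  (contDiff_timeBump m (n := 0)).continuous

theorem differentiable_timeBump (m : ℕ) : Differentiable ℝ (timeBump m) :=
  (contDiff_timeBump m (n := 1)).differentiable one_ne_zero

theorem contDiff_deriv_timeBump (m : ℕ) : ContDiff ℝ ∞ (deriv (timeBump m)) :=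
  (contDiff_infty_iff_deriv.1 (contDiff_timeBump m (n := ⊤))).2

theorem continuous_deriv_timeBump (m : ℕ) : Continuous (deriv (timeBump m)) :=
  (contDiff_deriv_timeBump m).continuous

theorem abs_timeBump_le_one (m : ℕ) (t : ℝ) : |timeBump m t| ≤ 1 := by
  rw [timeBump, abs_of_nonneg timeProfile.nonneg]; exact timeProfile.le_one

theorem timeBump_eq_zero {m : ℕ} {t : ℝ} (ht : t ∉ stage m) : timeBump m t = 0 := by
  refine timeProfile.zero_of_le_dist ?_
  rw [mem_stage_iff, not_and_or, not_le, not_le] at ht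
  change (1 / 5 : ℝ) ≤ _
  rw [Real.dist_eq, le_abs]
  rcases ht with h | h
  · left; linarith
  · right; linarith

theorem deriv_timeBump_eq_zero {m : ℕ} {t : ℝ} (ht : t ∉ stage m) : deriv (timeBump m) t = 0 := by
  have h : timeBump m =ᶠ[𝓝 t] fun _ => 0 := by
    filter_upwards [isClosed_Icc.isOpen_compl.mem_nhds ht] with s hs using timeBump_eq_zero hs
  rw [h.deriv_eq, deriv_const]

theorem stage_disjoint {m n : ℕ} {t : ℝ} (hm : t ∈ stage m) (hn : t ∈ stage n) : m = n := by
  wlog h : m < n generalizing m n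
  · rcases lt_trichotomy m n with h' | h' | h'
    · exact this hm hn h'
    · exact h'
    · exact (this hn hm h').symm
  exfalso
  rw [mem_stage_iff] at hm hn
  -- A ratio $2$ between the rates suffices, since the window $[4/5,6/5]$ of the rescaled time has
  -- endpoint ratio $3/2$.
  have : 2 * stageRate m ≤ stageRate n := by
    have h1 : stageRate (m + 1) ≤ stageRate n := pow_le_pow_right₀ (by norm_num) h
    have h2 : stageRate (m + 1) = 65536 * stageRate m := by unfold stageRate; ring
    linarith [stageRate_pos m]
  have ht : 0 ≤ 1 - t := by
    by_contra hc
    push Not at hc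
    linarith [mul_neg_of_pos_of_neg (stageRate_pos m) hc]
  nlinarith

/-- At each time at most one stage is active. -/
theorem exists_active_stage (t : ℝ) : ∃ m, ∀ n, n ≠ m → t ∉ stage n := by
  by_cases h : ∃ m, t ∈ stage m
  · obtain ⟨m, hm⟩ := h
    exact ⟨m, fun n hn hn' => hn (stage_disjoint hn' hm)⟩
  · push Not at h
    exact ⟨0, fun n _ => h n⟩

theorem one_le_notMem_stage (m : ℕ) {t : ℝ} (ht : 1 ≤ t) : t ∉ stage m := by
  rw [mem_stage_iff]
  intro h
  nlinarith [h.1, stageRate_pos m]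

theorem zero_notMem_stage {m : ℕ} (hm : m ≠ 0) : (0 : ℝ) ∉ stage m := by
  intro h
  refine hm (stage_disjoint h ?_)
  rw [mem_stage_iff]; unfold stageRate; norm_num

/-- Stage $0$ is centred at the initial time, so the evolution starts at full amplitude and only the
descending half of this bump is seen. -/
theorem timeBump_zero_zero : timeBump 0 0 = 1 := by
  unfold timeBump
  refine timeProfile.one_of_mem_closedBall ?_
  simp [stageRate, timeProfile]

theorem tendsto_stageRate : Tendsto stageRate atTop atTop :=
  tendsto_pow_atTop_atTop_of_one_lt (by norm_num)

/-- Away from time one only finitely many stages are met. -/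
theorem eventually_notMem_stage {t : ℝ} (ht : t < 1) :
    ∃ n, ∀ᶠ s in 𝓝 t, ∀ m, n ≤ m → s ∉ stage m := by
  obtain ⟨n, hn⟩ := (tendsto_stageRate.eventually_gt_atTop (6 / 5 / ((1 - t) / 2))).exists
  refine ⟨n, ?_⟩
  filter_upwards [Iio_mem_nhds (show t < (1 + t) / 2 by linarith)] with s hs m hm hmem
  have hs : s < (1 + t) / 2 := hs
  rw [mem_stage_iff] at hmem
  rw [div_lt_iff₀ (by linarith)] at hn
  have h1 : stageRate n ≤ stageRate m := pow_le_pow_right₀ (by norm_num) hm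
  nlinarith [hmem.2, stageRate_pos n]

/-- Near time one only late stages are met. -/
theorem eventually_notMem_early_stage (M : ℕ) :
    ∀ᶠ t in 𝓝[<] (1 : ℝ), ∀ m, m < M → t ∉ stage m := by
  have h : 1 - 4 / 5 / stageRate M < 1 := by
    have := stageRate_pos M
    have : 0 < 4 / 5 / stageRate M := by positivity
    linarith
  filter_upwards [Ioo_mem_nhdsLT h] with t ht m hm hmem
  rw [mem_stage_iff] at hmem
  have h1 : stageRate m ≤ stageRate M := pow_le_pow_right₀ (by norm_num) hm.le
  have h2 : 1 - t < 4 / 5 / stageRate M := by linarith [ht.1]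
  rw [lt_div_iff₀ (stageRate_pos M)] at h2
  nlinarith [hmem.1, ht.2]

/-- All bumps are rescalings of one profile. Since stage $m$ lasts at most `(stageRate m)⁻¹`, the
integral of $|a_m'|$ is bounded uniformly in $m$. -/
theorem exists_deriv_timeBump_le :
    ∃ C : ℝ, 1 ≤ C ∧ ∀ m t, |deriv (timeBump m) t| ≤ C * stageRate m := by
  have hc : Continuous (deriv (timeProfile : ℝ → ℝ)) :=
    (timeProfile.contDiff (n := 1)).continuous_deriv_one
  have hs : HasCompactSupport (deriv (timeProfile : ℝ → ℝ)) := timeProfile.hasCompactSupport.deriv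
  obtain ⟨C, hC⟩ := hs.exists_bound_of_continuous hc
  refine ⟨max C 1, le_max_right _ _, fun m t => ?_⟩
  have hd : HasDerivAt (timeBump m)
      (deriv (timeProfile : ℝ → ℝ) (1 - stageRate m * (1 - t)) * stageRate m) t := by
    have h1 : HasDerivAt (fun t : ℝ => 1 - stageRate m * (1 - t)) (stageRate m) t := by
      simpa using (((hasDerivAt_id t).const_sub 1).const_mul (stageRate m)).const_sub 1
    exact (((timeProfile.contDiff (n := 1)).differentiable one_ne_zero _).hasDerivAt).comp t h1
  rw [hd.deriv, abs_mul, abs_of_pos (stageRate_pos m)]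
  exact mul_le_mul_of_nonneg_right ((hC _).trans (le_max_left _ _)) (stageRate_pos m).le

theorem volume_stage_le (m : ℕ) : volume (stage m) ≤ ENNReal.ofReal (stageRate m)⁻¹ := by
  rw [stage, Real.volume_Icc]
  refine ENNReal.ofReal_le_ofReal ?_
  have := stageRate_pos m
  rw [inv_eq_one_div, sub_sub_sub_cancel_left, ← sub_div]
  gcongr; norm_num

theorem lintegral_stage_le {m : ℕ} {F : ℝ → ℝ≥0∞} {c : ℝ≥0∞} (S : Set ℝ)
    (h0 : ∀ t, t ∉ stage m → F t = 0) (hc : ∀ t, F t ≤ c) :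
    ∫⁻ t in S, F t ≤ c * ENNReal.ofReal (stageRate m)⁻¹ := by
  calc ∫⁻ t in S, F t ≤ ∫⁻ t, F t := setLIntegral_le_lintegral _ _
    _ ≤ ∫⁻ t, (stage m).indicator (fun _ => c) t := by
        refine lintegral_mono fun t => ?_
        by_cases ht : t ∈ stage m
        · rw [indicator_of_mem ht]; exact hc t
        · rw [h0 t ht]; exact zero_le
    _ = c * volume (stage m) := lintegral_indicator_const measurableSet_Icc c
    _ ≤ _ := by gcongr; exact volume_stage_le m

theorem integral_abs_stage_le {m : ℕ} {F : ℝ → ℝ} {c : ℝ} (hc0 : 0 ≤ c) (S : Set ℝ)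
    (hF : Continuous F) (h0 : ∀ t, t ∉ stage m → F t = 0) (hc : ∀ t, |F t| ≤ c) :
    ∫ t in S, ‖F t‖ ≤ c * (stageRate m)⁻¹ := by
  rw [integral_norm_eq_lintegral_enorm hF.aestronglyMeasurable]
  refine ENNReal.toReal_le_of_le_ofReal
    (mul_nonneg hc0 (inv_nonneg.2 (stageRate_pos m).le)) ?_
  rw [ENNReal.ofReal_mul hc0]
  refine lintegral_stage_le S (fun t ht => by simp [h0 t ht]) fun t => ?_
  rw [← ofReal_norm]
  exact ENNReal.ofReal_le_ofReal (hc t)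

theorem integral_timeBump_sq_ge (m : ℕ) :
    1 / 10 * (stageRate m)⁻¹ ≤ ∫ t in 0..1, timeBump m t ^ 2 := by
  have hp := stageRate_pos m
  have h1 := one_le_stageRate m
  have hi : (stageRate m)⁻¹ ≤ 1 := inv_le_one_of_one_le₀ h1
  have hi0 : 0 < (stageRate m)⁻¹ := inv_pos.2 hp
  -- On $[a,b]$ the argument of the profile lies in $[0,1/10]$, the later half of its plateau. The
  -- earlier half is left out because it precedes time $0$ when $m=0$.
  set a := 1 - (stageRate m)⁻¹ with ha
  set b := 1 - 9 / 10 * (stageRate m)⁻¹ with hb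
  have hab : a ≤ b := by rw [ha, hb]; linarith
  have hc : Continuous fun t => timeBump m t ^ 2 := (continuous_timeBump m).pow 2
  calc 1 / 10 * (stageRate m)⁻¹ = ∫ _t in a..b, (1 : ℝ) := by
        rw [intervalIntegral.integral_const, ha, hb, smul_eq_mul]; ring
    _ = ∫ t in a..b, timeBump m t ^ 2 := by
        refine intervalIntegral.integral_congr fun t ht => ?_
        rw [uIcc_of_le hab] at ht
        have : timeBump m t = 1 := by
          refine timeProfile.one_of_mem_closedBall ?_
          change dist _ _ ≤ (1 / 10 : ℝ)
          have e : stageRate m * (stageRate m)⁻¹ = 1 := mul_inv_cancel₀ hp.ne'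
          have h2 : stageRate m * (1 - t) ≤ 1 := by
            have : stageRate m * (1 - t) ≤ stageRate m * (stageRate m)⁻¹ := by
              gcongr; linarith [ht.1]
            linarith
          have h3 : 9 / 10 ≤ stageRate m * (1 - t) := by
            have : stageRate m * (9 / 10 * (stageRate m)⁻¹) ≤ stageRate m * (1 - t) := by
              gcongr; linarith [ht.2]
            linarith
          rw [Real.dist_eq, abs_le]; constructor <;> linarith
        simp [this]
    _ ≤ ∫ t in 0..1, timeBump m t ^ 2 :=
        intervalIntegral.integral_mono_interval (by linarith) hab (by linarith)
          (ae_of_all _ fun t => sq_nonneg _) (hc.intervalIntegrable _ _)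

/-- The integrand is an exact derivative, so the work of a stage depends only on the amplitudes at
the two end times. The exactness of all energy balances below rests on this. -/
theorem integral_timeBump_mul_deriv (m : ℕ) (c d : ℝ) :
    ∫ t in c..d, timeBump m t * deriv (timeBump m) t
      = (timeBump m d ^ 2 - timeBump m c ^ 2) / 2 := by
  have h : ∀ t ∈ uIcc c d, HasDerivAt (fun t => timeBump m t ^ 2 / 2)
      (timeBump m t * deriv (timeBump m) t) t := fun t _ =>
    (((differentiable_timeBump m t).hasDerivAt.pow 2).div_const 2).congr_deriv (by
      push_cast; ring)
  rw [intervalIntegral.integral_eq_sub_of_hasDerivAt h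
    (((continuous_timeBump m).mul (continuous_deriv_timeBump m)).intervalIntegrable _ _)]
  ring

/-- A sum over the stages with at most one nonzero term at each time. -/
theorem tsum_active {E : Type*} [AddCommMonoid E] [TopologicalSpace E] {t : ℝ} {m : ℕ}
    (hm : ∀ n, n ≠ m → t ∉ stage n) {F : ℕ → E} (hF : ∀ n, t ∉ stage n → F n = 0) :
    ∑' n, F n = F m := tsum_eq_single m fun n hn => hF n (hm n hn)

theorem sum_range_active {E : Type*} [AddCommMonoid E] {t : ℝ} {m : ℕ}
    (hm : ∀ n, n ≠ m → t ∉ stage n) {F : ℕ → E} (hF : ∀ n, t ∉ stage n → F n = 0) (N : ℕ) :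
    ∑ n ∈ Finset.range N, F n = if m < N then F m else 0 := by
  split_ifs with h
  · exact Finset.sum_eq_single m (fun n _ hn => hF n (hm n hn))
      fun h' => absurd (Finset.mem_range.2 h) h'
  · exact Finset.sum_eq_zero fun n hn => hF n (hm n fun e => h (e ▸ Finset.mem_range.1 hn))

/-! ### The sequence of concentrating profiles -/

/-- The size `(m+1)⁻²` of the `m`-th profile in `L²`. -/
noncomputable def profileSize (m : ℕ) : ℝ := (((m : ℝ) + 1) ^ 2)⁻¹

/-- The amplitude of the `m`-th profile. -/
noncomputable def profileAmp (m : ℕ) : ℝ := profileSize m / 8 ^ m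

/-- The central frequency of the `m`-th profile. -/
def profileFreq (m : ℕ) : ℕ := 4 * 1024 ^ m

/-- The `m`-th profile: a wave packet of width `2·4ᵐ` around the frequency `4·1024ᵐ`. -/
noncomputable def profile (L : ℝ) (m : ℕ) : ℝ → ℝ :=
  packet L (profileAmp m) (profileFreq m) (2 * 4 ^ m)

/-- The spatial energy of the `m`-th profile. -/
noncomputable def profileEnergy (L : ℝ) (m : ℕ) : ℝ :=
  pairing L (shear (profile L m)) (shear (profile L m))

/-- The enstrophy of the `m`-th profile. -/
noncomputable def profileEnstrophy (L : ℝ) (m : ℕ) : ℝ :=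
  ∫ x, gradSq (shear (profile L m)) x ∂torusMeasure L

theorem profileSize_pos (m : ℕ) : 0 < profileSize m := by unfold profileSize; positivity

theorem profileSize_le_one (m : ℕ) : profileSize m ≤ 1 := by
  refine inv_le_one_of_one_le₀ (one_le_pow₀ ?_)
  have : (0 : ℝ) ≤ m := by positivity
  linarith

theorem profileAmp_pos (m : ℕ) : 0 < profileAmp m := by
  have := profileSize_pos m
  unfold profileAmp; positivity

theorem summable_profileSize : Summable profileSize := by
  have h := (summable_nat_add_iff 1).2 (Real.summable_nat_pow_inv (p := 2).2 one_lt_two)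
  refine h.congr fun m => ?_
  simp [profileSize]

theorem profileFreq_pos (m : ℕ) : 0 < profileFreq m := by unfold profileFreq; positivity

theorem width_le_profileFreq (m : ℕ) : 2 * (2 * 4 ^ m) ≤ profileFreq m := by
  unfold profileFreq
  have : 4 ^ m ≤ 1024 ^ m := Nat.pow_le_pow_left (by norm_num) m
  omega

theorem width_sq_le_profileFreq (m : ℕ) : (2 * 4 ^ m) ^ 2 ≤ profileFreq m := by
  unfold profileFreq
  have : 16 ^ m ≤ 1024 ^ m := Nat.pow_le_pow_left (by norm_num) m
  have e : (2 * 4 ^ m) ^ 2 = 4 * 16 ^ m := by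
    rw [mul_pow, ← pow_mul, mul_comm m 2, pow_mul]; norm_num
  omega

theorem contDiff_profile (L : ℝ) (m : ℕ) {n : WithTop ℕ∞} : ContDiff ℝ n (profile L m) :=
  contDiff_packet _ _ _ _

theorem continuous_profile (L : ℝ) (m : ℕ) : Continuous (profile L m) :=
  (contDiff_profile L m (n := 0)).continuous

theorem differentiable_profile (L : ℝ) (m : ℕ) : Differentiable ℝ (profile L m) :=
  (contDiff_profile L m (n := 1)).differentiable one_ne_zero

theorem contDiff_deriv_deriv_profile (L : ℝ) (m : ℕ) {n : WithTop ℕ∞} :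
    ContDiff ℝ n (deriv (deriv (profile L m))) := by
  rw [profile, packet, deriv_deriv_cosSum]; exact contDiff_cosSum _ _ _ _

theorem periodic_profile {L : ℝ} (hL : 0 < L) (m : ℕ) : Function.Periodic (profile L m) L :=
  periodic_cosSum hL.ne' _ _ _

theorem periodic_deriv_deriv_profile {L : ℝ} (hL : 0 < L) (m : ℕ) :
    Function.Periodic (deriv (deriv (profile L m))) L :=
  periodic_deriv (periodic_deriv (periodic_profile hL m))

/-- Amplitude $8^{-m}$ and width $2\cdot4^m$ are balanced so that the sup norm grows like $2^m$ and
the $L^1$ norm decays like $2^{-m}$; their product leaves `profileSize m` as the order of the $L^2$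
norm. -/
theorem abs_profile_le (L : ℝ) (m : ℕ) (s : ℝ) :
    |profile L m s| ≤ 4 * profileSize m * 2 ^ m := by
  refine (abs_packet_le L (profileAmp_pos m).le _ _ s).trans (le_of_eq ?_)
  have e : (8 : ℝ) ^ m * 2 ^ m = 4 ^ m * 4 ^ m := by rw [← mul_pow, ← mul_pow]; norm_num
  unfold profileAmp
  rw [div_mul_eq_mul_div, div_eq_iff (by positivity)]
  push_cast
  linear_combination (-4 * profileSize m) * e

theorem integral_abs_profile_le {L : ℝ} (hL : 0 < L) (m : ℕ) :
    ∫ s in 0..L, |profile L m s| ≤ 2 * L * profileSize m * (2 ^ m)⁻¹ := by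
  refine (integral_abs_packet_le hL (profileAmp_pos m).le _ _).trans (le_of_eq ?_)
  have e : (8 : ℝ) ^ m = 4 ^ m * 2 ^ m := by rw [← mul_pow]; norm_num
  unfold profileAmp
  rw [e]
  push_cast
  field_simp

/-- Interpolation between `L¹` and `L^∞` for shear fields. -/
theorem eLpNorm_shear_le {L : ℝ} (hL : 0 < L) {g : ℝ → ℝ} (hg : Continuous g) {S I r : ℝ}
    (hr : 1 ≤ r) (hS : ∀ s, |g s| ≤ S) (hI : ∫ s in 0..L, |g s| ≤ I) :
    eLpNorm (shear g) (ENNReal.ofReal r) (torusMeasure L)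
      ≤ ENNReal.ofReal ((S ^ (r - 1) * (L ^ 2 * I)) ^ (1 / r)) := by
  have hr0 : 0 < r := by linarith
  have hS0 : 0 ≤ S := (abs_nonneg _).trans (hS 0)
  have hI0 : 0 ≤ I :=
    (intervalIntegral.integral_nonneg hL.le fun s _ => abs_nonneg (g s)).trans hI
  rw [eLpNorm_eq_lintegral_rpow_enorm_toReal (by simpa using hr0) ENNReal.ofReal_ne_top,
    ENNReal.toReal_ofReal hr0.le,
    ← ENNReal.ofReal_rpow_of_nonneg (by positivity) (by positivity)]
  refine ENNReal.rpow_le_rpow ?_ (by positivity)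
  have hint : Integrable (fun x : E3 => |g (x 0)|) (torusMeasure L) :=
    integrable_torus L (hg.comp (continuous_coord 0)).abs
  calc ∫⁻ x, ‖shear g x‖ₑ ^ r ∂torusMeasure L
      ≤ ∫⁻ x, ENNReal.ofReal (S ^ (r - 1)) * ENNReal.ofReal |g (x 0)| ∂torusMeasure L := by
        refine lintegral_mono fun x => ?_
        rw [← ofReal_norm, norm_shear, ENNReal.ofReal_rpow_of_nonneg (abs_nonneg _) hr0.le,
          ← ENNReal.ofReal_mul (by positivity)]
        refine ENNReal.ofReal_le_ofReal ?_
        calc |g (x 0)| ^ r = |g (x 0)| ^ (r - 1) * |g (x 0)| := by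
              rcases (abs_nonneg (g (x 0))).eq_or_lt with h | h
              · rw [← h, Real.zero_rpow hr0.ne', mul_zero]
              · rw [← Real.rpow_add_one h.ne']; ring_nf
          _ ≤ S ^ (r - 1) * |g (x 0)| := by
              gcongr
              exact hS _
    _ = ENNReal.ofReal (S ^ (r - 1)) * ENNReal.ofReal (∫ x, |g (x 0)| ∂torusMeasure L) := by
        rw [lintegral_const_mul' _ _ ENNReal.ofReal_ne_top,
          ofReal_integral_eq_lintegral_ofReal hint (ae_of_all _ fun x => abs_nonneg _)]
    _ ≤ _ := by
        rw [integral_torus_coord hL.le fun s => |g s|, ← ENNReal.ofReal_mul (by positivity)]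
        refine ENNReal.ofReal_le_ofReal ?_
        gcongr

theorem eLpNorm_two_profile_le {L : ℝ} (hL : 0 < L) (m : ℕ) :
    eLpNorm (shear (profile L m)) 2 (torusMeasure L)
      ≤ ENNReal.ofReal (Real.sqrt (8 * L ^ 3) * profileSize m) := by
  have h := eLpNorm_shear_le hL (continuous_profile L m) (r := 2) one_le_two
    (abs_profile_le L m) (integral_abs_profile_le hL m)
  have e2 : ENNReal.ofReal 2 = 2 := by norm_num
  rw [e2] at h
  refine h.trans (le_of_eq ?_)
  congr 1
  have hp := profileSize_pos m
  rw [← Real.sqrt_eq_rpow, show (2 : ℝ) - 1 = 1 by norm_num, Real.rpow_one]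
  have : 4 * profileSize m * 2 ^ m * (L ^ 2 * (2 * L * profileSize m * (2 ^ m)⁻¹))
      = 8 * L ^ 3 * profileSize m ^ 2 := by field_simp; ring
  rw [this, Real.sqrt_mul (by positivity), Real.sqrt_sq hp.le]

theorem profileEnergy_le {L : ℝ} (hL : 0 < L) (m : ℕ) :
    profileEnergy L m ≤ 8 * L ^ 3 * profileSize m ^ 2 := by
  have hp := profileSize_pos m
  have hc := continuous_profile L m
  rw [profileEnergy, pairing_shear hL.le]
  have h1 : ∫ s in 0..L, profile L m s * profile L m s
      ≤ ∫ s in 0..L, 4 * profileSize m * 2 ^ m * |profile L m s| := by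
    refine intervalIntegral.integral_mono_on hL.le (Continuous.intervalIntegrable (by fun_prop) _ _)
      (Continuous.intervalIntegrable (by fun_prop) _ _) fun s _ => ?_
    rw [← abs_mul_abs_self]
    gcongr
    exact abs_profile_le L m s
  rw [intervalIntegral.integral_const_mul] at h1
  calc L ^ 2 * ∫ s in 0..L, profile L m s * profile L m s
      ≤ L ^ 2 * (4 * profileSize m * 2 ^ m * (2 * L * profileSize m * (2 ^ m)⁻¹)) := by
        gcongr
        refine h1.trans ?_
        gcongr
        exact integral_abs_profile_le hL m
    _ = _ := by field_simp; ring

theorem profileEnergy_nonneg (L : ℝ) (m : ℕ) : 0 ≤ profileEnergy L m :=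
  integral_nonneg fun _ => real_inner_self_nonneg

theorem profileEnergy_zero_pos {L : ℝ} (hL : 0 < L) : 0 < profileEnergy L 0 := by
  rw [profileEnergy, pairing_shear hL.le]
  have hc := continuous_profile L 0
  refine mul_pos (by positivity) (intervalIntegral.integral_pos hL
    (Continuous.continuousOn (by fun_prop)) (fun s _ => mul_self_nonneg _)
    ⟨0, left_mem_Icc.2 hL.le, mul_self_pos.2 ?_⟩)
  have : profile L 0 0 = 4 * profileAmp 0 := by
    simp [profile, packet, cosSum, card_packetIndex]
  rw [this]
  exact (mul_pos (by norm_num) (profileAmp_pos 0)).ne'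

theorem profileEnstrophy_ge {L : ℝ} (hL : 0 < L) (m : ℕ) :
    (2 * Real.pi / L) ^ 2 * L ^ 3 / 8 * (profileAmp m ^ 2 * profileFreq m ^ 2 * (4 ^ m) ^ 3)
      ≤ profileEnstrophy L m := by
  have h := integral_deriv_packet_sq_ge hL (profileAmp m) (lam := profileFreq m) (M := 4 ^ m)
    (by have := width_le_profileFreq m; omega) (profileFreq_pos m)
  have e : profileEnstrophy L m = L ^ 2 * ∫ s in 0..L, deriv (profile L m) s ^ 2 := by
    rw [← integral_torus_coord hL.le fun s => deriv (profile L m) s ^ 2]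
    simp only [profileEnstrophy, gradSq_shear (differentiable_profile L m)]
  rw [e]
  refine le_trans (le_of_eq ?_) (mul_le_mul_of_nonneg_left h (by positivity))
  push_cast; ring

/-- In powers of $z=2^m$ the product is of order $z^{-16}\cdot z^{-6}\cdot z^{20}\cdot
z^{6}/(m+1)^4=(z/(m+1))^4$, from duration, amplitude, frequency and width, and $m+1\le z$. -/
theorem exists_le_enstrophy_rate {L : ℝ} (hL : 0 < L) :
    ∃ c : ℝ, 0 < c ∧ ∀ m, c ≤ (stageRate m)⁻¹ * profileEnstrophy L m := by
  refine ⟨(2 * Real.pi / L) ^ 2 * L ^ 3 / 8, by positivity, fun m => ?_⟩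
  refine le_trans ?_ (mul_le_mul_of_nonneg_left (profileEnstrophy_ge hL m)
    (inv_nonneg.2 (stageRate_pos m).le))
  have h2 : ((m : ℝ) + 1) ≤ 2 ^ m := by exact_mod_cast Nat.lt_two_pow_self (n := m)
  have hz : (0 : ℝ) < 2 ^ m := by positivity
  have e8 : (8 : ℝ) ^ m = (2 ^ m) ^ 3 := by rw [← pow_mul, mul_comm, pow_mul]; norm_num
  have e4 : (4 : ℝ) ^ m = (2 ^ m) ^ 2 := by rw [← pow_mul, mul_comm, pow_mul]; norm_num
  have e10 : (1024 : ℝ) ^ m = (2 ^ m) ^ 10 := by rw [← pow_mul, mul_comm, pow_mul]; norm_num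
  have e16 : (65536 : ℝ) ^ m = (2 ^ m) ^ 16 := by rw [← pow_mul, mul_comm, pow_mul]; norm_num
  have key : 1 ≤ (stageRate m)⁻¹
      * (profileAmp m ^ 2 * (profileFreq m : ℝ) ^ 2 * (4 ^ m) ^ 3) := by
    unfold profileAmp profileFreq profileSize stageRate
    push_cast
    rw [e8, e4, e10, e16]
    generalize (2 : ℝ) ^ m = z at *
    have hm : (0 : ℝ) < m + 1 := by positivity
    have : (z ^ 16)⁻¹ * (((((m : ℝ) + 1) ^ 2)⁻¹ / z ^ 3) ^ 2 * (4 * z ^ 10) ^ 2 * (z ^ 2) ^ 3)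
        = 16 * (z / (m + 1)) ^ 4 := by field_simp; ring
    rw [this]
    have : 1 ≤ (z / ((m : ℝ) + 1)) ^ 4 := one_le_pow₀ ((one_le_div hm).2 h2)
    linarith
  calc _ ≤ (2 * Real.pi / L) ^ 2 * L ^ 3 / 8 * ((stageRate m)⁻¹
      * (profileAmp m ^ 2 * (profileFreq m : ℝ) ^ 2 * (4 ^ m) ^ 3)) :=
        le_mul_of_one_le_right (by positivity) key
    _ = _ := by ring

theorem profileEnstrophy_pos {L : ℝ} (hL : 0 < L) (m : ℕ) : 0 < profileEnstrophy L m := by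
  obtain ⟨c, hc, h⟩ := exists_le_enstrophy_rate hL
  have := hc.trans_le (h m)
  exact (mul_pos_iff_of_pos_left (inv_pos.2 (stageRate_pos m))).1 this

/-- In `L^r`, `r < 2`, the Laplacian of the profiles is negligible compared with the enstrophy. -/
theorem exists_laplacian_rate {L : ℝ} (hL : 0 < L) {r : ℝ} (hr : 1 ≤ r) (hr2 : r < 2) :
    ∃ δ : ℕ → ℝ, Tendsto δ atTop (𝓝 0) ∧ (∀ m, 0 ≤ δ m) ∧
      ∀ m, eLpNorm (shear (deriv (deriv (profile L m)))) (ENNReal.ofReal r) (torusMeasure L)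
        ≤ ENNReal.ofReal (δ m * profileEnstrophy L m) := by
  have hr0 : 0 < r := by linarith
  set κ := 2 * Real.pi / L with hκ
  have hκ0 : 0 < κ := by positivity
  -- The Laplacian is of order $A\lambda^2N^{2-1/r}$ and the enstrophy of order $A^2\lambda^2N^3$.
  -- Their ratio $N^{-1-1/r}/A$ is of order $(m+1)^2\,2^{(1-2/r)m}$, and the exponent is negative
  -- precisely because $r<2$.
  set ρ : ℝ := 2 ^ (1 - 2 / r) with hρ
  have hρ0 : 0 < ρ := by positivity
  have hρ1 : ρ < 1 := by
    refine Real.rpow_lt_one_of_one_lt_of_neg one_lt_two ?_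
    rw [sub_neg, lt_div_iff₀ hr0]; linarith
  set C : ℝ := 4 * κ ^ 2 * (L ^ 3) ^ (1 / r) * 4 / (κ ^ 2 * L ^ 3 / 8) with hC
  have hC0 : 0 < C := by positivity
  refine ⟨fun m => C * (((m : ℝ) + 1) ^ 2 * ρ ^ m), ?_, fun m => by positivity, fun m => ?_⟩
  · have h := tendsto_pow_const_mul_const_pow_of_abs_lt_one 2 (r := ρ) (by rwa [abs_of_pos hρ0])
    have h1 := (tendsto_add_atTop_iff_nat 1).2 h
    have h2 := h1.const_mul (C / ρ)
    rw [mul_zero] at h2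
    refine h2.congr fun m => ?_
    push_cast
    field_simp
    ring
  · have hA := profileAmp_pos m
    have hw := width_le_profileFreq m
    have h := eLpNorm_shear_le hL (contDiff_deriv_deriv_profile L m (n := 0)).continuous hr
      (abs_deriv_deriv_packet_le hL hA.le hw)
      (integral_abs_deriv_deriv_packet_le hL hA.le (by omega) (width_sq_le_profileFreq m))
    refine h.trans (ENNReal.ofReal_le_ofReal ?_)
    set N : ℝ := ((2 * 4 ^ m : ℕ) : ℝ) with hN
    have hN0 : 0 < N := by rw [hN]; positivity
    set lam : ℝ := (profileFreq m : ℝ) with hlam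
    have hlam0 : 0 < lam := by rw [hlam]; exact_mod_cast profileFreq_pos m
    set A := profileAmp m
    -- The sup bound $S$ and the $L^1$ bound differ by the factor $L/N$, so the interpolated norm is
    -- $S\,(L^3/N)^{1/r}$.
    have e1 : (4 * A * κ ^ 2 * lam ^ 2 * N ^ 2) ^ (r - 1) * (L ^ 2 * (4 * A * κ ^ 2 * lam ^ 2 * N * L))
        = (4 * A * κ ^ 2 * lam ^ 2 * N ^ 2) ^ r * (L ^ 3 * N⁻¹) := by
      rw [Real.rpow_sub_one (by positivity)]
      field_simp
    have e2 : ((4 * A * κ ^ 2 * lam ^ 2 * N ^ 2) ^ r * (L ^ 3 * N⁻¹)) ^ (1 / r)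
        = 4 * A * κ ^ 2 * lam ^ 2 * N ^ 2 * ((L ^ 3) ^ (1 / r) * N⁻¹ ^ (1 / r)) := by
      rw [Real.mul_rpow (by positivity) (by positivity), ← Real.rpow_mul (by positivity),
        mul_one_div_cancel hr0.ne', Real.rpow_one, Real.mul_rpow (by positivity) (by positivity)]
    rw [e1, e2]
    have hz : (0 : ℝ) < 2 ^ m := by positivity
    have hNr : N⁻¹ ^ (1 / r) ≤ ((2 : ℝ) ^ m)⁻¹ * ρ ^ m := by
      have h4 : N⁻¹ ≤ ((4 : ℝ) ^ m)⁻¹ := by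
        rw [hN]; push_cast
        gcongr
        have : (0 : ℝ) < 4 ^ m := by positivity
        linarith
      refine (Real.rpow_le_rpow (by positivity) h4 (by positivity)).trans (le_of_eq ?_)
      have e4 : (4 : ℝ) ^ m = 2 ^ (2 * (m : ℝ)) := by
        rw [Real.rpow_mul zero_le_two, Real.rpow_natCast]; norm_num
      rw [e4, ← Real.rpow_neg zero_le_two, ← Real.rpow_mul zero_le_two, hρ,
        ← Real.rpow_natCast 2 m, ← Real.rpow_natCast (2 ^ (1 - 2 / r)) m,
        ← Real.rpow_neg zero_le_two, ← Real.rpow_mul zero_le_two, ← Real.rpow_add zero_lt_two]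
      congr 1
      ring
    have hG := profileEnstrophy_ge hL m
    calc 4 * A * κ ^ 2 * lam ^ 2 * N ^ 2 * ((L ^ 3) ^ (1 / r) * N⁻¹ ^ (1 / r))
        ≤ 4 * A * κ ^ 2 * lam ^ 2 * N ^ 2 * ((L ^ 3) ^ (1 / r) * (((2 : ℝ) ^ m)⁻¹ * ρ ^ m)) := by
          gcongr
      _ = C * (((m : ℝ) + 1) ^ 2 * ρ ^ m)
          * (κ ^ 2 * L ^ 3 / 8 * (A ^ 2 * lam ^ 2 * (4 ^ m) ^ 3)) := by
          have eA : A = (((m : ℝ) + 1) ^ 2)⁻¹ / (2 ^ m) ^ 3 := by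
            have e8 : (8 : ℝ) ^ m = (2 ^ m) ^ 3 := by rw [← pow_mul, mul_comm, pow_mul]; norm_num
            simp only [A, profileAmp, profileSize, e8]
          have eN : N = 2 * (2 ^ m) ^ 2 := by
            have e4 : (4 : ℝ) ^ m = (2 ^ m) ^ 2 := by rw [← pow_mul, mul_comm, pow_mul]; norm_num
            rw [hN]; push_cast; rw [e4]
          have e4 : (4 : ℝ) ^ m = (2 ^ m) ^ 2 := by rw [← pow_mul, mul_comm, pow_mul]; norm_num
          rw [eN, e4, hC, eA]
          generalize (2 : ℝ) ^ m = z at *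
          have hm : (0 : ℝ) < m + 1 := by positivity
          field_simp
          ring
      _ ≤ C * (((m : ℝ) + 1) ^ 2 * ρ ^ m) * profileEnstrophy L m := by
          gcongr

/-- Smooth test fields see the profiles only through the inverse square of their frequency. -/
theorem tendsto_stageRate_mul_pairing {L : ℝ} (hL : 0 < L) {ψ : E3 → E3} (hψ : ContDiff ℝ ∞ ψ)
    (hψp : IsPeriodic L ψ) :
    Tendsto (fun m => stageRate m * pairing L (shear (profile L m)) ψ) atTop (𝓝 0) := by
  set κ := 2 * Real.pi / L with hκ
  have hκ0 : 0 < κ := by positivity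
  have h1 : ContDiff ℝ ∞ (fun x => fderiv ℝ ψ x (unitVec 0)) :=
    (hψ.fderiv_right (m := ∞) (by simp)).clm_apply contDiff_const
  have h2 : ContDiff ℝ ∞ (fun x => fderiv ℝ (fun y => fderiv ℝ ψ y (unitVec 0)) x (unitVec 0)) :=
    (h1.fderiv_right (m := ∞) (by simp)).clm_apply contDiff_const
  set ψ₂ : E3 → E3 := fun x => fderiv ℝ (fun y => fderiv ℝ ψ y (unitVec 0)) x (unitVec 0)
  obtain ⟨C, hC0, hC⟩ := exists_bound_on_cube L h2.continuous
  -- Two integrations by parts put two derivatives on the test field and replace the packet by its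
  -- second antiderivative, smaller by $\lambda^{-2}$.
  have key : ∀ m, pairing L (shear (profile L m)) ψ = pairing L (shear (packetPrimitive L
      (profileAmp m) (profileFreq m) (2 * 4 ^ m))) ψ₂ := by
    intro m
    have hb : ContDiff ℝ 2 (packetPrimitive L (profileAmp m) (profileFreq m) (2 * 4 ^ m)) :=
      contDiff_cosSum _ _ _ _
    have hp : Function.Periodic (packetPrimitive L (profileAmp m) (profileFreq m) (2 * 4 ^ m)) L :=
      periodic_cosSum hL.ne' _ _ _
    rw [profile, ← deriv_deriv_packetPrimitive hL _ (width_le_profileFreq m) (profileFreq_pos m),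
      pairing_shear_deriv hL.le (contDiff_succ_iff_deriv (n := 1).1 hb).2.2 (periodic_deriv hp)
        (hψ.of_le (by exact_mod_cast le_top)) hψp,
      pairing_shear_deriv hL.le (hb.of_le one_le_two) hp (h1.of_le (by exact_mod_cast le_top))
        (isPeriodic_fderiv hψp _), neg_neg]
  have hbound : ∀ m, |pairing L (shear (profile L m)) ψ|
      ≤ (4 * profileAmp m * (2 * 4 ^ m : ℕ) ^ 2 / (κ ^ 2 * (profileFreq m : ℝ) ^ 2)) * C
        * (torusMeasure L).real univ := by
    intro m
    rw [key, pairing, ← Real.norm_eq_abs]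
    refine norm_integral_le_of_norm_le_const ?_
    filter_upwards [ae_mem_closedCube L] with x hx
    refine (norm_inner_le_norm _ _).trans ?_
    rw [norm_shear]
    have := abs_packetPrimitive_le hL (profileAmp_pos m).le (width_le_profileFreq m)
      (profileFreq_pos m) (x 0)
    exact mul_le_mul this (hC x hx) (norm_nonneg _) ((abs_nonneg _).trans this)
  set D := (torusMeasure L).real univ
  have hD : 0 ≤ D := measureReal_nonneg
  have hlim : Tendsto (fun m : ℕ => (κ ^ 2)⁻¹ * C * D * (1 / 2 : ℝ) ^ m) atTop (𝓝 0) := by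
    simpa using (tendsto_pow_atTop_nhds_zero_of_lt_one (by norm_num : (0 : ℝ) ≤ 1 / 2)
      (by norm_num)).const_mul ((κ ^ 2)⁻¹ * C * D)
  refine squeeze_zero_norm (fun m => ?_) hlim
  rw [norm_mul, Real.norm_of_nonneg (stageRate_pos m).le, Real.norm_eq_abs]
  refine (mul_le_mul_of_nonneg_left (hbound m) (stageRate_pos m).le).trans ?_
  have hz : (0 : ℝ) < 2 ^ m := by positivity
  have e8 : (8 : ℝ) ^ m = (2 ^ m) ^ 3 := by rw [← pow_mul, mul_comm, pow_mul]; norm_num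
  have e4 : (4 : ℝ) ^ m = (2 ^ m) ^ 2 := by rw [← pow_mul, mul_comm, pow_mul]; norm_num
  have e10 : (1024 : ℝ) ^ m = (2 ^ m) ^ 10 := by rw [← pow_mul, mul_comm, pow_mul]; norm_num
  have e16 : (65536 : ℝ) ^ m = (2 ^ m) ^ 16 := by rw [← pow_mul, mul_comm, pow_mul]; norm_num
  -- Powers of $2^m$: $16$ from the rate, $-3$ from the amplitude, $4$ from the squared width, $-20$
  -- from the squared frequency; in total $-3$.
  have e : stageRate m * (4 * profileAmp m * (2 * 4 ^ m : ℕ) ^ 2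
      / (κ ^ 2 * (profileFreq m : ℝ) ^ 2) * C * D)
      = profileSize m * ((κ ^ 2)⁻¹ * C * D * ((2 : ℝ) ^ m)⁻¹ ^ 3) := by
    unfold profileAmp profileFreq stageRate
    push_cast
    rw [e8, e4, e10, e16]
    field_simp
    ring
  rw [e]
  have hi : ((2 : ℝ) ^ m)⁻¹ ≤ 1 := inv_le_one_of_one_le₀ (one_le_pow₀ one_le_two)
  calc profileSize m * ((κ ^ 2)⁻¹ * C * D * ((2 : ℝ) ^ m)⁻¹ ^ 3)
      ≤ 1 * ((κ ^ 2)⁻¹ * C * D * ((2 : ℝ) ^ m)⁻¹) := by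
        gcongr
        · exact profileSize_le_one m
        · exact pow_le_of_le_one (by positivity) hi three_ne_zero
    _ = _ := by rw [one_mul, one_div, inv_pow]

/-! ### Littlewood–Paley operators on the profiles -/

theorem abs_packetFreq_profile_le {m : ℕ} {p : ℕ × ℕ} (hp : p ∈ packetIndex (2 * 4 ^ m)) :
    |(packetFreq (profileFreq m) p : ℝ)| ≤ 3 / 2 * profileFreq m := by
  obtain ⟨h1, h2⟩ := packetFreq_bounds (width_le_profileFreq m) hp
  have : (0 : ℝ) ≤ profileFreq m := by positivity
  rw [abs_le]; constructor <;> linarith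

theorem lowPass_profile_eventually_eq {L : ℝ} (hL : 0 < L) {χ : E3 → ℝ} (hχ : IsCutoff χ) (m : ℕ) :
    ∀ᶠ q in atTop, lowPass χ L q (shear (profile L m)) = shear (profile L m) := by
  filter_upwards [(tendsto_pow_atTop_atTop_of_one_lt (one_lt_two (α := ℝ))).eventually_ge_atTop
    (3 / 2 * (profileFreq m : ℝ))] with q hq
  exact lowPass_shear_cosSum_eq_self hL hχ fun p hp => (abs_packetFreq_profile_le hp).trans hq

/-- All frequencies of the $m$-th profile are at least $2\cdot1024^m\ge2^{q+1}$. Each $S_q$ thus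
sees finitely many stages, and sums of filtered energies are finite sums. -/
theorem lowPass_profile_eq_zero {L : ℝ} (hL : 0 < L) {χ : E3 → ℝ} (hχ : IsCutoff χ) {q m : ℕ}
    (h : q ≤ m) : lowPass χ L q (shear (profile L m)) = 0 := by
  refine lowPass_shear_cosSum_eq_zero hL hχ fun p hp => ?_
  refine le_trans ?_ (le_abs_self _)
  refine le_trans ?_ (packetFreq_bounds (width_le_profileFreq m) hp).1
  have h1 : (2 : ℝ) ^ q ≤ 2 ^ m := pow_le_pow_right₀ one_le_two h
  have h2 : (2 : ℝ) ^ m ≤ 1024 ^ m := pow_le_pow_left₀ (by norm_num) (by norm_num) m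
  unfold profileFreq
  push_cast
  rw [pow_succ]
  linarith

/-- The Littlewood–Paley blocks of the profiles obey the critical `B^{1/3}_{3,∞}` bound after
integration over their stages. -/
theorem exists_besov_bound {L : ℝ} (hL : 0 < L) {χ : E3 → ℝ} (hχ : IsCutoff χ) :
    ∃ ρ : ℕ → ℝ, (∀ m, 0 ≤ ρ m) ∧ Summable (fun m => ρ m ^ 3 * (stageRate m)⁻¹) ∧
      ∀ m (j : ℕ), ENNReal.ofReal ((2 : ℝ) ^ (1 / 3 * ((j : ℝ) - 1)))
        * eLpNorm (lpBlock χ L j (shear (profile L m))) 3 (torusMeasure L)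
        ≤ ENNReal.ofReal (ρ m) := by
  obtain ⟨K, hK1, hK⟩ := hχ.exists_le
  have hK0 : 0 ≤ K := by linarith
  -- The weight at the highest relevant shell, times the sum of moduli of the coefficients, times
  -- $(L^3)^{1/3}$. This sup bound ignores spatial concentration, yet
  -- $\rho_m^3\tau_m\lesssim2^{10m+3m-16m}=2^{-3m}$.
  refine ⟨fun m => (2 * profileFreq m : ℝ) ^ (1 / 3 : ℝ) * (4 * K * profileSize m * 2 ^ m * L),
    fun m => by have := profileSize_pos m; positivity, ?_, fun m j => ?_⟩
  · have hs : Summable fun m : ℕ => 8 * (4 * K * L) ^ 3 * (1 / 8 : ℝ) ^ m :=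
      (summable_geometric_of_lt_one (by norm_num) (by norm_num)).mul_left _
    refine Summable.of_nonneg_of_le (fun m => ?_) (fun m => ?_) hs
    · have := profileSize_pos m
      have := stageRate_pos m
      positivity
    · have hp := profileSize_pos m
      have e3 : ((2 * profileFreq m : ℝ) ^ (1 / 3 : ℝ)) ^ 3 = 2 * profileFreq m := by
        rw [← Real.rpow_natCast, ← Real.rpow_mul (by positivity)]; norm_num
      have e8 : (8 : ℝ) ^ m = (2 ^ m) ^ 3 := by rw [← pow_mul, mul_comm, pow_mul]; norm_num
      have e10 : (1024 : ℝ) ^ m = (2 ^ m) ^ 10 := by rw [← pow_mul, mul_comm, pow_mul]; norm_num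
      have e16 : (65536 : ℝ) ^ m = (2 ^ m) ^ 16 := by rw [← pow_mul, mul_comm, pow_mul]; norm_num
      rw [mul_pow, e3]
      have e : 2 * (profileFreq m : ℝ) * (4 * K * profileSize m * 2 ^ m * L) ^ 3 * (stageRate m)⁻¹
          = 8 * (4 * K * L) ^ 3 * (1 / 8) ^ m * profileSize m ^ 3 := by
        unfold profileFreq stageRate
        push_cast
        rw [one_div, inv_pow, e8, e10, e16]
        field_simp
        norm_num
      rw [e]
      exact mul_le_of_le_one_right (by positivity)
        (pow_le_one₀ hp.le (profileSize_le_one m))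
  · have hp := profileSize_pos m
    have hF0 : (0 : ℝ) < profileFreq m := by exact_mod_cast profileFreq_pos m
    rw [profile, packet, lpBlock_shear_cosSum hL hχ]
    set c : ℕ × ℕ → ℝ := fun p => profileAmp m
      * lpSymbol χ j (freq (axisFreq (packetFreq (profileFreq m) p))) with hc
    have hnorm : ∀ x, ‖shear (cosSum L (packetIndex (2 * 4 ^ m)) c (packetFreq (profileFreq m))) x‖
        ≤ 4 * K * profileSize m * 2 ^ m := by
      intro x
      rw [norm_shear]
      refine (abs_cosSum_le _ _ _ _ _).trans ?_
      have : ∀ p ∈ packetIndex (2 * 4 ^ m), |c p| ≤ profileAmp m * K := by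
        intro p _
        rw [hc, abs_mul, abs_of_pos (profileAmp_pos m)]
        exact mul_le_mul_of_nonneg_left (abs_lpSymbol_le hχ hK _ _) (profileAmp_pos m).le
      refine (Finset.sum_le_sum this).trans (le_of_eq ?_)
      rw [Finset.sum_const, card_packetIndex, nsmul_eq_mul]
      have e8 : (8 : ℝ) ^ m = (2 ^ m) ^ 3 := by rw [← pow_mul, mul_comm, pow_mul]; norm_num
      have e4 : (4 : ℝ) ^ m = (2 ^ m) ^ 2 := by rw [← pow_mul, mul_comm, pow_mul]; norm_num
      unfold profileAmp
      push_cast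
      rw [e4, e8]
      field_simp
      norm_num
    by_cases hz : ∀ p ∈ packetIndex (2 * 4 ^ m),
        lpSymbol χ j (freq (axisFreq (packetFreq (profileFreq m) p))) = 0
    · have : shear (cosSum L (packetIndex (2 * 4 ^ m)) c (packetFreq (profileFreq m))) = 0 := by
        ext1 x
        have : cosSum L (packetIndex (2 * 4 ^ m)) c (packetFreq (profileFreq m)) (x 0) = 0 :=
          Finset.sum_eq_zero fun p hp => by simp only [hc, hz p hp, mul_zero, zero_mul]
        simp [shear, this]
      rw [this, eLpNorm_zero, mul_zero]
      exact zero_le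
    · push Not at hz
      obtain ⟨p, hpi, hps⟩ := hz
      -- A block that does not annihilate the packet meets a frequency $k\le\frac32\lambda$ with
      -- $2^{j-1}<\frac43k$, whence the bound $2\lambda$. For $j=0$ it is trivial.
      have hj : (2 : ℝ) ^ ((j : ℝ) - 1) ≤ 2 * profileFreq m := by
        cases j with
        | zero =>
          have h1 : (2 : ℝ) ^ (((0 : ℕ) : ℝ) - 1) ≤ 1 :=
            Real.rpow_le_one_of_one_le_of_nonpos one_le_two (by norm_num)
          have h2 : (1 : ℝ) ≤ profileFreq m := by exact_mod_cast profileFreq_pos m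
          linarith
        | succ i =>
          push_cast
          rw [add_sub_cancel_right, Real.rpow_natCast]
          by_contra hcon
          refine hps (lpSymbol_axisFreq_eq_zero hχ ?_)
          have := abs_packetFreq_profile_le hpi
          linarith
      have h2 : (2 : ℝ) ^ (1 / 3 * ((j : ℝ) - 1)) ≤ (2 * profileFreq m : ℝ) ^ (1 / 3 : ℝ) := by
        rw [mul_comm, Real.rpow_mul zero_le_two]
        exact Real.rpow_le_rpow (by positivity) hj (by norm_num)
      have h3 := eLpNorm_le_of_ae_bound (p := 3) (μ := torusMeasure L) (ae_of_all _ hnorm)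
      have h4 : (torusMeasure L) univ ^ (ENNReal.toReal 3)⁻¹ = ENNReal.ofReal L := by
        rw [torusMeasure_univ, ← ENNReal.rpow_natCast, ← ENNReal.rpow_mul]
        norm_num
      rw [h4, ← ENNReal.ofReal_mul hL.le] at h3
      refine (mul_le_mul' (ENNReal.ofReal_le_ofReal h2) h3).trans (le_of_eq ?_)
      rw [← ENNReal.ofReal_mul (by positivity)]
      congr 1
      ring

/-! ### The velocities and the forces -/

/-- The first `N` stages of the velocity. -/
noncomputable def truncatedVelocity (L : ℝ) (N : ℕ) (t : ℝ) : E3 → E3 :=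
  shear fun s => ∑ m ∈ Finset.range N, timeBump m t * profile L m s

/-- The first `N` stages of the inviscid force. -/
noncomputable def truncatedForce (L : ℝ) (N : ℕ) (t : ℝ) : E3 → E3 :=
  shear fun s => ∑ m ∈ Finset.range N, deriv (timeBump m) t * profile L m s

/-- The Laplacian of the truncated velocity. -/
noncomputable def truncatedLaplacian (L : ℝ) (N : ℕ) (t : ℝ) : E3 → E3 :=
  shear fun s => ∑ m ∈ Finset.range N, timeBump m t * deriv (deriv (profile L m)) s

/-- The force that makes the truncated velocity a Navier–Stokes solution with viscosity `ν`. -/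
noncomputable def viscousForce (L ν : ℝ) (N : ℕ) (t : ℝ) : E3 → E3 :=
  truncatedForce L N t - ν • truncatedLaplacian L N t

/-- The limiting velocity. -/
noncomputable def limitVelocity (L : ℝ) (t : ℝ) : E3 → E3 :=
  shear fun s => ∑' m, timeBump m t * profile L m s

/-- The limiting force. -/
noncomputable def limitForce (L : ℝ) (t : ℝ) : E3 → E3 :=
  shear fun s => ∑' m, deriv (timeBump m) t * profile L m s

section active

variable {L t : ℝ} {m : ℕ}

theorem limitVelocity_active (hm : ∀ n, n ≠ m → t ∉ stage n) :
    limitVelocity L t = timeBump m t • shear (profile L m) := by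
  rw [smul_shear]
  unfold limitVelocity
  congr 1
  funext s
  exact tsum_active hm fun n hn => by rw [timeBump_eq_zero hn, zero_mul]

theorem limitForce_active (hm : ∀ n, n ≠ m → t ∉ stage n) :
    limitForce L t = deriv (timeBump m) t • shear (profile L m) := by
  rw [smul_shear]
  unfold limitForce
  congr 1
  funext s
  exact tsum_active hm fun n hn => by rw [deriv_timeBump_eq_zero hn, zero_mul]

theorem truncatedVelocity_active (hm : ∀ n, n ≠ m → t ∉ stage n) (N : ℕ) :
    truncatedVelocity L N t = if m < N then timeBump m t • shear (profile L m) else 0 := by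
  have h : ∀ s, ∑ n ∈ Finset.range N, timeBump n t * profile L n s
      = if m < N then timeBump m t * profile L m s else 0 := fun s =>
    sum_range_active hm (fun n hn => by rw [timeBump_eq_zero hn, zero_mul]) N
  ext1 x
  simp only [truncatedVelocity, shear, h]
  split_ifs <;> simp [shear, smul_smul]

theorem truncatedForce_active (hm : ∀ n, n ≠ m → t ∉ stage n) (N : ℕ) :
    truncatedForce L N t = if m < N then deriv (timeBump m) t • shear (profile L m) else 0 := by
  have h : ∀ s, ∑ n ∈ Finset.range N, deriv (timeBump n) t * profile L n s
      = if m < N then deriv (timeBump m) t * profile L m s else 0 := fun s =>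
    sum_range_active hm (fun n hn => by rw [deriv_timeBump_eq_zero hn, zero_mul]) N
  ext1 x
  simp only [truncatedForce, shear, h]
  split_ifs <;> simp [shear, smul_smul]

theorem truncatedLaplacian_active (hm : ∀ n, n ≠ m → t ∉ stage n) (N : ℕ) :
    truncatedLaplacian L N t
      = if m < N then timeBump m t • shear (deriv (deriv (profile L m))) else 0 := by
  have h : ∀ s, ∑ n ∈ Finset.range N, timeBump n t * deriv (deriv (profile L n)) s
      = if m < N then timeBump m t * deriv (deriv (profile L m)) s else 0 := fun s =>
    sum_range_active hm (fun n hn => by rw [timeBump_eq_zero hn, zero_mul]) N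
  ext1 x
  simp only [truncatedLaplacian, shear, h]
  split_ifs <;> simp [shear, smul_smul]

end active

/-- The first stages of the velocity at time `t`, as a function of the first coordinate. -/
theorem contDiff_sum_profile (L : ℝ) (a : ℕ → ℝ) (N : ℕ) {n : WithTop ℕ∞} :
    ContDiff ℝ n fun s => ∑ m ∈ Finset.range N, a m * profile L m s :=
  ContDiff.sum fun m _ => (contDiff_const (c := a m)).mul (contDiff_profile L m)

theorem periodic_sum {L : ℝ} {g : ℕ → ℝ → ℝ} (hg : ∀ m, Function.Periodic (g m) L) (a : ℕ → ℝ)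
    (N : ℕ) : Function.Periodic (fun s => ∑ m ∈ Finset.range N, a m * g m s) L := fun s =>
  Finset.sum_congr rfl fun m _ => by rw [hg m s]

theorem deriv_sum_profile (L : ℝ) (a : ℕ → ℝ) (N : ℕ) :
    deriv (deriv fun s => ∑ m ∈ Finset.range N, a m * profile L m s)
      = fun s => ∑ m ∈ Finset.range N, a m * deriv (deriv (profile L m)) s := by
  have h1 : (deriv fun s => ∑ m ∈ Finset.range N, a m * profile L m s)
      = fun s => ∑ m ∈ Finset.range N, a m * deriv (profile L m) s := by
    funext s
    have h : HasDerivAt (fun s => ∑ m ∈ Finset.range N, a m * profile L m s)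
        (∑ m ∈ Finset.range N, a m * deriv (profile L m) s) s :=
      HasDerivAt.fun_sum fun m _ => (differentiable_profile L m s).hasDerivAt.const_mul (a m)
    exact h.deriv
  rw [h1]
  funext s
  have h2 : ∀ m, ContDiff ℝ 1 (deriv (profile L m)) := fun m =>
    (contDiff_succ_iff_deriv (n := 1).1 (contDiff_profile L m)).2.2
  have h : HasDerivAt (fun s => ∑ m ∈ Finset.range N, a m * deriv (profile L m) s)
      (∑ m ∈ Finset.range N, a m * deriv (deriv (profile L m)) s) s :=
    HasDerivAt.fun_sum fun m _ =>
      ((h2 m).differentiable one_ne_zero s).hasDerivAt.const_mul (a m)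
  exact h.deriv

theorem contDiff_shear_sum {a : ℕ → ℝ → ℝ} {g : ℕ → ℝ → ℝ} (ha : ∀ m, ContDiff ℝ ∞ (a m))
    (hg : ∀ m, ContDiff ℝ ∞ (g m)) (N : ℕ) : ContDiff ℝ ∞ fun z : ℝ × E3 =>
      shear (fun s => ∑ m ∈ Finset.range N, a m z.1 * g m s) z.2 := by
  have h : ContDiff ℝ ∞ fun z : ℝ × E3 => ∑ m ∈ Finset.range N, a m z.1 * g m (z.2 0) :=
    ContDiff.sum fun m _ => ((ha m).comp contDiff_fst).mul
      ((hg m).comp ((contDiff_coord 0).comp contDiff_snd))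
  exact h.smul contDiff_const

theorem contDiff_truncatedVelocity (L : ℝ) (N : ℕ) :
    ContDiff ℝ ∞ fun z : ℝ × E3 => truncatedVelocity L N z.1 z.2 :=
  contDiff_shear_sum (fun m => contDiff_timeBump m) (fun m => contDiff_profile L m) N

theorem contDiff_truncatedForce (L : ℝ) (N : ℕ) :
    ContDiff ℝ ∞ fun z : ℝ × E3 => truncatedForce L N z.1 z.2 :=
  contDiff_shear_sum (fun m => contDiff_deriv_timeBump m) (fun m => contDiff_profile L m) N

theorem contDiff_truncatedLaplacian (L : ℝ) (N : ℕ) :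
    ContDiff ℝ ∞ fun z : ℝ × E3 => truncatedLaplacian L N z.1 z.2 :=
  contDiff_shear_sum (fun m => contDiff_timeBump m) (fun m => contDiff_deriv_deriv_profile L m) N

theorem hasDerivAt_truncatedVelocity (L : ℝ) (N : ℕ) (t : ℝ) (x : E3) :
    HasDerivAt (fun s => truncatedVelocity L N s x) (truncatedForce L N t x) t := by
  unfold truncatedVelocity truncatedForce shear
  refine HasDerivAt.smul_const (HasDerivAt.fun_sum fun m _ => ?_) _
  exact (differentiable_timeBump m t).hasDerivAt.mul_const _

/-- The truncated velocities solve the forced Navier–Stokes equations. -/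
theorem isSmoothSolution_truncated {L : ℝ} (hL : 0 < L) (ν : ℝ) (N : ℕ) :
    IsSmoothSolution L ν (Icc 0 1) (truncatedVelocity L N) (viscousForce L ν N) where
  periodic_u _ _ := isPeriodic_shear (periodic_sum (periodic_profile hL) _ N)
  periodic_f t _ i x := by
    have h1 := isPeriodic_shear
      (periodic_sum (periodic_profile hL) (fun m => deriv (timeBump m) t) N) i x
    have h2 := isPeriodic_shear
      (periodic_sum (periodic_deriv_deriv_profile hL) (fun m => timeBump m t) N) i x
    simp only [viscousForce, truncatedForce, truncatedLaplacian, Pi.sub_apply, Pi.smul_apply,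
      h1, h2]
  smooth_u := (contDiff_truncatedVelocity L N).contDiffOn
  smooth_f := ((contDiff_truncatedForce L N).sub
    ((contDiff_truncatedLaplacian L N).const_smul ν)).contDiffOn
  div_free t _ x := divergence_shear
    ((contDiff_sum_profile L _ N (n := 1)).differentiable one_ne_zero) x
  momentum := by
    -- Zero pressure suffices: the convective term vanishes and the force is $\partial_tu-\nu\Delta
    -- u$ by construction.
    refine ⟨fun _ _ => 0, fun _ _ _ _ => rfl, contDiffOn_const, fun t ht x => ?_⟩
    rw [(hasDerivAt_truncatedVelocity L N t x).hasDerivWithinAt.derivWithin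
      (uniqueDiffOn_Icc zero_lt_one t ht)]
    unfold viscousForce truncatedForce truncatedLaplacian truncatedVelocity
    rw [fderiv_shear_shear ((contDiff_sum_profile L _ N (n := 1)).differentiable one_ne_zero),
      laplacian_shear (contDiff_sum_profile L _ N), deriv_sum_profile]
    simp [gradient]

/-- Before time one the limit coincides locally with a truncation. -/
theorem eventually_limit_eq_truncated (L : ℝ) {t : ℝ} (ht : t < 1) :
    ∃ N, ∀ᶠ s in 𝓝 t, limitVelocity L s = truncatedVelocity L N s
      ∧ limitForce L s = truncatedForce L N s := by
  obtain ⟨N, hN⟩ := eventually_notMem_stage ht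
  refine ⟨N, ?_⟩
  filter_upwards [hN] with s hs
  obtain ⟨m, hm⟩ := exists_active_stage s
  rw [limitVelocity_active hm, limitForce_active hm, truncatedVelocity_active hm,
    truncatedForce_active hm]
  split_ifs with h
  · exact ⟨rfl, rfl⟩
  · have := hs m (not_lt.1 h)
    simp [timeBump_eq_zero this, deriv_timeBump_eq_zero this]

theorem isPeriodic_smul {F : Type} [AddCommGroup F] [Module ℝ F] {L : ℝ} {v : E3 → F}
    (hv : IsPeriodic L v) (a : ℝ) : IsPeriodic L (a • v) := hv.comp (a • ·)

theorem isPeriodic_limitVelocity {L : ℝ} (hL : 0 < L) (t : ℝ) :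
    IsPeriodic L (limitVelocity L t) := by
  obtain ⟨m, hm⟩ := exists_active_stage t
  rw [limitVelocity_active hm]
  exact isPeriodic_smul (isPeriodic_shear (periodic_profile hL m)) _

theorem isPeriodic_limitForce {L : ℝ} (hL : 0 < L) (t : ℝ) : IsPeriodic L (limitForce L t) := by
  obtain ⟨m, hm⟩ := exists_active_stage t
  rw [limitForce_active hm]
  exact isPeriodic_smul (isPeriodic_shear (periodic_profile hL m)) _

/-- The limit solves the Euler equations before time one. -/
theorem isSmoothSolution_limit {L : ℝ} (hL : 0 < L) :
    IsSmoothSolution L 0 (Ico 0 1) (limitVelocity L) (limitForce L) where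
  periodic_u t _ := isPeriodic_limitVelocity hL t
  periodic_f t _ := isPeriodic_limitForce hL t
  smooth_u := fun z hz => by
    obtain ⟨N, hN⟩ := eventually_limit_eq_truncated L hz.1.2
    refine (ContDiffAt.congr_of_eventuallyEq (contDiff_truncatedVelocity L N).contDiffAt
      ?_).contDiffWithinAt
    filter_upwards [continuous_fst.continuousAt.eventually hN] with w hw
    rw [hw.1]
  smooth_f := fun z hz => by
    obtain ⟨N, hN⟩ := eventually_limit_eq_truncated L hz.1.2
    refine (ContDiffAt.congr_of_eventuallyEq (contDiff_truncatedForce L N).contDiffAt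
      ?_).contDiffWithinAt
    filter_upwards [continuous_fst.continuousAt.eventually hN] with w hw
    rw [hw.2]
  div_free t ht x := by
    obtain ⟨N, hN⟩ := eventually_limit_eq_truncated L ht.2
    rw [hN.self_of_nhds.1]
    exact (isSmoothSolution_truncated hL 0 N).div_free t ⟨ht.1, ht.2.le⟩ x
  momentum := by
    refine ⟨fun _ _ => 0, fun _ _ _ _ => rfl, contDiffOn_const, fun t ht x => ?_⟩
    obtain ⟨N, hN⟩ := eventually_limit_eq_truncated L ht.2
    have hd : HasDerivAt (fun s => limitVelocity L s x) (truncatedForce L N t x) t := by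
      refine (hasDerivAt_truncatedVelocity L N t x).congr_of_eventuallyEq ?_
      filter_upwards [hN] with s hs
      rw [hs.1]
    rw [hd.hasDerivWithinAt.derivWithin (uniqueDiffOn_Ico 0 1 t ht), hN.self_of_nhds.1,
      hN.self_of_nhds.2]
    have := fderiv_shear_shear ((contDiff_sum_profile L (fun m => timeBump m t) N
      (n := 1)).differentiable one_ne_zero)
      (fun s => ∑ m ∈ Finset.range N, timeBump m t * profile L m s) x
    rw [truncatedVelocity, this]
    simp [gradient]

theorem zero_active_stage : ∀ n, n ≠ 0 → (0 : ℝ) ∉ stage n := fun _ => zero_notMem_stage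

theorem limitVelocity_zero (L : ℝ) : limitVelocity L 0 = shear (profile L 0) := by
  rw [limitVelocity_active zero_active_stage, timeBump_zero_zero, one_smul]

theorem truncatedVelocity_zero (L : ℝ) (n : ℕ) :
    truncatedVelocity L (n + 1) 0 = shear (profile L 0) := by
  rw [truncatedVelocity_active zero_active_stage, if_pos n.succ_pos, timeBump_zero_zero, one_smul]

theorem limitVelocity_one (L : ℝ) : limitVelocity L 1 = 0 := by
  rw [limitVelocity_active (m := 0) fun n _ => one_le_notMem_stage n le_rfl,
    timeBump_eq_zero (one_le_notMem_stage 0 le_rfl), zero_smul]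

/-! ### Convergence of the velocities and of the forces -/

theorem mixedNorm_top_le {L T : ℝ} {r C : ℝ≥0∞} {v : ℝ → E3 → E3}
    (h : ∀ t, eLpNorm (v t) r (torusMeasure L) ≤ C) : mixedNorm L T ⊤ r v ≤ C := by
  rw [mixedNorm, eLpNorm_exponent_top]
  exact essSup_le_of_ae_le _ (ae_of_all _ h)

theorem mixedNorm_one (L T : ℝ) (r : ℝ≥0∞) (v : ℝ → E3 → E3) :
    mixedNorm L T 1 r v = ∫⁻ t in Icc 0 T, eLpNorm (v t) r (torusMeasure L) := by
  rw [mixedNorm, eLpNorm_one_eq_lintegral_enorm]; rfl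

theorem profileSize_antitone : Antitone profileSize := by
  intro m n h
  unfold profileSize
  gcongr

theorem eLpNorm_two_limitVelocity_le {L : ℝ} (hL : 0 < L) (t : ℝ) :
    eLpNorm (limitVelocity L t) 2 (torusMeasure L) ≤ ENNReal.ofReal (Real.sqrt (8 * L ^ 3)) := by
  obtain ⟨m, hm⟩ := exists_active_stage t
  rw [limitVelocity_active hm, eLpNorm_const_smul]
  have h1 : ‖timeBump m t‖ₑ ≤ 1 := by
    rw [← ofReal_norm, ← ENNReal.ofReal_one]
    exact ENNReal.ofReal_le_ofReal (abs_timeBump_le_one m t)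
  calc _ ≤ 1 * ENNReal.ofReal (Real.sqrt (8 * L ^ 3) * profileSize m) :=
        mul_le_mul' h1 (eLpNorm_two_profile_le hL m)
    _ ≤ _ := by
        rw [one_mul]
        exact ENNReal.ofReal_le_ofReal
          (mul_le_of_le_one_right (Real.sqrt_nonneg _) (profileSize_le_one m))

/-- At each time the difference is either zero or a single stage $m\ge n+1$, whose $L^2$ norm is
controlled by the decreasing sequence `profileSize`; hence uniformity in time. -/
theorem tendsto_mixedNorm_velocity {L : ℝ} (hL : 0 < L) :
    Tendsto (fun n => mixedNorm L 1 ⊤ 2 (truncatedVelocity L (n + 1) - limitVelocity L))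
      atTop (𝓝 0) := by
  have hb : ∀ n, mixedNorm L 1 ⊤ 2 (truncatedVelocity L (n + 1) - limitVelocity L)
      ≤ ENNReal.ofReal (Real.sqrt (8 * L ^ 3) * profileSize n) := by
    intro n
    refine mixedNorm_top_le fun t => ?_
    obtain ⟨m, hm⟩ := exists_active_stage t
    rw [Pi.sub_apply, limitVelocity_active hm, truncatedVelocity_active hm]
    split_ifs with h
    · rw [sub_self, eLpNorm_zero]; exact zero_le
    · rw [zero_sub, eLpNorm_neg, eLpNorm_const_smul]
      have h1 : ‖timeBump m t‖ₑ ≤ 1 := by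
        rw [← ofReal_norm, ← ENNReal.ofReal_one]
        exact ENNReal.ofReal_le_ofReal (abs_timeBump_le_one m t)
      calc _ ≤ 1 * ENNReal.ofReal (Real.sqrt (8 * L ^ 3) * profileSize m) :=
            mul_le_mul' h1 (eLpNorm_two_profile_le hL m)
        _ ≤ _ := by
            rw [one_mul]
            refine ENNReal.ofReal_le_ofReal (mul_le_mul_of_nonneg_left ?_ (Real.sqrt_nonneg _))
            exact profileSize_antitone (by omega)
  refine tendsto_of_tendsto_of_tendsto_of_le_of_le tendsto_const_nhds ?_ (fun _ => zero_le) hb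
  have h := (summable_profileSize.tendsto_atTop_zero.const_mul (Real.sqrt (8 * L ^ 3)))
  simpa using ENNReal.tendsto_ofReal h

/-- The weight of the `m`-th stage in the total enstrophy. -/
noncomputable def stageEnstrophy (L : ℝ) (m : ℕ) : ℝ :=
  (∫ t in 0..1, timeBump m t ^ 2) * profileEnstrophy L m

/-- The viscosities, chosen so that the dissipation equals the initial energy. -/
noncomputable def viscosity (L : ℝ) (n : ℕ) : ℝ :=
  profileEnergy L 0 / (2 * ∑ m ∈ Finset.range (n + 1), stageEnstrophy L m)

theorem rate_enstrophy_le {L : ℝ} (hL : 0 < L) (m : ℕ) :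
    (stageRate m)⁻¹ * profileEnstrophy L m ≤ 10 * stageEnstrophy L m := by
  have h := mul_le_mul_of_nonneg_right (integral_timeBump_sq_ge m) (profileEnstrophy_pos hL m).le
  rw [stageEnstrophy]
  linarith

theorem stageEnstrophy_pos {L : ℝ} (hL : 0 < L) (m : ℕ) : 0 < stageEnstrophy L m := by
  have h := rate_enstrophy_le hL m
  have := mul_pos (inv_pos.2 (stageRate_pos m)) (profileEnstrophy_pos hL m)
  linarith

theorem sum_stageEnstrophy_pos {L : ℝ} (hL : 0 < L) (n : ℕ) :
    0 < ∑ m ∈ Finset.range (n + 1), stageEnstrophy L m :=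
  Finset.sum_pos (fun m _ => stageEnstrophy_pos hL m) ⟨0, by simp⟩

theorem tendsto_sum_stageEnstrophy {L : ℝ} (hL : 0 < L) :
    Tendsto (fun n => ∑ m ∈ Finset.range n, stageEnstrophy L m) atTop atTop := by
  obtain ⟨c, hc, h⟩ := exists_le_enstrophy_rate hL
  have h1 : Tendsto (fun n : ℕ => (n : ℝ) * (c / 10)) atTop atTop :=
    tendsto_natCast_atTop_atTop.atTop_mul_const (by positivity)
  refine tendsto_atTop_mono (fun n => ?_) h1
  have : ∀ m ∈ Finset.range n, c / 10 ≤ stageEnstrophy L m := fun m _ => by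
    have := (h m).trans (rate_enstrophy_le hL m)
    linarith
  simpa [nsmul_eq_mul] using Finset.card_nsmul_le_sum _ _ _ this

theorem viscosity_pos {L : ℝ} (hL : 0 < L) (n : ℕ) : 0 < viscosity L n :=
  div_pos (profileEnergy_zero_pos hL) (mul_pos two_pos (sum_stageEnstrophy_pos hL n))

theorem tendsto_viscosity {L : ℝ} (hL : 0 < L) : Tendsto (viscosity L) atTop (𝓝 0) := by
  have h := (tendsto_add_atTop_iff_nat 1).2 (tendsto_sum_stageEnstrophy hL)
  exact (h.const_mul_atTop two_pos).const_div_atTop _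

theorem viscosity_mul_sum {L : ℝ} (hL : 0 < L) (n : ℕ) :
    2 * viscosity L n * ∑ m ∈ Finset.range (n + 1), stageEnstrophy L m = profileEnergy L 0 := by
  have := sum_stageEnstrophy_pos hL n
  rw [viscosity]; field_simp

/-- A weighted Cesàro argument: early terms are washed out because the weights have divergent sum.
With enstrophies as weights it turns stagewise smallness of the Laplacian into smallness of the
whole viscous force. -/
theorem tendsto_weighted_average {w δ : ℕ → ℝ} (hw : ∀ m, 0 < w m)
    (hsum : Tendsto (fun n => ∑ m ∈ Finset.range n, w m) atTop atTop)
    (hδ : Tendsto δ atTop (𝓝 0)) :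
    Tendsto (fun n => (∑ m ∈ Finset.range n, δ m * w m) / ∑ m ∈ Finset.range n, w m)
      atTop (𝓝 0) := by
  have h : (fun m => δ m * w m) =o[atTop] w := by
    refine (Asymptotics.isLittleO_iff_tendsto fun m hm => absurd hm (hw m).ne').2 ?_
    refine hδ.congr fun m => ?_
    rw [mul_div_cancel_right₀ _ (hw m).ne']
  exact (h.sum_range (fun m => (hw m).le) hsum).tendsto_div_nhds_zero

/-- On the torus, convergence in `L^r` for `1 ≤ r < 2` controls all smaller exponents. -/
theorem exists_mixedNorm_le {L : ℝ} {r : ℝ≥0∞} (h0 : 0 < r) (h2 : r < 2) :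
    ∃ (r' : ℝ) (K : ℝ≥0∞), 1 ≤ r' ∧ r' < 2 ∧ K ≠ ⊤ ∧ ∀ v : ℝ → E3 → E3,
      (∀ t, Continuous (v t)) →
      mixedNorm L 1 1 r v ≤ mixedNorm L 1 1 (ENNReal.ofReal r') v * K := by
  have hr : r ≠ ⊤ := (h2.trans ENNReal.ofNat_lt_top).ne
  have hr0 : 0 < r.toReal := ENNReal.toReal_pos h0.ne' hr
  have hr2 : r.toReal < 2 := (ENNReal.toReal_lt_toReal hr ENNReal.ofNat_ne_top).2 h2
  have hle : r ≤ ENNReal.ofReal (max r.toReal 1) := by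
    rw [ENNReal.le_ofReal_iff_toReal_le hr (by positivity)]; exact le_max_left _ _
  -- The exponent $\max(r,1)$ covers the quasi-norm range $r<1$ as well; $K$ is the Hölder constant
  -- on a space of finite measure.
  refine ⟨max r.toReal 1, torusMeasure L univ ^ (1 / r.toReal - 1 / max r.toReal 1),
    le_max_right _ _, max_lt hr2 one_lt_two, ?_, fun v hv => ?_⟩
  · refine (ENNReal.rpow_lt_top_of_nonneg ?_ (measure_ne_top _ _)).ne
    rw [sub_nonneg]
    exact one_div_le_one_div_of_le hr0 (le_max_left _ _)
  · have hK : torusMeasure L univ ^ (1 / r.toReal - 1 / max r.toReal 1) ≠ ⊤ := by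
      refine (ENNReal.rpow_lt_top_of_nonneg ?_ (measure_ne_top _ _)).ne
      rw [sub_nonneg]
      exact one_div_le_one_div_of_le hr0 (le_max_left _ _)
    rw [mixedNorm_one, mixedNorm_one, ← lintegral_mul_const' _ _ hK]
    refine lintegral_mono fun t => ?_
    have := eLpNorm_le_eLpNorm_mul_rpow_measure_univ hle
      (hv t).aestronglyMeasurable (μ := torusMeasure L)
    rwa [ENNReal.toReal_ofReal (by positivity)] at this

theorem exists_eLpNorm_profile_le {L : ℝ} (hL : 0 < L) {r : ℝ} (hr : 1 ≤ r) (hr2 : r < 2) :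
    ∃ C : ℝ, 0 ≤ C ∧ ∀ m, eLpNorm (shear (profile L m)) (ENNReal.ofReal r) (torusMeasure L)
      ≤ ENNReal.ofReal (C * profileSize m) := by
  have hle : ENNReal.ofReal r ≤ 2 := by
    rw [← ENNReal.ofReal_ofNat]; exact ENNReal.ofReal_le_ofReal hr2.le
  set K := torusMeasure L univ ^ (1 / r - 1 / 2)
  have hK : K ≠ ⊤ := by
    refine (ENNReal.rpow_lt_top_of_nonneg ?_ (measure_ne_top _ _)).ne
    rw [sub_nonneg]
    exact one_div_le_one_div_of_le (by linarith) hr2.le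
  refine ⟨Real.sqrt (8 * L ^ 3) * K.toReal, by positivity, fun m => ?_⟩
  have h := eLpNorm_le_eLpNorm_mul_rpow_measure_univ hle
    (continuous_shear (continuous_profile L m)).aestronglyMeasurable (μ := torusMeasure L)
  rw [ENNReal.toReal_ofReal (by linarith)] at h
  have e : (2 : ℝ≥0∞).toReal = 2 := rfl
  rw [e] at h
  refine h.trans ?_
  have hp := profileSize_pos m
  calc _ ≤ ENNReal.ofReal (Real.sqrt (8 * L ^ 3) * profileSize m) * ENNReal.ofReal K.toReal := by
        rw [ENNReal.ofReal_toReal hK]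
        gcongr
        exact eLpNorm_two_profile_le hL m
    _ = _ := by
        rw [← ENNReal.ofReal_mul (by positivity)]
        congr 1; ring

theorem continuous_limitForce (L t : ℝ) : Continuous (limitForce L t) := by
  obtain ⟨m, hm⟩ := exists_active_stage t
  rw [limitForce_active hm]
  exact (continuous_shear (continuous_profile L m)).const_smul _

theorem continuous_limitVelocity (L t : ℝ) : Continuous (limitVelocity L t) := by
  obtain ⟨m, hm⟩ := exists_active_stage t
  rw [limitVelocity_active hm]
  exact (continuous_shear (continuous_profile L m)).const_smul _

theorem continuous_viscousForce (L ν : ℝ) (N : ℕ) (t : ℝ) : Continuous (viscousForce L ν N t) :=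
  ((contDiff_truncatedForce L N).continuous.comp (Continuous.prodMk_right t)).sub
    (((contDiff_truncatedLaplacian L N).continuous.comp
      (Continuous.prodMk_right t)).const_smul ν)

theorem lintegral_deriv_timeBump_le {C : ℝ} (hC0 : 0 ≤ C)
    (hC : ∀ m t, |deriv (timeBump m) t| ≤ C * stageRate m) (m : ℕ) (S : Set ℝ) :
    ∫⁻ t in S, ‖deriv (timeBump m) t‖ₑ ≤ ENNReal.ofReal C := by
  have hp := stageRate_pos m
  refine (lintegral_stage_le (m := m) (c := ENNReal.ofReal (C * stageRate m)) S
    (fun t ht => by simp [deriv_timeBump_eq_zero ht]) fun t => ?_).trans (le_of_eq ?_)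
  · rw [← ofReal_norm]; exact ENNReal.ofReal_le_ofReal (hC m t)
  · rw [← ENNReal.ofReal_mul (by positivity), mul_inv_cancel_right₀ hp.ne']

theorem lintegral_timeBump_le (m : ℕ) (S : Set ℝ) :
    ∫⁻ t in S, ‖timeBump m t‖ₑ ≤ ENNReal.ofReal (stageRate m)⁻¹ := by
  refine (lintegral_stage_le (m := m) (c := 1) S
    (fun t ht => by simp [timeBump_eq_zero ht]) fun t => ?_).trans (by rw [one_mul])
  rw [← ofReal_norm, ← ENNReal.ofReal_one]; exact ENNReal.ofReal_le_ofReal (abs_timeBump_le_one m t)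

/-- Only the stage terms have to be measurable. The dominated function, typically a spatial norm as
a function of time, enters through monotonicity of the lower integral alone. -/
theorem lintegral_tsum_mul_le {F : ℕ → ℝ → ℝ≥0∞} {B : ℕ → ℝ≥0∞} {G : ℝ → ℝ≥0∞} {S : Set ℝ}
    (hF : ∀ m, Measurable (F m)) (hG : ∀ t, G t ≤ ∑' m, F m t)
    (hB : ∀ m, ∫⁻ t in S, F m t ≤ B m) : ∫⁻ t in S, G t ≤ ∑' m, B m :=
  (lintegral_mono hG).trans ((lintegral_tsum fun m => (hF m).aemeasurable).trans_le
    (ENNReal.tsum_le_tsum hB))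

theorem tsum_ite_lt (A B : ℕ → ℝ≥0∞) (k : ℕ) :
    ∑' m, (if m < k then A m else B m) = ∑ m ∈ Finset.range k, A m + ∑' m, B (m + k) := by
  rw [← Summable.sum_add_tsum_nat_add' (f := fun m => if m < k then A m else B m) (k := k)
    ENNReal.summable]
  congr 1
  · exact Finset.sum_congr rfl fun m hm => if_pos (Finset.mem_range.1 hm)
  · exact tsum_congr fun m => if_neg (by omega)

theorem mixedNorm_limitForce_lt_top_of_one_le {L : ℝ} (hL : 0 < L) {r : ℝ} (hr : 1 ≤ r)
    (hr2 : r < 2) : mixedNorm L 1 1 (ENNReal.ofReal r) (limitForce L) < ⊤ := by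
  obtain ⟨C, hC1, hC⟩ := exists_deriv_timeBump_le
  obtain ⟨D, hD0, hD⟩ := exists_eLpNorm_profile_le hL hr hr2
  have hC0 : 0 ≤ C := by linarith
  rw [mixedNorm_one]
  refine (lintegral_tsum_mul_le
    (F := fun m t => ‖deriv (timeBump m) t‖ₑ * ENNReal.ofReal (D * profileSize m))
    (B := fun m => ENNReal.ofReal (C * D * profileSize m))
    (fun m => (continuous_deriv_timeBump m).measurable.enorm.mul_const _)
    (fun t => ?_) fun m => ?_).trans_lt ?_
  · obtain ⟨m, hm⟩ := exists_active_stage t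
    rw [limitForce_active hm, eLpNorm_const_smul]
    refine le_trans ?_ (ENNReal.le_tsum m)
    gcongr
    exact hD m
  · rw [lintegral_mul_const' _ _ ENNReal.ofReal_ne_top, mul_assoc, ENNReal.ofReal_mul hC0]
    gcongr
    exact lintegral_deriv_timeBump_le hC0 hC m _
  · rw [lt_top_iff_ne_top]
    exact (summable_profileSize.mul_left (C * D)).tsum_ofReal_ne_top

/-- The force error is controlled by the viscous terms of the past stages and the inviscid forces
of the future ones. -/
theorem mixedNorm_force_le {L : ℝ} (hL : 0 < L) {r C D : ℝ} {δ : ℕ → ℝ} (hC0 : 0 ≤ C)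
    (hC : ∀ m t, |deriv (timeBump m) t| ≤ C * stageRate m)
    (hD : ∀ m, eLpNorm (shear (profile L m)) (ENNReal.ofReal r) (torusMeasure L)
      ≤ ENNReal.ofReal (D * profileSize m)) (hδ0 : ∀ m, 0 ≤ δ m)
    (hδb : ∀ m, eLpNorm (shear (deriv (deriv (profile L m)))) (ENNReal.ofReal r) (torusMeasure L)
        ≤ ENNReal.ofReal (δ m * profileEnstrophy L m)) (n : ℕ) :
    mixedNorm L 1 1 (ENNReal.ofReal r)
      (viscousForce L (viscosity L n) (n + 1) - limitForce L)
      ≤ ENNReal.ofReal (∑ m ∈ Finset.range (n + 1),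
          viscosity L n * ((stageRate m)⁻¹ * (δ m * profileEnstrophy L m)))
        + ∑' m, ENNReal.ofReal (C * D * profileSize (m + (n + 1))) := by
  have hV0 : ∀ m, 0 ≤ viscosity L n * ((stageRate m)⁻¹ * (δ m * profileEnstrophy L m)) := fun m => by
    have := (viscosity_pos hL n).le
    have := (stageRate_pos m).le
    have := (profileEnstrophy_pos hL m).le
    have := hδ0 m
    positivity
  have hν := viscosity_pos hL n
  rw [mixedNorm_one]
  refine (lintegral_tsum_mul_le
    (F := fun m t => if m < n + 1 then
        ‖timeBump m t‖ₑ * ENNReal.ofReal (viscosity L n * (δ m * profileEnstrophy L m))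
      else ‖deriv (timeBump m) t‖ₑ * ENNReal.ofReal (D * profileSize m))
    (B := fun m => if m < n + 1 then ENNReal.ofReal ((viscosity L n * ((stageRate m)⁻¹ * (δ m * profileEnstrophy L m)))) else ENNReal.ofReal (C * D * profileSize m))
    (fun m => ?_) (fun t => ?_) fun m => ?_).trans (le_of_eq ?_)
  · by_cases h : m < n + 1
    · simp only [h, if_true]
      exact (continuous_timeBump m).measurable.enorm.mul_const _
    · simp only [h, if_false]
      exact (continuous_deriv_timeBump m).measurable.enorm.mul_const _
  · obtain ⟨m, hm⟩ := exists_active_stage t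
    refine le_trans ?_ (ENNReal.le_tsum m)
    rw [Pi.sub_apply, viscousForce, limitForce_active hm, truncatedForce_active hm,
      truncatedLaplacian_active hm]
    split_ifs with h
    · rw [sub_sub_cancel_left, eLpNorm_neg, eLpNorm_const_smul, eLpNorm_const_smul,
        ENNReal.ofReal_mul hν.le, ← mul_assoc, mul_comm ‖viscosity L n‖ₑ, mul_assoc]
      gcongr
      · rw [← ofReal_norm, Real.norm_of_nonneg hν.le]
      · exact hδb m
    · rw [smul_zero, sub_zero, zero_sub, eLpNorm_neg, eLpNorm_const_smul]
      gcongr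
      exact hD m
  · split_ifs with h
    · rw [lintegral_mul_const' _ _ ENNReal.ofReal_ne_top]
      rw [mul_left_comm (viscosity L n) (stageRate m)⁻¹, ENNReal.ofReal_mul (inv_nonneg.2 (stageRate_pos m).le)]
      gcongr
      exact lintegral_timeBump_le m _
    · rw [lintegral_mul_const' _ _ ENNReal.ofReal_ne_top, mul_assoc, ENNReal.ofReal_mul hC0]
      gcongr
      exact lintegral_deriv_timeBump_le hC0 hC m _
  · rw [tsum_ite_lt, ENNReal.ofReal_sum_of_nonneg fun m _ => hV0 m]

theorem tendsto_mixedNorm_force_of_one_le {L : ℝ} (hL : 0 < L) {r : ℝ} (hr : 1 ≤ r)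
    (hr2 : r < 2) : Tendsto (fun n => mixedNorm L 1 1 (ENNReal.ofReal r)
      (viscousForce L (viscosity L n) (n + 1) - limitForce L)) atTop (𝓝 0) := by
  obtain ⟨C, hC1, hC⟩ := exists_deriv_timeBump_le
  obtain ⟨D, hD0, hD⟩ := exists_eLpNorm_profile_le hL hr hr2
  obtain ⟨δ, hδ, hδ0, hδb⟩ := exists_laplacian_rate hL hr hr2
  have hC0 : 0 ≤ C := by linarith
  set V : ℕ → ℕ → ℝ := fun n m =>
    viscosity L n * ((stageRate m)⁻¹ * (δ m * profileEnstrophy L m)) with hV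
  have hV0 : ∀ n m, 0 ≤ V n m := fun n m => by
    have := (viscosity_pos hL n).le
    have := (stageRate_pos m).le
    have := (profileEnstrophy_pos hL m).le
    have := hδ0 m
    positivity
  have hbound := mixedNorm_force_le hL hC0 hC hD hδ0 hδb
  refine tendsto_of_tendsto_of_tendsto_of_le_of_le tendsto_const_nhds ?_ (fun _ => zero_le) hbound
  have htail : Tendsto (fun n => ∑' m, ENNReal.ofReal (C * D * profileSize (m + (n + 1))))
      atTop (𝓝 0) :=
    (tendsto_add_atTop_iff_nat 1).2 (ENNReal.tendsto_sum_nat_add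
      (fun m => ENNReal.ofReal (C * D * profileSize m))
      (summable_profileSize.mul_left (C * D)).tsum_ofReal_ne_top)
  have hmain : Tendsto (fun n => ∑ m ∈ Finset.range (n + 1), V n m) atTop (𝓝 0) := by
    have havg := (tendsto_add_atTop_iff_nat 1).2 (tendsto_weighted_average
      (stageEnstrophy_pos hL) (tendsto_sum_stageEnstrophy hL) hδ)
    -- The $5$ is the $10$ of `rate_enstrophy_le` divided by the $2$ in the denominator of the
    -- viscosity.
    have h5 := havg.const_mul (5 * profileEnergy L 0)
    rw [mul_zero] at h5
    refine squeeze_zero (fun n => Finset.sum_nonneg fun m _ => hV0 n m) (fun n => ?_) h5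
    have hS := sum_stageEnstrophy_pos hL n
    have hE := (profileEnergy_zero_pos hL).le
    calc ∑ m ∈ Finset.range (n + 1), V n m
        ≤ ∑ m ∈ Finset.range (n + 1), viscosity L n * (δ m * (10 * stageEnstrophy L m)) := by
          refine Finset.sum_le_sum fun m _ => mul_le_mul_of_nonneg_left ?_ (viscosity_pos hL n).le
          calc _ = δ m * ((stageRate m)⁻¹ * profileEnstrophy L m) := by ring
            _ ≤ _ := mul_le_mul_of_nonneg_left (rate_enstrophy_le hL m) (hδ0 m)
      _ = 10 * viscosity L n * ∑ m ∈ Finset.range (n + 1), δ m * stageEnstrophy L m := by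
          rw [Finset.mul_sum]
          exact Finset.sum_congr rfl fun m _ => by ring
      _ = _ := by rw [viscosity]; field_simp; ring
  simpa using (ENNReal.tendsto_ofReal hmain).add htail

theorem force_convergence {L : ℝ} (hL : 0 < L) {r : ℝ≥0∞} (h0 : 0 < r) (h2 : r < 2) :
    mixedNorm L 1 1 r (limitForce L) < ⊤ ∧ Tendsto (fun n => mixedNorm L 1 1 r
      (viscousForce L (viscosity L n) (n + 1) - limitForce L)) atTop (𝓝 0) := by
  obtain ⟨r', K, h1, h2', hK, hle⟩ := exists_mixedNorm_le (L := L) h0 h2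
  constructor
  · exact (hle _ (continuous_limitForce L)).trans_lt
      (ENNReal.mul_lt_top (mixedNorm_limitForce_lt_top_of_one_le hL h1 h2') hK.lt_top)
  · have h := ENNReal.Tendsto.mul_const (tendsto_mixedNorm_force_of_one_le hL h1 h2')
      (Or.inr hK) (b := K)
    rw [zero_mul] at h
    exact tendsto_of_tendsto_of_tendsto_of_le_of_le tendsto_const_nhds h (fun _ => zero_le)
      fun n => hle _ fun t => (continuous_viscousForce L _ _ t).sub (continuous_limitForce L t)

/-! ### Energy balance and anomalous work -/

theorem pairing_smul_smul (L a b : ℝ) (v w : E3 → E3) :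
    pairing L (a • v) (b • w) = a * b * pairing L v w := by
  simp only [pairing, Pi.smul_apply, real_inner_smul_left, real_inner_smul_right, ← mul_assoc,
    integral_const_mul, mul_comm b a]

theorem pairing_smul_left (L a : ℝ) (v w : E3 → E3) :
    pairing L (a • v) w = a * pairing L v w := by
  simp only [pairing, Pi.smul_apply, real_inner_smul_left, integral_const_mul]

theorem pairing_sub_left (L : ℝ) {v w z : E3 → E3} (hv : Continuous v) (hw : Continuous w)
    (hz : Continuous z) : pairing L (v - w) z = pairing L v z - pairing L w z := by
  simp only [pairing, Pi.sub_apply, inner_sub_left]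
  exact integral_sub (integrable_torus L (hv.inner hz)) (integrable_torus L (hw.inner hz))

theorem pairing_self (L : ℝ) (v : E3 → E3) : pairing L v v = ∫ x, ‖v x‖ ^ 2 ∂torusMeasure L := by
  simp only [pairing, real_inner_self_eq_norm_sq]

/-- The power `∑ₘ aₘ aₘ' Qₘ` of the temporal bumps weighted by energies `Qₘ`. -/
noncomputable def powerDensity (Q : ℕ → ℝ) (t : ℝ) : ℝ :=
  ∑' m, timeBump m t * deriv (timeBump m) t * Q m

/-- The energy difference between two times. -/
noncomputable def energyJump (Q : ℕ → ℝ) (c d : ℝ) : ℝ :=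
  ∑' m, (timeBump m d ^ 2 - timeBump m c ^ 2) / 2 * Q m

theorem powerDensity_active {t : ℝ} {m : ℕ} (hm : ∀ n, n ≠ m → t ∉ stage n) (Q : ℕ → ℝ) :
    powerDensity Q t = timeBump m t * deriv (timeBump m) t * Q m :=
  tsum_active hm fun n hn => by rw [timeBump_eq_zero hn, zero_mul, zero_mul]

/-- Sum and integral commute because $|a_ma_m'|\lesssim\tau_m^{-1}$ on a set of length at most
$\tau_m=$ `(stageRate m)⁻¹`, so stage $m$ has $L^1$ norm at most $C|Q_m|$. Each stage then
integrates exactly, even when the interval reaches time $1$. -/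
theorem integral_powerDensity {Q : ℕ → ℝ} (hQ : Summable fun m => |Q m|) {c d : ℝ} (h : c ≤ d) :
    ∫ t in c..d, powerDensity Q t = energyJump Q c d := by
  obtain ⟨C, hC1, hC⟩ := exists_deriv_timeBump_le
  have hC0 : 0 ≤ C := by linarith
  have hcont : ∀ m, Continuous fun t => timeBump m t * deriv (timeBump m) t * Q m := fun m =>
    ((continuous_timeBump m).mul (continuous_deriv_timeBump m)).mul continuous_const
  rw [intervalIntegral.integral_of_le h]
  have hs := hasSum_integral_of_summable_integral_norm (μ := volume.restrict (Ioc c d))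
    (F := fun m t => timeBump m t * deriv (timeBump m) t * Q m)
    (fun m => ((hcont m).integrableOn_Icc (a := c) (b := d)).mono_set Ioc_subset_Icc_self) (by
      refine Summable.of_nonneg_of_le (fun m => integral_nonneg fun t => norm_nonneg _)
        (fun m => ?_) (hQ.mul_left C)
      have hp := stageRate_pos m
      refine (integral_abs_stage_le (m := m) (c := C * stageRate m * |Q m|) (by positivity) _
        (hcont m) (fun t ht => by rw [timeBump_eq_zero ht, zero_mul, zero_mul])
        fun t => ?_).trans (le_of_eq ?_)
      · rw [abs_mul, abs_mul]
        refine mul_le_mul_of_nonneg_right ?_ (abs_nonneg _)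
        calc |timeBump m t| * |deriv (timeBump m) t| ≤ 1 * (C * stageRate m) :=
              mul_le_mul (abs_timeBump_le_one m t) (hC m t) (abs_nonneg _) zero_le_one
          _ = _ := one_mul _
      · field_simp)
  refine hs.tsum_eq.symm.trans (tsum_congr fun m => ?_)
  rw [← intervalIntegral.integral_of_le h, intervalIntegral.integral_mul_const,
    integral_timeBump_mul_deriv]

theorem summable_energyJump {Q : ℕ → ℝ} (hQ : Summable fun m => |Q m|) (c d : ℝ) :
    Summable fun m => (timeBump m d ^ 2 - timeBump m c ^ 2) / 2 * Q m := by
  refine Summable.of_norm_bounded hQ fun m => ?_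
  rw [norm_mul, Real.norm_eq_abs, Real.norm_eq_abs]
  refine mul_le_of_le_one_left (abs_nonneg _) ?_
  have h1 := (sq_le_one_iff_abs_le_one _).2 (abs_timeBump_le_one m c)
  have h2 := (sq_le_one_iff_abs_le_one _).2 (abs_timeBump_le_one m d)
  have h3 := sq_nonneg (timeBump m c)
  have h4 := sq_nonneg (timeBump m d)
  rw [abs_le]; constructor <;> linarith

/-- Weierstrass M-test. Continuity at the accumulation time supplies the limit of the work as
$t\to1^-$. -/
theorem continuous_energyJump {Q : ℕ → ℝ} (hQ : Summable fun m => |Q m|) (c : ℝ) :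
    Continuous (energyJump Q c) := by
  refine continuous_tsum (fun m => ?_) hQ fun m d => ?_
  · have := continuous_timeBump m
    fun_prop
  · rw [norm_mul, Real.norm_eq_abs, Real.norm_eq_abs]
    refine mul_le_of_le_one_left (abs_nonneg _) ?_
    have h1 := (sq_le_one_iff_abs_le_one _).2 (abs_timeBump_le_one m c)
    have h2 := (sq_le_one_iff_abs_le_one _).2 (abs_timeBump_le_one m d)
    have h3 := sq_nonneg (timeBump m c)
    have h4 := sq_nonneg (timeBump m d)
    rw [abs_le]; constructor <;> linarith

theorem summable_profileEnergy {L : ℝ} (hL : 0 < L) : Summable fun m => |profileEnergy L m| := by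
  refine Summable.of_nonneg_of_le (fun m => abs_nonneg _) (fun m => ?_)
    (summable_profileSize.mul_left (8 * L ^ 3))
  rw [abs_of_nonneg (profileEnergy_nonneg L m)]
  refine (profileEnergy_le hL m).trans ?_
  gcongr
  exact pow_le_of_le_one (profileSize_pos m).le (profileSize_le_one m) two_ne_zero

/-- The energy of the low frequencies of the `m`-th profile. -/
noncomputable def lowPassEnergy (χ : E3 → ℝ) (L : ℝ) (q m : ℕ) : ℝ :=
  pairing L (lowPass χ L q (shear (profile L m))) (lowPass χ L q (shear (profile L m)))

theorem summable_lowPassEnergy {L : ℝ} (hL : 0 < L) {χ : E3 → ℝ} (hχ : IsCutoff χ) (q : ℕ) :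
    Summable fun m => |lowPassEnergy χ L q m| := by
  refine summable_of_ne_finset_zero (s := Finset.range q) fun m hm => ?_
  rw [Finset.mem_range, not_lt] at hm
  simp [lowPassEnergy, lowPass_profile_eq_zero hL hχ hm, pairing]

theorem pairing_limit (L t : ℝ) :
    pairing L (limitForce L t) (limitVelocity L t) = powerDensity (profileEnergy L) t := by
  obtain ⟨m, hm⟩ := exists_active_stage t
  rw [limitForce_active hm, limitVelocity_active hm, powerDensity_active hm, pairing_smul_smul,
    mul_comm (timeBump m t)]
  rfl

theorem pairing_lowPass_limit (χ : E3 → ℝ) (L : ℝ) (q : ℕ) (t : ℝ) :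
    pairing L (lowPass χ L q (limitForce L t)) (lowPass χ L q (limitVelocity L t))
      = powerDensity (lowPassEnergy χ L q) t := by
  obtain ⟨m, hm⟩ := exists_active_stage t
  rw [limitForce_active hm, limitVelocity_active hm, powerDensity_active hm, lowPass_smul,
    lowPass_smul, pairing_smul_smul, mul_comm (timeBump m t)]
  rfl

theorem tendsto_integral_power {L : ℝ} (hL : 0 < L) {c : ℝ} (hc : c < 1) :
    Tendsto (fun t => ∫ s in c..t, pairing L (limitForce L s) (limitVelocity L s)) (𝓝[<] 1)
      (𝓝 (energyJump (profileEnergy L) c 1)) := by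
  have h := ((continuous_energyJump (summable_profileEnergy hL) c).tendsto 1).mono_left
    (nhdsWithin_le_nhds (s := Iio 1))
  refine h.congr' ?_
  filter_upwards [Ioo_mem_nhdsLT hc] with t ht
  simp only [pairing_limit]
  exact (integral_powerDensity (summable_profileEnergy hL) ht.1.le).symm

/-- For low-pass filters of high order the energy differences are eventually exact. -/
theorem eventually_energyJump_eq {L : ℝ} (hL : 0 < L) {χ : E3 → ℝ} (hχ : IsCutoff χ) (c d : ℝ) :
    ∀ᶠ q in atTop, energyJump (lowPassEnergy χ L q) c d = energyJump (profileEnergy L) c d := by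
  -- The jump involves the bumps only at the end times, so every stage other than $i$ and $j$ drops
  -- out on both sides.
  obtain ⟨i, hi⟩ := exists_active_stage c
  obtain ⟨j, hj⟩ := exists_active_stage d
  filter_upwards [lowPass_profile_eventually_eq hL hχ i, lowPass_profile_eventually_eq hL hχ j]
    with q h1 h2
  refine tsum_congr fun m => ?_
  by_cases hmi : m = i
  · rw [hmi, lowPassEnergy, h1]; rfl
  by_cases hmj : m = j
  · rw [hmj, lowPassEnergy, h2]; rfl
  rw [timeBump_eq_zero (hi m hmi), timeBump_eq_zero (hj m hmj)]
  simp

/-- Filtered and unfiltered work are energy jumps over the same interval. Its ends $c,d$ do not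
depend on $q$, so exactness of the filters at two fixed stages will be enough. -/
theorem shellAnomalousWork_limit {L : ℝ} (hL : 0 < L) {χ : E3 → ℝ} (hχ : IsCutoff χ)
    {t h : ℝ} (ht : t ∈ Icc (0 : ℝ) 1) (hh : 0 < h) : ∃ c d : ℝ,
    ∀ q, shellAnomalousWork χ L 1 (limitVelocity L) (limitForce L) q t h
      = energyJump (lowPassEnergy χ L q) c d - energyJump (profileEnergy L) c d := by
  by_cases h1 : t < 1
  · refine ⟨max (t - h) 0, min (t + h) 1, fun q => ?_⟩
    have hcd : max (t - h) 0 ≤ min (t + h) 1 := by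
      rw [max_le_iff, le_min_iff, le_min_iff]
      exact ⟨⟨by linarith, by linarith [ht.2]⟩, by linarith [ht.1], zero_le_one⟩
    have hsub : Summable fun m => |lowPassEnergy χ L q m - profileEnergy L m| :=
      Summable.of_nonneg_of_le (fun m => abs_nonneg _) (fun m => abs_sub _ _)
        ((summable_lowPassEnergy hL hχ q).add (summable_profileEnergy hL))
    have hpt : ∀ τ, powerDensity (lowPassEnergy χ L q) τ - powerDensity (profileEnergy L) τ
        = powerDensity (fun m => lowPassEnergy χ L q m - profileEnergy L m) τ := fun τ => by
      obtain ⟨m, hm⟩ := exists_active_stage τ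
      rw [powerDensity_active hm, powerDensity_active hm, powerDensity_active hm, mul_sub]
    rw [shellAnomalousWork, if_pos h1, Icc_inter_Icc]
    simp only [pairing_limit, pairing_lowPass_limit, hpt]
    rw [integral_Icc_eq_integral_Ioc, ← intervalIntegral.integral_of_le hcd,
      integral_powerDensity hsub hcd, energyJump, energyJump, energyJump,
      ← (summable_energyJump (summable_lowPassEnergy hL hχ q) _ _).tsum_sub
        (summable_energyJump (summable_profileEnergy hL) _ _)]
    simp only [mul_sub]
  · have hc : max (1 - h) 0 < 1 := max_lt (by linarith) zero_lt_one
    refine ⟨max (1 - h) 0, 1, fun q => ?_⟩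
    rw [shellAnomalousWork, if_neg h1, (tendsto_integral_power hL hc).limUnder_eq]
    simp only [pairing_lowPass_limit]
    rw [integral_powerDensity (summable_lowPassEnergy hL hχ q) hc.le]

/-- The limiting force does no anomalous work. -/
theorem anomalousWork_limit {L : ℝ} (hL : 0 < L) {χ : E3 → ℝ} (hχ : IsCutoff χ) {t h : ℝ}
    (ht : t ∈ Icc (0 : ℝ) 1) (hh : 0 < h) :
    anomalousWork χ L 1 (limitVelocity L) (limitForce L) t h = 0 := by
  obtain ⟨c, d, hcd⟩ := shellAnomalousWork_limit hL hχ ht hh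
  have hev : (fun q => ENNReal.ofReal
      |shellAnomalousWork χ L 1 (limitVelocity L) (limitForce L) q t h|) =ᶠ[atTop] fun _ => 0 := by
    filter_upwards [eventually_energyJump_eq hL hχ c d] with q hq
    rw [hcd, hq, sub_self, abs_zero, ENNReal.ofReal_zero]
  rw [anomalousWork, limsup_congr hev, limsup_const]

theorem continuousOn_power (L : ℝ) :
    ContinuousOn (fun t => pairing L (limitForce L t) (limitVelocity L t)) (Ico 0 1) := by
  intro t ht
  obtain ⟨N, hN⟩ := eventually_notMem_stage ht.2
  have hc : Continuous fun s => ∑ m ∈ Finset.range N,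
      timeBump m s * deriv (timeBump m) s * profileEnergy L m :=
    continuous_finsetSum _ fun m _ =>
      ((continuous_timeBump m).mul (continuous_deriv_timeBump m)).mul continuous_const
  refine (hc.continuousAt.congr ?_).continuousWithinAt
  filter_upwards [hN] with s hs
  rw [pairing_limit, powerDensity]
  refine (tsum_eq_sum fun m hm => ?_).symm
  rw [Finset.mem_range, not_lt] at hm
  rw [timeBump_eq_zero (hs m hm), zero_mul, zero_mul]

/-- The force vanishes in the sense of distributions as time one is approached. -/
theorem tendsto_pairing_limitForce {L : ℝ} (hL : 0 < L) {ψ : E3 → E3} (hψ : ContDiff ℝ ∞ ψ)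
    (hψp : IsPeriodic L ψ) :
    Tendsto (fun t => pairing L (limitForce L t) ψ) (𝓝[<] 1) (𝓝 0) := by
  obtain ⟨C, hC1, hC⟩ := exists_deriv_timeBump_le
  have h := (tendsto_stageRate_mul_pairing hL hψ hψp).const_mul C
  rw [mul_zero] at h
  rw [Metric.tendsto_nhds]
  intro ε hε
  obtain ⟨M, hM⟩ := eventually_atTop.1 (Metric.tendsto_nhds.1 h ε hε)
  filter_upwards [eventually_notMem_early_stage M] with t ht
  obtain ⟨m, hm⟩ := exists_active_stage t
  rw [limitForce_active hm, pairing_smul_left, Real.dist_eq, sub_zero]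
  by_cases hmt : t ∈ stage m
  · have hmM : M ≤ m := by
      by_contra hlt
      exact ht m (not_le.1 hlt) hmt
    refine lt_of_le_of_lt ?_ (hM m hmM)
    rw [Real.dist_eq, sub_zero, ← mul_assoc, abs_mul, abs_mul (C * _)]
    exact mul_le_mul_of_nonneg_right ((hC m t).trans (le_abs_self _)) (abs_nonneg _)
  · rw [deriv_timeBump_eq_zero hmt, zero_mul, abs_zero]; exact hε

theorem hasFiniteEnergyInput_limit {L : ℝ} (hL : 0 < L) :
    HasFiniteEnergyInput L 1 (limitVelocity L) (limitForce L) where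
  solution := isSmoothSolution_limit hL
  bounded := (mixedNorm_top_le (eLpNorm_two_limitVelocity_le hL)).trans_lt ENNReal.ofReal_lt_top
  work_locallyIntegrable := (continuousOn_power L).locallyIntegrableOn measurableSet_Ico
  work_limit := ⟨_, tendsto_integral_power hL zero_lt_one⟩
  force_limit _ hψ hψp := ⟨0, tendsto_pairing_limitForce hL hψ hψp⟩

/-! ### Exact energy balance of the viscous approximations -/

theorem gradSq_smul_shear (a : ℝ) {g : ℝ → ℝ} (hg : Differentiable ℝ g) (x : E3) :
    gradSq (a • shear g) x = a ^ 2 * gradSq (shear g) x := by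
  rw [smul_shear, gradSq_shear hg, gradSq_shear (hg.const_smul a), deriv_const_smul _ (hg _),
    smul_eq_mul, mul_pow]

theorem integral_gradSq_truncated (L : ℝ) (N : ℕ) (t : ℝ) :
    ∫ x, gradSq (truncatedVelocity L N t) x ∂torusMeasure L
      = ∑ m ∈ Finset.range N, timeBump m t ^ 2 * profileEnstrophy L m := by
  obtain ⟨m, hm⟩ := exists_active_stage t
  rw [truncatedVelocity_active hm, sum_range_active hm fun n hn => by
    rw [timeBump_eq_zero hn, zero_pow two_ne_zero, zero_mul]]
  split_ifs
  · simp only [gradSq_smul_shear _ (differentiable_profile L m), integral_const_mul]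
    rfl
  · simp [gradSq]

/-- The dissipation of the truncated velocities equals the initial energy. -/
theorem dissipation_truncated {L : ℝ} (hL : 0 < L) (n : ℕ) :
    2 * viscosity L n * ∫ t in 0..1, ∫ x, gradSq (truncatedVelocity L (n + 1) t) x ∂torusMeasure L
      = profileEnergy L 0 := by
  rw [← viscosity_mul_sum hL n]
  congr 1
  simp only [integral_gradSq_truncated]
  rw [intervalIntegral.integral_finsetSum fun m _ => Continuous.intervalIntegrable
    (by have := continuous_timeBump m; fun_prop) _ _]
  exact Finset.sum_congr rfl fun m _ => intervalIntegral.integral_mul_const _ _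

/-- The force carries $-\nu\Delta u$, so integration by parts makes the viscous contribution
positive: this part of the force returns to the flow what viscosity removes. -/
theorem pairing_truncated {L : ℝ} (hL : 0 < L) (ν : ℝ) (N : ℕ) (t : ℝ) :
    pairing L (viscousForce L ν N t) (truncatedVelocity L N t)
      = ∑ m ∈ Finset.range N, (timeBump m t * deriv (timeBump m) t * profileEnergy L m
        + ν * (timeBump m t ^ 2 * profileEnstrophy L m)) := by
  obtain ⟨m, hm⟩ := exists_active_stage t
  rw [viscousForce, truncatedVelocity_active hm, truncatedForce_active hm,
    truncatedLaplacian_active hm, sum_range_active hm fun n hn => by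
      rw [timeBump_eq_zero hn]; ring]
  split_ifs
  · have hb := continuous_shear (continuous_profile L m)
    have hb2 := continuous_shear (contDiff_deriv_deriv_profile L m (n := 0)).continuous
    rw [pairing_sub_left L (hb.const_smul _) ((hb2.const_smul _).const_smul _) (hb.const_smul _),
      smul_smul, pairing_smul_smul, pairing_smul_smul,
      pairing_shear_deriv_deriv hL.le (contDiff_profile L m) (periodic_profile hL m),
      profileEnergy, profileEnstrophy]
    ring
  · simp [pairing]

/-- The viscous forces do no work. -/
theorem work_truncated {L : ℝ} (hL : 0 < L) (n : ℕ) :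
    ∫ t in 0..1, pairing L (viscousForce L (viscosity L n) (n + 1) t)
      (truncatedVelocity L (n + 1) t) = 0 := by
  simp only [pairing_truncated hL]
  have h1 : ∀ m, Continuous fun t => timeBump m t * deriv (timeBump m) t * profileEnergy L m :=
    fun m => ((continuous_timeBump m).mul (continuous_deriv_timeBump m)).mul continuous_const
  have h2 : ∀ m, Continuous fun t => viscosity L n * (timeBump m t ^ 2 * profileEnstrophy L m) :=
    fun m => continuous_const.mul (((continuous_timeBump m).pow 2).mul continuous_const)
  rw [intervalIntegral.integral_finsetSum fun m _ => Continuous.intervalIntegrable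
    (by have := h1 m; have := h2 m; fun_prop) _ _]
  -- Every stage $m\ne0$ vanishes at both end times and has no net inertial work. Stage $0$ loses
  -- half of $\|b_0\|^2$, which the viscous terms restore by the choice of the viscosity.
  have e : ∀ m ∈ Finset.range (n + 1), (∫ t in 0..1,
      (timeBump m t * deriv (timeBump m) t * profileEnergy L m
        + viscosity L n * (timeBump m t ^ 2 * profileEnstrophy L m)))
      = (if m = 0 then -(profileEnergy L 0 / 2) else 0) + viscosity L n * stageEnstrophy L m := by
    intro m _
    rw [intervalIntegral.integral_add ((h1 m).intervalIntegrable _ _)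
      ((h2 m).intervalIntegrable _ _), intervalIntegral.integral_mul_const,
      intervalIntegral.integral_const_mul, intervalIntegral.integral_mul_const,
      integral_timeBump_mul_deriv, timeBump_eq_zero (one_le_notMem_stage m le_rfl)]
    congr 1
    split_ifs with h
    · rw [h, timeBump_zero_zero]; ring
    · rw [timeBump_eq_zero (zero_notMem_stage h)]; ring
  rw [Finset.sum_congr rfl e, Finset.sum_add_distrib, ← Finset.mul_sum, Finset.sum_ite_eq',
    if_pos (by simp)]
  linarith [viscosity_mul_sum hL n]

/-! ### Besov regularity of the limiting velocity -/

theorem enorm_timeBump_le_one (m : ℕ) (t : ℝ) : ‖timeBump m t‖ₑ ≤ 1 := by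
  rw [← ofReal_norm, ← ENNReal.ofReal_one]
  exact ENNReal.ofReal_le_ofReal (abs_timeBump_le_one m t)

theorem cube_enorm_mul_le (m : ℕ) (t ρ : ℝ) :
    (‖timeBump m t‖ₑ * ENNReal.ofReal ρ) ^ 3 ≤ ‖timeBump m t‖ₑ * ENNReal.ofReal ρ ^ 3 := by
  rw [mul_pow]
  gcongr
  exact pow_le_of_le_one zero_le (enorm_timeBump_le_one m t) three_ne_zero

theorem lintegral_cube_stages_lt_top {ρ : ℕ → ℝ} (hρ : ∀ m, 0 ≤ ρ m)
    (hs : Summable fun m => ρ m ^ 3 * (stageRate m)⁻¹) :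
    ∫⁻ t in Icc (0 : ℝ) 1, ∑' m, ‖timeBump m t‖ₑ * ENNReal.ofReal (ρ m) ^ 3 < ⊤ := by
  refine (lintegral_tsum_mul_le
    (F := fun m t => ‖timeBump m t‖ₑ * ENNReal.ofReal (ρ m) ^ 3)
    (B := fun m => ENNReal.ofReal (ρ m ^ 3 * (stageRate m)⁻¹))
    (fun m => (continuous_timeBump m).measurable.enorm.mul_const _) (fun t => le_rfl)
    fun m => ?_).trans_lt hs.tsum_ofReal_lt_top
  rw [lintegral_mul_const' _ _ (by finiteness), mul_comm, ENNReal.ofReal_mul (pow_nonneg (hρ m) 3),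
    ENNReal.ofReal_pow (hρ m)]
  gcongr
  exact lintegral_timeBump_le m _

/-- The bound $\rho_m$ on the weighted blocks is uniform in $j$, so the Besov norm at a time of
stage $m$ is at most $|a_m|\rho_m\sum_jc_j$, and the cubes are integrated stage by stage. -/
theorem lintegral_weightedBesovNorm_lt_top {L : ℝ} (hL : 0 < L) {χ : E3 → ℝ} (hχ : IsCutoff χ)
    {c : ℕ → ℝ} (hc : Summable c) :
    ∫⁻ t in Icc 0 1, weightedBesovNorm χ L (1 / 3) 3 c (limitVelocity L t) ^ 3 < ⊤ := by
  obtain ⟨ρ, hρ0, hρs, hρ⟩ := exists_besov_bound hL hχ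
  set W := ∑' j, ENNReal.ofReal (c (j + 1))
  have hW : W ≠ ⊤ := ((summable_nat_add_iff 1).2 hc).tsum_ofReal_ne_top
  have key : ∀ t, weightedBesovNorm χ L (1 / 3) 3 c (limitVelocity L t) ^ 3
      ≤ W ^ 3 * ∑' m, ‖timeBump m t‖ₑ * ENNReal.ofReal (ρ m) ^ 3 := fun t => by
    obtain ⟨m, hm⟩ := exists_active_stage t
    rw [tsum_active hm fun n hn => by simp [timeBump_eq_zero hn]]
    refine le_trans ?_ (mul_le_mul_right (cube_enorm_mul_le m t (ρ m)) _)
    rw [← mul_pow]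
    gcongr
    rw [weightedBesovNorm, ← ENNReal.tsum_mul_right]
    refine ENNReal.tsum_le_tsum fun j => ?_
    rw [limitVelocity_active hm, lpBlock_smul, eLpNorm_const_smul, mul_assoc, mul_left_comm _ ‖_‖ₑ]
    gcongr
    exact hρ m j
  refine (lintegral_mono key).trans_lt ?_
  rw [lintegral_const_mul' _ _ (by finiteness)]
  exact ENNReal.mul_lt_top (by finiteness) (lintegral_cube_stages_lt_top hρ0 hρs)

theorem limsup_lintegral_lpBlock_lt_top {L : ℝ} (hL : 0 < L) {χ : E3 → ℝ} (hχ : IsCutoff χ) :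
    limsup (fun q : ℕ => ∫⁻ t in Icc 0 1,
      2 ^ q * eLpNorm (lpBlock χ L (q + 1) (limitVelocity L t)) 3 (torusMeasure L) ^ 3) atTop
      < ⊤ := by
  obtain ⟨ρ, hρ0, hρs, hρ⟩ := exists_besov_bound hL hχ
  refine lt_of_le_of_lt ?_ (lintegral_cube_stages_lt_top hρ0 hρs)
  refine limsup_le_of_le (h := Eventually.of_forall fun q => lintegral_mono fun t => ?_)
  obtain ⟨m, hm⟩ := exists_active_stage t
  rw [tsum_active hm fun n hn => by simp [timeBump_eq_zero hn]]
  refine le_trans ?_ (cube_enorm_mul_le m t (ρ m))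
  have e : (2 : ℝ≥0∞) ^ q = ENNReal.ofReal ((2 : ℝ) ^ (1 / 3 * (((q + 1 : ℕ) : ℝ) - 1))) ^ 3 := by
    rw [← ENNReal.ofReal_pow (by positivity), ← Real.rpow_natCast, ← Real.rpow_mul two_pos.le,
      show 1 / 3 * (((q + 1 : ℕ) : ℝ) - 1) * ((3 : ℕ) : ℝ) = q by push_cast; ring,
      Real.rpow_natCast, ENNReal.ofReal_pow two_pos.le, ENNReal.ofReal_ofNat]
  rw [e, ← mul_pow, limitVelocity_active hm, lpBlock_smul, eLpNorm_const_smul, mul_left_comm _ ‖_‖ₑ]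
  gcongr
  exact hρ m (q + 1)

/-! ### The limit is a weak Euler solution -/

/-- Young's inequality weighted by $s=$ `profileSize m`, namely
$\|b\|\|\psi\|\le\|b\|^2/(2s)+s\|\psi\|^2/2$. Since $\|b_m\|^2\lesssim s^2$, both terms are linear
in $s$, hence summable in $m$. -/
theorem abs_pairing_profile_le {L : ℝ} (hL : 0 < L) (m : ℕ) {ψ : E3 → E3}
    (hψ : MemLp ψ 2 (torusMeasure L)) :
    |pairing L (shear (profile L m)) ψ|
      ≤ (8 * L ^ 3 + ∫ x, ‖ψ x‖ ^ 2 ∂torusMeasure L) / 2 * profileSize m := by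
  have hs := profileSize_pos m
  have hb := memLp_torus L (continuous_shear (continuous_profile L m)) 2
  have ib := hb.integrable_norm_pow two_ne_zero
  have iψ := hψ.integrable_norm_pow two_ne_zero
  have h2 : ∫ x, ‖shear (profile L m) x‖ ^ 2 ∂torusMeasure L ≤ 8 * L ^ 3 * profileSize m ^ 2 := by
    rw [← pairing_self]; exact profileEnergy_le hL m
  calc |pairing L (shear (profile L m)) ψ|
      ≤ ∫ x, ((profileSize m)⁻¹ / 2 * ‖shear (profile L m) x‖ ^ 2
          + profileSize m / 2 * ‖ψ x‖ ^ 2) ∂torusMeasure L := by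
        rw [pairing, ← Real.norm_eq_abs]
        refine norm_integral_le_of_norm_le ((ib.const_mul _).add (iψ.const_mul _))
          (ae_of_all _ fun x => ?_)
        refine (norm_inner_le_norm _ _).trans ?_
        have := sq_nonneg (‖shear (profile L m) x‖ - profileSize m * ‖ψ x‖)
        have e : (profileSize m)⁻¹ / 2 * ‖shear (profile L m) x‖ ^ 2
            + profileSize m / 2 * ‖ψ x‖ ^ 2 - ‖shear (profile L m) x‖ * ‖ψ x‖
            = (‖shear (profile L m) x‖ - profileSize m * ‖ψ x‖) ^ 2 / (2 * profileSize m) := by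
          field_simp; ring
        have : 0 ≤ (‖shear (profile L m) x‖ - profileSize m * ‖ψ x‖) ^ 2 / (2 * profileSize m) := by
          positivity
        linarith
    _ = (profileSize m)⁻¹ / 2 * ∫ x, ‖shear (profile L m) x‖ ^ 2 ∂torusMeasure L
          + profileSize m / 2 * ∫ x, ‖ψ x‖ ^ 2 ∂torusMeasure L := by
        rw [integral_add (ib.const_mul _) (iψ.const_mul _), integral_const_mul, integral_const_mul]
    _ ≤ (profileSize m)⁻¹ / 2 * (8 * L ^ 3 * profileSize m ^ 2)
          + profileSize m / 2 * ∫ x, ‖ψ x‖ ^ 2 ∂torusMeasure L := by gcongr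
    _ = _ := by field_simp

theorem continuous_pairing_limitVelocity {L : ℝ} (hL : 0 < L) {ψ : E3 → E3}
    (hψ : MemLp ψ 2 (torusMeasure L)) : Continuous fun t => pairing L (limitVelocity L t) ψ := by
  have e : (fun t => pairing L (limitVelocity L t) ψ)
      = fun t => ∑' m, timeBump m t * pairing L (shear (profile L m)) ψ := by
    funext t
    obtain ⟨m, hm⟩ := exists_active_stage t
    rw [tsum_active hm fun n hn => by rw [timeBump_eq_zero hn, zero_mul], limitVelocity_active hm,
      pairing_smul_left]
  rw [e]
  refine continuous_tsum (fun m => (continuous_timeBump m).mul continuous_const)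
    (summable_profileSize.mul_left ((8 * L ^ 3 + ∫ x, ‖ψ x‖ ^ 2 ∂torusMeasure L) / 2))
    fun m t => ?_
  rw [norm_mul]
  exact (mul_le_of_le_one_left (norm_nonneg _) (abs_timeBump_le_one m t)).trans
    (abs_pairing_profile_le hL m hψ)

/-- Stage $0$ begins at time $-1/5$, so bounds on test fields are taken on an interval extending
below $0$. -/
theorem stage_subset (m : ℕ) : stage m ⊆ Icc (-1) 1 := by
  intro t ht
  have h1 := one_le_stageRate m
  rw [mem_stage_iff] at ht
  constructor
  · by_contra h
    nlinarith [ht.2]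
  · by_contra h
    nlinarith [ht.1]

theorem hasDerivAt_time_slice {φ : ℝ → E3 → E3} (hφ : ContDiff ℝ ∞ fun z : ℝ × E3 => φ z.1 z.2)
    (t : ℝ) (x : E3) : HasDerivAt (fun s => φ s x)
      (fderiv ℝ (fun z : ℝ × E3 => φ z.1 z.2) (t, x) (1, 0)) t := by
  have h := ((hφ.differentiable (by simp)) (t, x)).hasFDerivAt
  have h2 : HasDerivAt (fun s : ℝ => (s, x)) ((1 : ℝ), (0 : E3)) t :=
    (hasDerivAt_id t).prodMk (hasDerivAt_const t x)
  exact h.comp_hasDerivAt t h2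

theorem continuous_time_deriv {φ : ℝ → E3 → E3}
    (hφ : ContDiff ℝ ∞ fun z : ℝ × E3 => φ z.1 z.2) :
    Continuous fun z : ℝ × E3 => deriv (fun s => φ s z.2) z.1 := by
  have e : (fun z : ℝ × E3 => deriv (fun s => φ s z.2) z.1)
      = fun z => fderiv ℝ (fun z : ℝ × E3 => φ z.1 z.2) z (1, 0) := by
    funext z; exact (hasDerivAt_time_slice hφ z.1 z.2).deriv
  rw [e]
  exact (hφ.continuous_fderiv (by simp)).clm_apply continuous_const

/-- Pairings of the profiles with a continuous family of fields are bounded, uniformly in time, by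
a multiple of the profile sizes. -/
theorem exists_pairing_profile_le {L : ℝ} (hL : 0 < L) {φ : ℝ → E3 → E3}
    (hφ : Continuous fun z : ℝ × E3 => φ z.1 z.2) : ∃ C : ℝ, 0 ≤ C ∧
      ∀ m, ∀ t ∈ Icc (-1 : ℝ) 1, |pairing L (shear (profile L m)) (φ t)| ≤ C * profileSize m := by
  have hc := continuous_integral_torus L (k := fun t x => ‖φ t x‖ ^ 2) (hφ.norm.pow 2)
  obtain ⟨C, hC⟩ := (isCompact_Icc (a := (-1 : ℝ)) (b := 1)).exists_bound_of_continuousOn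
    hc.continuousOn
  have hC0 : 0 ≤ C := (norm_nonneg _).trans (hC 0 (by norm_num))
  refine ⟨(8 * L ^ 3 + C) / 2, by positivity, fun m t ht => ?_⟩
  have hs := profileSize_pos m
  refine (abs_pairing_profile_le hL m
    (memLp_torus L (hφ.comp (Continuous.prodMk_right t)) 2)).trans ?_
  gcongr
  exact (le_abs_self _).trans (hC t ht)

theorem continuous_pairing_profile (L : ℝ) (m : ℕ) {φ : ℝ → E3 → E3}
    (hφ : Continuous fun z : ℝ × E3 => φ z.1 z.2) :
    Continuous fun t => pairing L (shear (profile L m)) (φ t) :=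
  continuous_integral_torus L
    (((continuous_shear (continuous_profile L m)).comp continuous_snd).inner hφ)

theorem hasDerivAt_pairing_profile (L : ℝ) (m : ℕ) {φ : ℝ → E3 → E3}
    (hφ : ContDiff ℝ ∞ fun z : ℝ × E3 => φ z.1 z.2) (t : ℝ) :
    HasDerivAt (fun t => pairing L (shear (profile L m)) (φ t))
      (pairing L (shear (profile L m)) fun x => deriv (fun s => φ s x) t) t := by
  have hb : Continuous fun z : ℝ × E3 => shear (profile L m) z.2 :=
    (continuous_shear (continuous_profile L m)).comp continuous_snd
  refine hasDerivAt_integral_torus L (k := fun t x => ⟪shear (profile L m) x, φ t x⟫)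
    (k' := fun t x => ⟪shear (profile L m) x, deriv (fun s => φ s x) t⟫) (hb.inner hφ.continuous)
    (hb.inner (continuous_time_deriv hφ)) (fun s x => ?_) t
  have h := (hasDerivAt_const s (shear (profile L m) x)).inner ℝ
    (hasDerivAt_time_slice hφ s x).differentiableAt.hasDerivAt
  simpa using h

/-- The space integral in the weak formulation splits over the stages. -/
theorem integral_weak_density {L : ℝ} (hL : 0 < L) {φ : ℝ → E3 → E3}
    (hφ : ContDiff ℝ ∞ fun z : ℝ × E3 => φ z.1 z.2) (hp : ∀ t, IsPeriodic L (φ t)) (t : ℝ) :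
    ∫ x, (⟪limitVelocity L t x, deriv (fun s => φ s x) t⟫
        + ⟪limitVelocity L t x, fderiv ℝ (φ t) x (limitVelocity L t x)⟫
        + ⟪limitForce L t x, φ t x⟫) ∂torusMeasure L
      = ∑' m, (deriv (timeBump m) t * pairing L (shear (profile L m)) (φ t)
        + timeBump m t * pairing L (shear (profile L m)) fun x => deriv (fun s => φ s x) t) := by
  obtain ⟨m, hm⟩ := exists_active_stage t
  have hφt : ContDiff ℝ ∞ (φ t) := hφ.comp (contDiff_prodMk_right t)
  have hu := continuous_limitVelocity L t
  have c1 : Continuous fun x => ⟪limitVelocity L t x, deriv (fun s => φ s x) t⟫ :=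
    hu.inner ((continuous_time_deriv hφ).comp (Continuous.prodMk_right t))
  have c2 : Continuous fun x => ⟪limitVelocity L t x, fderiv ℝ (φ t) x (limitVelocity L t x)⟫ :=
    hu.inner ((hφt.continuous_fderiv (by simp)).clm_apply hu)
  have c3 : Continuous fun x => ⟪limitForce L t x, φ t x⟫ :=
    (continuous_limitForce L t).inner hφt.continuous
  rw [integral_add (integrable_torus L (c1.fun_add c2)) (integrable_torus L c3),
    integral_add (integrable_torus L c1) (integrable_torus L c2),
    tsum_active hm fun n hn => by
      rw [timeBump_eq_zero hn, deriv_timeBump_eq_zero hn, zero_mul, zero_mul, add_zero]]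
  have h2 : ∫ x, ⟪limitVelocity L t x, fderiv ℝ (φ t) x (limitVelocity L t x)⟫ ∂torusMeasure L
      = 0 := by
    have hper : Function.Periodic (timeBump m t • profile L m) L := fun s => by
      simp only [Pi.smul_apply, periodic_profile hL m s]
    rw [limitVelocity_active hm, smul_shear]
    exact integral_convection_shear hL.le (contDiff_const.smul (contDiff_profile L m)) hper
      (hφt.of_le (by simp)) (hp t)
  rw [h2, add_zero, add_comm, ← pairing_smul_left, ← pairing_smul_left, ← limitForce_active hm,
    ← limitVelocity_active hm]
  rfl

/-- Stage by stage the density is $\frac{d}{dt}\bigl(a_m\langle b_m,\varphi\rangle\bigr)$. All bumps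
vanish at $t=1$ and only stage $0$ is active at $t=0$, so one boundary term remains. -/
theorem weak_form_limit {L : ℝ} (hL : 0 < L) {φ : ℝ → E3 → E3}
    (hφ : ContDiff ℝ ∞ fun z : ℝ × E3 => φ z.1 z.2) (hp : ∀ t, IsPeriodic L (φ t)) :
    ∫ t in (0 : ℝ)..1, ∫ x, (⟪limitVelocity L t x, deriv (fun s => φ s x) t⟫
        + ⟪limitVelocity L t x, fderiv ℝ (φ t) x (limitVelocity L t x)⟫
        + ⟪limitForce L t x, φ t x⟫) ∂torusMeasure L
      = -pairing L (shear (profile L 0)) (φ 0) := by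
  obtain ⟨D, hD1, hD⟩ := exists_deriv_timeBump_le
  obtain ⟨A, hA0, hA⟩ := exists_pairing_profile_le hL hφ.continuous
  obtain ⟨B, hB0, hB⟩ := exists_pairing_profile_le hL
    (φ := fun t x => deriv (fun s => φ s x) t) (continuous_time_deriv hφ)
  have hD0 : 0 ≤ D := by linarith
  have hcont : ∀ m, Continuous fun t =>
      deriv (timeBump m) t * pairing L (shear (profile L m)) (φ t)
        + timeBump m t * pairing L (shear (profile L m)) fun x => deriv (fun s => φ s x) t :=
    fun m => ((continuous_deriv_timeBump m).mul (continuous_pairing_profile L m hφ.continuous)).add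
      ((continuous_timeBump m).mul (continuous_pairing_profile L m
        (φ := fun t x => deriv (fun s => φ s x) t) (continuous_time_deriv hφ)))
  simp only [integral_weak_density hL hφ hp]
  rw [intervalIntegral.integral_of_le zero_le_one]
  have hs := hasSum_integral_of_summable_integral_norm (μ := volume.restrict (Ioc (0 : ℝ) 1))
    (F := fun m t => deriv (timeBump m) t * pairing L (shear (profile L m)) (φ t)
        + timeBump m t * pairing L (shear (profile L m)) fun x => deriv (fun s => φ s x) t)
    (fun m => ((hcont m).integrableOn_Icc (a := 0) (b := 1)).mono_set Ioc_subset_Icc_self) (by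
      refine Summable.of_nonneg_of_le (fun m => integral_nonneg fun t => norm_nonneg _)
        (fun m => ?_) (summable_profileSize.mul_left (D * A + B))
      have hr := stageRate_pos m
      have hr1 := one_le_stageRate m
      have hz := profileSize_pos m
      -- The part with $a_m'$ contributes $DA$, its rate cancelling the duration; the part with
      -- $a_m$ contributes at most $B$, as durations are at most $1$.
      refine (integral_abs_stage_le (m := m) (c := stageRate m * ((D * A + B) * profileSize m))
        (by positivity) _ (hcont m) (fun t ht => by
          rw [timeBump_eq_zero ht, deriv_timeBump_eq_zero ht, zero_mul, zero_mul, add_zero])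
        fun t => ?_).trans (le_of_eq (by field_simp))
      by_cases ht : t ∈ stage m
      · have ht' := stage_subset m ht
        refine (abs_add_le _ _).trans ?_
        rw [abs_mul, abs_mul]
        calc _ ≤ D * stageRate m * (A * profileSize m) + 1 * (B * profileSize m) :=
              add_le_add (mul_le_mul (hD m t) (hA m t ht') (abs_nonneg _) (by positivity))
                (mul_le_mul (abs_timeBump_le_one m t) (hB m t ht') (abs_nonneg _) zero_le_one)
          _ ≤ D * stageRate m * (A * profileSize m) + stageRate m * (B * profileSize m) := by
              gcongr
          _ = _ := by ring
      · rw [timeBump_eq_zero ht, deriv_timeBump_eq_zero ht, zero_mul, zero_mul, add_zero, abs_zero]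
        positivity)
  refine hs.tsum_eq.symm.trans ?_
  have hm : ∀ m, ∫ t in Ioc (0 : ℝ) 1,
      (deriv (timeBump m) t * pairing L (shear (profile L m)) (φ t)
        + timeBump m t * pairing L (shear (profile L m)) fun x => deriv (fun s => φ s x) t)
      = -(timeBump m 0 * pairing L (shear (profile L m)) (φ 0)) := fun m => by
    rw [← intervalIntegral.integral_of_le zero_le_one,
      intervalIntegral.integral_eq_sub_of_hasDerivAt
        (f := fun t => timeBump m t * pairing L (shear (profile L m)) (φ t)) (fun t _ =>
          (differentiable_timeBump m t).hasDerivAt.mul (hasDerivAt_pairing_profile L m hφ t))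
        ((hcont m).intervalIntegrable _ _),
      timeBump_eq_zero (one_le_notMem_stage m le_rfl), zero_mul, zero_sub]
  rw [tsum_congr hm, tsum_active zero_active_stage fun n hn => by
    rw [timeBump_eq_zero hn, zero_mul, neg_zero], timeBump_zero_zero, one_mul]

theorem isWeakEulerSolution_limit {L : ℝ} (hL : 0 < L) :
    IsWeakEulerSolution L 1 (limitVelocity L) (limitForce L) (shear (profile L 0)) where
  periodic_u t _ := isPeriodic_limitVelocity hL t
  memLp t _ := memLp_torus L (continuous_limitVelocity L t) 2
  weakly_continuous _ hψ := (continuous_pairing_limitVelocity hL hψ).continuousOn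
  force_integrable := (force_convergence hL one_pos ENNReal.one_lt_two).1
  weakly_div_free t _ ψ hψ hψp := by
    obtain ⟨m, hm⟩ := exists_active_stage t
    rw [limitVelocity_active hm, pairing_smul_left, pairing_shear_gradient hL.le
      (contDiff_profile L m) (periodic_profile hL m) (hψ.of_le (by simp)) hψp, mul_zero]
  initial := by rw [limitVelocity_zero]
  weak_form φ hφ hp _ := by
    have h : pairing L 0 (φ 1) = 0 := by simp [pairing]
    rw [weak_form_limit hL hφ hp, limitVelocity_one, h, zero_sub]

theorem theorem3p3 (L : ℝ) (hL : 0 < L) (χ : E3 → ℝ) (hχ : IsCutoff χ) :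
    ∃ (T : ℝ) (ν : ℕ → ℝ) (un fn : ℕ → ℝ → E3 → E3) (u f : ℝ → E3 → E3) (uin : E3 → E3),
      0 < T ∧ (∀ n, 0 < ν n) ∧ Tendsto ν atTop (𝓝 0) ∧
      -- smooth forced Navier–Stokes solutions with a common initial datum
      (∀ n, IsSmoothSolution L (ν n) (Icc 0 T) (un n) (fn n)) ∧
      (∀ n, un n 0 = uin) ∧ u 0 = uin ∧
      -- convergence of the velocities and of the forces
      mixedNorm L T ⊤ 2 u < ⊤ ∧
      Tendsto (fun n => mixedNorm L T ⊤ 2 (un n - u)) atTop (𝓝 0) ∧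
      (∀ r : ℝ≥0∞, 0 < r → r < 2 →
        mixedNorm L T 1 r f < ⊤ ∧
        Tendsto (fun n => mixedNorm L T 1 r (fn n - f)) atTop (𝓝 0)) ∧
      -- the limit is a weak Euler solution of the stated regularity
      IsWeakEulerSolution L T u f uin ∧
      (∀ c : ℕ → ℝ, (∀ n, 0 ≤ c n) → Summable c →
        ∫⁻ t in Icc 0 T, weightedBesovNorm χ L (1 / 3) 3 c (u t) ^ 3 < ⊤) ∧
      limsup (fun q : ℕ => ∫⁻ t in Icc 0 T,
        2 ^ q * eLpNorm (lpBlock χ L (q + 1) (u t)) 3 (torusMeasure L) ^ 3) atTop < ⊤ ∧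
      -- zero anomalous work
      HasFiniteEnergyInput L T u f ∧
      (∀ t ∈ Icc 0 T, ∀ h : ℝ, 0 < h → (t < T → t + h < T) →
        anomalousWork χ L T u f t h = 0) ∧
      -- total viscous anomalous dissipation, and zero work for each member of the family
      0 < ∫ x, ‖uin x‖ ^ 2 ∂torusMeasure L ∧
      Tendsto (fun n => 2 * ν n * ∫ t in 0..T, ∫ x, gradSq (un n t) x ∂torusMeasure L) atTop
        (𝓝 (∫ x, ‖uin x‖ ^ 2 ∂torusMeasure L)) ∧
      ∀ n, ∫ t in 0..T, pairing L (fn n t) (un n t) = 0 := by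
  have henergy : ∫ x, ‖shear (profile L 0) x‖ ^ 2 ∂torusMeasure L = profileEnergy L 0 :=
    (pairing_self L _).symm
  refine ⟨1, viscosity L, fun n => truncatedVelocity L (n + 1),
    fun n => viscousForce L (viscosity L n) (n + 1), limitVelocity L, limitForce L,
    shear (profile L 0), one_pos, viscosity_pos hL, tendsto_viscosity hL,
    fun n => isSmoothSolution_truncated hL _ _, truncatedVelocity_zero L, limitVelocity_zero L,
    (hasFiniteEnergyInput_limit hL).bounded, tendsto_mixedNorm_velocity hL,
    fun r h0 h2 => force_convergence hL h0 h2, isWeakEulerSolution_limit hL,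
    fun c _ hc => lintegral_weightedBesovNorm_lt_top hL hχ hc,
    limsup_lintegral_lpBlock_lt_top hL hχ, hasFiniteEnergyInput_limit hL,
    fun t ht h hh _ => anomalousWork_limit hL hχ ht hh, ?_, ?_, work_truncated hL⟩
  · rw [henergy]; exact profileEnergy_zero_pos hL
  -- The dissipation equals the initial energy for every $n$, so the sequence is constant.
  · simp only [henergy, dissipation_truncated hL]
    exact tendsto_const_nhds
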